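/- **Notation.** $D_r=\{|\xi|<r\}$, $D=D_1$; $f'=\partial_\xi f$. For $E\subset\mathbb C$, $H(E)$ is the set of functions analytic in a neighbourhood of $E$, and $\omega(E)$ the set of $f\in H(E)$ that are locally univalent (injective near every point of $E$) with $f(0)=0$, $f'(0)>0$. The space $H(D_r)\cap C(\overline{D_r})$ carries the supremum norm. For $g$ on $\partial D$ put $P[g](\xi)=\frac1{2\pi i}\int_{\partial D}g(z)\frac{z+\xi}{z-\xi}\frac{dz}{z}$, $\xi\in D$. A *strong\* solution* on $[0,T]$ is a family $f(\cdot,t)\in\omega(\overline D)$, $0\le t\le T$, continuously differentiable in $t$, with $$f_t=\xi f'\,P\Big[\frac1{|f'|^2}\Big],\qquad \xi\in D,\ 0\le t\le T .\tag{1}$$ Put $\big|\sum_{i\ge0}a_i\xi^i\big|_{M(r)}=\sum_{i\ge0}|a_i|r^i$ and $\big\|\sum_{j}v_j\xi^j\big\|_{\rho,n}=\sum_{j\ge1}|v_j|\rho^jj^{\frac12+n}$. **Theorem.** There are constants $c(j,k)>0$ $(j,k\ge0)$, depending on $j$ and $k$ only, such that the following holds. Let $r>1$, $t_1>0$, $l<1$,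 and let $f_{k_0}\in C^1([0,t_1],H(\overline{D_r}))$, with $f_{k_0}(\cdot,t)\in\omega(\overline{D_r})$ for $0\le t\le t_1$, be a strong\* solution of (1) on $[0,t_1]$ such that $f_{k_0}(\cdot,t)$ is a polynomial of degree $k_0$ for every $t$. Put $m=\min_{\overline{D_r}\times[0,t_1]}|f_{k_0}'|$. Then there is a constant $C=C(f_{k_0},t_1,r,l)>0$ such that for every $\rho>r$ and every function $f_0$ analytic in $D_\rho$ with $f_0(0)=0$, $f_0'(0)\in\mathbb R$ and $$\|f_0-f_{k_0}(\cdot,0)\|_{\rho,1}\le\frac{l}{\sqrt{k_0}}\,m ,$$ with $t_0=\min\big\{\frac1{Ck_0}\ln\frac\rho r,\ t_1\big\}$ there is a strong\* solution $f$ of (1) on $[0,t_0]$ with $f(\cdot,0)=f_0$ on $\overline{D_r}$, $f\in C^1([0,t_0],H(D_r)\cap C(\overline{D_r}))$ and $f(\cdot,t)\in\omega(D_r)$ for $0\le t\le t_0$, which has the following properties. (a) $\max_{0\le t\le t_0}|f'-f_{k_0}'|_{M(r)}\le l\,m$. Moreover $f$ is a limit of polynomial solutions: writing $f_0-f_{k_0}(\cdot,0)=\sum_{i\ge1}b_i\xi^i$,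 there are, for $k\ge0$, polynomial strong\* solutions $g_k\in C^1([0,t_0],H(\overline{D_r}))$ of (1) on $[0,t_0]$ with $g_k(\cdot,t)\in\omega(\overline{D_r})$ and $g_k(\cdot,0)=f_{k_0}(\cdot,0)+\sum_{i=1}^kb_i\xi^i$, and $\sup_{0\le t\le t_0}|g_k'-f'|_{M(r)}\to0$ as $k\to\infty$. (b) If $j\ge0$ is an integer and $\delta>0$ are such that $\|f_0-f_{k_0}(\cdot,0)\|_{\rho,j}\le\delta$, then $\max_{0\le t\le t_0}|f^{(j)}-f_{k_0}^{(j)}|_{M(r)}\le c(j,k_0)\,\delta$. -/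

import Mathlib

open Set Metric Filter Topology Polynomial

noncomputable section

namespace HeleShaw

/-- `f` belongs to `ω(E)`: it is analytic in a neighbourhood of every point of `E`, locally
univalent (injective on a full neighbourhood in `ℂ` of every point of `E`), `f 0 = 0`, and
`f' 0` is a positive real number. -/
structure IsOmega (E : Set ℂ) (f : ℂ → ℂ) : Prop where
  analytic : AnalyticOnNhd ℂ f E
  locallyUnivalent : ∀ z ∈ E, ∃ U ∈ 𝓝 z, InjOn f U
  map_zero : f 0 = 0
  deriv_im : (deriv f 0).im = 0
  deriv_re : 0 < (deriv f 0).re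

/-- `P[g](ξ) = (1 / 2πi) ∫_{∂D} g(z) (z + ξ) / (z - ξ) dz / z`. -/
def poissonOp (g : ℂ → ℝ) (ξ : ℂ) : ℂ :=
  (2 * (Real.pi : ℂ) * Complex.I)⁻¹ *
    ∮ z in C(0, 1), (g z : ℂ) * ((z + ξ) / (z - ξ)) / z

/-- `f` is a strong* solution of `f_t = ξ f' P[1 / |f'|²]` for `0 ≤ t ≤ T` (one-sided time
derivatives at the ends of the interval). -/
structure IsStrongStar (T : ℝ) (f : ℝ → ℂ → ℂ) : Prop where
  mem_omega : ∀ t ∈ Icc 0 T, IsOmega (closedBall 0 1) (f t)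
  contDiff_time : ∀ ξ ∈ closedBall (0 : ℂ) 1, ContDiffOn ℝ 1 (fun t => f t ξ) (Icc 0 T)
  equation : ∀ t ∈ Icc 0 T, ∀ ξ ∈ ball (0 : ℂ) 1,
    HasDerivWithinAt (fun s => f s ξ)
      (ξ * deriv (f t) ξ * poissonOp (fun z => 1 / ‖deriv (f t) z‖ ^ 2) ξ) (Icc 0 T) t

/-- `t ↦ f(·, t)` is a `C¹` curve on `[0, T]` with values in the Banach space of continuous
functions on the closed disk of radius `R`, with the supremum norm. -/
def IsC1Curve (R T : ℝ) (f : ℝ → ℂ → ℂ) : Prop :=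
  ∃ F : ℝ → C(closedBall (0 : ℂ) R, ℂ),
    (∀ t ∈ Icc 0 T, ∀ z : closedBall (0 : ℂ) R, F t z = f t z) ∧ ContDiffOn ℝ 1 F (Icc 0 T)

/-- `f ∈ C¹([0, T], H(D_r) ∩ C(closure D_r))`. The space `H(D_r) ∩ C(closure D_r)` carries the
supremum norm, and is closed in `C(closure D_r)`. -/
def IsC1Open (r T : ℝ) (f : ℝ → ℂ → ℂ) : Prop :=
  (∀ t ∈ Icc 0 T, AnalyticOnNhd ℂ (f t) (ball 0 r)) ∧ IsC1Curve r T f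

/-- `f ∈ C¹([0, T], H(closure D_r))`, where `H(closure D_r)` consists of the functions analytic
in a neighbourhood of the closed disk: `f` is a `C¹` curve of analytic functions on some larger
closed disk. -/
def IsC1Closed (r T : ℝ) (f : ℝ → ℂ → ℂ) : Prop :=
  ∃ R > r, (∀ t ∈ Icc 0 T, AnalyticOnNhd ℂ (f t) (closedBall 0 R)) ∧ IsC1Curve R T f

/-- The coefficient of `ξ ^ i` in the Taylor series of `φ` at `0`. -/
def coeffAt (φ : ℂ → ℂ) (i : ℕ) : ℂ := iteratedDeriv i φ 0 / (i.factorial : ℂ)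

/-- `|Σ aᵢ ξ^i|_{M(r)} = Σ_{i ≥ 0} |aᵢ| r^i`, possibly infinite. -/
def mNorm (r : ℝ) (φ : ℂ → ℂ) : ENNReal :=
  ∑' i : ℕ, ENNReal.ofReal (‖coeffAt φ i‖ * r ^ i)

/-- `‖Σ vⱼ ξ^j‖_{ρ,n} = Σ_{j ≥ 1} |vⱼ| ρ^j j^{1/2 + n}`, possibly infinite. -/
def rhoNorm (ρ : ℝ) (n : ℕ) (v : ℂ → ℂ) : ENNReal :=
  ∑' j : ℕ, ENNReal.ofReal
    (‖coeffAt v (j + 1)‖ * ρ ^ (j + 1) * ((j : ℝ) + 1) ^ ((1 : ℝ) / 2 + (n : ℝ)))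

/-- The family of functions given by a time-dependent polynomial. -/
def polyFun (p : ℝ → ℂ[X]) (t : ℝ) (z : ℂ) : ℂ := (p t).eval z

/-- The minimum of `|f'(ξ, t)|` over `|ξ| ≤ r`, `0 ≤ t ≤ T`. -/
def minDeriv (r T : ℝ) (f : ℝ → ℂ → ℂ) : ℝ :=
  sInf ((fun q : ℂ × ℝ => ‖deriv (f q.2) q.1‖) '' (closedBall (0 : ℂ) r ×ˢ Icc (0 : ℝ) T))

end HeleShaw

end

/-!
If `f` is a polynomial, then `f' P[1 / |f'|²]` is a polynomial of degree less than that of `f`: on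
the unit circle the equation `Re (s / B) = 1 / |B|²` for `B = f'` amounts to a linear system for the
coefficients of `s`, which is uniquely solvable because `B` has no zeros in the closed disk. Hence
(1) is an ordinary differential equation on the polynomials of degree at most `K`. As long as
`μ ≤ |f'| ≤ M` on `D_r`, the velocity `s` is a Lipschitz function of `f'` in the Hardy space norm of
`D_r`, with a constant that does not depend on the degree, so that by Gronwall's inequality the
distance of two solutions of degree at most `K` grows at most like `exp (c K t)`.

The perturbation of the initial value is added one coefficient at a time. The solutions with and
without the term `b_k ξ^k` have degree at most `max k k₀ ≤ k₀ k`, and `exp (c k₀ k t) ≤ (ρ / r) ^ k`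
for `t ≤ t₀`. So their distance, measured on `D_r`, is controlled by `|b_k| ρ ^ k`, up to powers of
`k` and a factor `√k₀` from the Cauchy-Schwarz inequality. The sum of these distances stays below
`m`, which keeps the derivatives away from zero and lets all these solutions exist up to `t₀`, and
it makes them converge.
-/

noncomputable section

namespace HeleShaw

open scoped ComplexConjugate NNReal

/-! ### Reflection of polynomials in the unit circle -/

section StarReflect

variable {R : Type*} [CommSemiring R] [StarRing R]

/-- The conjugate reciprocal `X ^ N * conj (p (1 / conj X))` of a polynomial `p` of degree at most
`N`: on the unit circle, `z ^ N` times the conjugate of `p z`. -/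
def starReflect (N : ℕ) (p : R[X]) : R[X] := (p.map (starRingEnd R)).reflect N

theorem coeff_starReflect (N n : ℕ) (p : R[X]) :
    (starReflect N p).coeff n = conj (p.coeff (revAt N n)) := by
  simp [starReflect, coeff_reflect]

theorem starReflect_add (N : ℕ) (p q : R[X]) :
    starReflect N (p + q) = starReflect N p + starReflect N q := by
  simp [starReflect]

theorem starReflect_C_mul (N : ℕ) (a : R) (p : R[X]) :
    starReflect N (C a * p) = C (conj a) * starReflect N p := by
  simp [starReflect, reflect_C_mul]

theorem starReflect_starReflect (N : ℕ) (p : R[X]) : starReflect N (starReflect N p) = p := by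
  ext n
  simp [coeff_starReflect]

theorem natDegree_starReflect_le {N : ℕ} {p : R[X]} (hp : p.natDegree ≤ N) :
    (starReflect N p).natDegree ≤ N :=
  natDegree_reflect_le.trans (max_le le_rfl (natDegree_map_le.trans hp))

theorem starReflect_mul {N M : ℕ} {p q : R[X]} (hp : p.natDegree ≤ N) (hq : q.natDegree ≤ M) :
    starReflect (N + M) (p * q) = starReflect N p * starReflect M q := by
  rw [starReflect, Polynomial.map_mul]
  exact reflect_mul _ _ (natDegree_map_le.trans hp) (natDegree_map_le.trans hq)

end StarReflect

theorem eval_starReflect {K : Type*} [Field K] [StarRing K] {N : ℕ} {p : K[X]}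
    (hp : p.natDegree ≤ N) {z : K} (hz : z ≠ 0) :
    (starReflect N p).eval z = z ^ N * conj (p.eval (conj z)⁻¹) := by
  let _ : Invertible z := invertibleOfNonzero hz
  have h := eval₂_reflect_mul_pow (RingHom.id K) z N _ (natDegree_starReflect_le hp)
  rw [starReflect, reflect_reflect] at h
  rw [starReflect, ← eval₂_id, ← h, mul_comm, eval₂_id, eval_map, ← eval₂_id (p := p),
    Polynomial.hom_eval₂]
  simp

theorem inv_conj_of_norm_eq {r : ℝ} {z : ℂ} (hz : ‖z‖ = r) : (conj z)⁻¹ = z / (r : ℂ) ^ 2 := by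
  rw [Complex.inv_def, Complex.conj_conj, Complex.normSq_conj, Complex.normSq_eq_norm_sq, hz,
    div_eq_mul_inv]
  push_cast
  rfl

/-- The symmetrization `s B* + s* B`, where `*` is `starReflect N`. On the unit circle it is
`z ^ N` times twice the real part of `s * conj B`. -/
def symmProd (N : ℕ) (B s : ℂ[X]) : ℂ[X] := s * starReflect N B + starReflect N s * B

theorem eval_symmProd {N : ℕ} {B s : ℂ[X]} (hB : B.natDegree ≤ N) (hs : s.natDegree ≤ N)
    {r : ℝ} {z : ℂ} (hz0 : z ≠ 0) (hz : ‖z‖ = r) :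
    (symmProd N B s).eval z = z ^ N * (s.eval z * conj (B.eval (z / (r : ℂ) ^ 2)) +
      conj (s.eval (z / (r : ℂ) ^ 2)) * B.eval z) := by
  simp only [symmProd, eval_add, eval_mul, eval_starReflect hB hz0, eval_starReflect hs hz0,
    inv_conj_of_norm_eq hz]
  ring

theorem eval_symmProd_of_norm_eq_one {N : ℕ} {B s : ℂ[X]} (hB : B.natDegree ≤ N)
    (hs : s.natDegree ≤ N) {z : ℂ} (hz : ‖z‖ = 1) :
    (symmProd N B s).eval z =
      z ^ N * (s.eval z * conj (B.eval z) + conj (s.eval z) * B.eval z) := by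
  simpa using eval_symmProd hB hs (norm_pos_iff.1 (hz ▸ one_pos)) hz

theorem symmProd_add (N : ℕ) (B s t : ℂ[X]) :
    symmProd N B (s + t) = symmProd N B s + symmProd N B t := by
  simp only [symmProd, starReflect_add]
  ring

theorem symmProd_real_smul (N : ℕ) (B s : ℂ[X]) (a : ℝ) :
    symmProd N B (a • s) = a • symmProd N B s := by
  have h : ∀ p : ℂ[X], a • p = C (a : ℂ) * p := fun p => by
    rw [← smul_eq_C_mul, Complex.coe_smul]
  simp only [symmProd, h, starReflect_C_mul, Complex.conj_ofReal]
  ring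

theorem starReflect_symmProd {N : ℕ} {B s : ℂ[X]} (hB : B.natDegree ≤ N) (hs : s.natDegree ≤ N) :
    starReflect (N + N) (symmProd N B s) = symmProd N B s := by
  rw [symmProd, starReflect_add, starReflect_mul hs (natDegree_starReflect_le hB),
    starReflect_mul (natDegree_starReflect_le hs) hB, starReflect_starReflect,
    starReflect_starReflect, add_comm]

theorem natDegree_symmProd_le {N : ℕ} {B s : ℂ[X]} (hB : B.natDegree ≤ N)
    (hs : s.natDegree ≤ N) : (symmProd N B s).natDegree ≤ N + N :=
  natDegree_add_le_of_degree_le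
    (natDegree_mul_le_of_le hs (natDegree_starReflect_le hB))
    (natDegree_mul_le_of_le (natDegree_starReflect_le hs) hB)

theorem im_coeff_symmProd {N : ℕ} {B s : ℂ[X]} (hB : B.natDegree ≤ N) (hs : s.natDegree ≤ N) :
    ((symmProd N B s).coeff N).im = 0 := by
  have h := congrArg (fun p => coeff p N) (starReflect_symmProd hB hs)
  simp only [coeff_starReflect, revAt_le (Nat.le_add_left N N), Nat.add_sub_cancel] at h
  exact Complex.conj_eq_iff_im.1 h

theorem symmProd_eq_C_mul_X_pow {N : ℕ} {B s : ℂ[X]} (hB : B.natDegree ≤ N)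
    (hs : s.natDegree ≤ N) {a : ℂ} (h0 : (symmProd N B s).coeff N = a)
    (hpos : ∀ n, 0 < n → n ≤ N → (symmProd N B s).coeff (N + n) = 0) :
    symmProd N B s = C a * X ^ N := by
  ext n
  rw [coeff_C_mul_X_pow]
  rcases lt_trichotomy n N with hn | hn | hn
  · rw [if_neg (by omega), ← starReflect_symmProd hB hs, coeff_starReflect, revAt_le (by omega),
      show N + N - n = N + (N - n) by omega, hpos _ (by omega) (by omega), map_zero]
  · rw [if_pos hn, hn, h0]
  · rw [if_neg (by omega)]
    rcases le_or_gt n (N + N) with h2 | h2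
    · rw [show n = N + (n - N) by omega, hpos _ (by omega) (by omega)]
    · exact coeff_eq_zero_of_natDegree_lt (lt_of_le_of_lt (natDegree_symmProd_le hB hs) h2)

/-! ### The Schwarz integral formula -/

theorem circleAverage_conj {g : ℂ → ℂ} {c : ℂ} {R : ℝ} (hg : CircleIntegrable g c R) :
    Real.circleAverage (fun z => conj (g z)) c R = conj (Real.circleAverage g c R) :=
  (Complex.conjCLE : ℂ →L[ℝ] ℂ).circleAverage_comp_comm hg

theorem circleAverage_re {g : ℂ → ℂ} {c : ℂ} {R : ℝ} (hg : CircleIntegrable g c R) :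
    Real.circleAverage (fun z => (g z).re) c R = (Real.circleAverage g c R).re :=
  Complex.reCLM.circleAverage_comp_comm hg

section Schwarz

variable {φ : ℂ → ℂ} {c ξ : ℂ} {R : ℝ}

theorem circleAverage_herglotzRieszKernel_mul (hφ : DiffContOnCl ℂ φ (ball c |R|))
    (hξ : ξ ∈ ball c |R|) :
    Real.circleAverage (fun z => herglotzRieszKernel c ξ z * φ z) c R = 2 * φ ξ - φ c := by
  have hne : ∀ z ∈ sphere c |R|, z - ξ ≠ 0 := fun z hz h =>
    (mem_sphere.1 hz).not_lt (by rw [sub_eq_zero.1 h]; exact mem_ball.1 hξ)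
  have hφc : ContinuousOn φ (sphere c |R|) := hφ.continuousOn_ball.mono sphere_subset_closedBall
  have : ContinuousOn (fun z => (z - c) / (z - ξ)) (sphere c |R|) :=
    ContinuousOn.div (by fun_prop) (by fun_prop) hne
  have hquot : ContinuousOn (fun z => (2 : ℂ) • ((z - c) / (z - ξ) * φ z)) (sphere c |R|) := by
    fun_prop
  have hcauchy := hφ.circleAverage_smul_div hξ
  have hmean := hφ.circleAverage
  have hsplit : ∀ z ∈ sphere c |R|, herglotzRieszKernel c ξ z * φ z =
      (2 : ℂ) • ((z - c) / (z - ξ) * φ z) - φ z := fun z hz => by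
    have := hne z hz
    rw [herglotzRieszKernel_def, sub_sub_sub_cancel_right, smul_eq_mul]
    field_simp
    ring
  rw [Real.circleAverage_congr_sphere hsplit, Real.circleAverage_fun_sub
    hquot.circleIntegrable' hφc.circleIntegrable', Real.circleAverage_fun_smul, hmean]
  simp only [smul_eq_mul] at hcauchy ⊢
  rw [hcauchy]

theorem circleAverage_conj_herglotzRieszKernel_mul (hφ : DiffContOnCl ℂ φ (ball c |R|))
    (hξ : ξ ∈ ball c |R|) :
    Real.circleAverage (fun z => conj (herglotzRieszKernel c ξ z) * φ z) c R = φ c := by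
  have hφc : ContinuousOn φ (sphere c |R|) := hφ.continuousOn_ball.mono sphere_subset_closedBall
  have hK : ContinuousOn (herglotzRieszKernel c ξ) (sphere c |R|) := by
    simpa using continuousOn_herglotzRieszKernel_sphere hξ
  have hpoisson :
      Real.circleAverage (fun z => (herglotzRieszKernel c ξ z).re • φ z) c R = φ ξ :=
    Real.circleAverage_abs_radius.symm.trans (hφ.circleAverage_re_herglotzRieszKernel_smul hξ)
  have hsplit : (fun z => conj (herglotzRieszKernel c ξ z) * φ z) = fun z =>
      (2 : ℝ) • ((herglotzRieszKernel c ξ z).re • φ z) - herglotzRieszKernel c ξ z * φ z := by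
    funext z
    have := Complex.add_conj (herglotzRieszKernel c ξ z)
    simp only [Complex.real_smul]
    push_cast at this ⊢
    linear_combination φ z * this
  have hre : ContinuousOn (fun z => (2 : ℝ) • ((herglotzRieszKernel c ξ z).re • φ z))
      (sphere c |R|) := by fun_prop
  have hKφ : ContinuousOn (fun z => herglotzRieszKernel c ξ z * φ z) (sphere c |R|) :=
    hK.mul hφc
  rw [hsplit, Real.circleAverage_fun_sub hre.circleIntegrable' hKφ.circleIntegrable',
    Real.circleAverage_fun_smul, circleAverage_herglotzRieszKernel_mul hφ hξ,
    hpoisson, Complex.real_smul]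
  push_cast
  ring

theorem circleAverage_herglotzRieszKernel_mul_re (hφ : DiffContOnCl ℂ φ (ball c |R|))
    (hξ : ξ ∈ ball c |R|) :
    Real.circleAverage (fun z => herglotzRieszKernel c ξ z * ((φ z).re : ℂ)) c R =
      φ ξ - (φ c).im * Complex.I := by
  have hφc : ContinuousOn φ (sphere c |R|) := hφ.continuousOn_ball.mono sphere_subset_closedBall
  have hK : ContinuousOn (herglotzRieszKernel c ξ) (sphere c |R|) := by
    simpa using continuousOn_herglotzRieszKernel_sphere hξ
  have hconj : ContinuousOn (fun z => conj (herglotzRieszKernel c ξ z) * φ z) (sphere c |R|) :=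
    ContinuousOn.mul (Complex.continuous_conj.comp_continuousOn hK) hφc
  have hconj' : ContinuousOn (fun z => conj (conj (herglotzRieszKernel c ξ z) * φ z))
      (sphere c |R|) := Complex.continuous_conj.comp_continuousOn hconj
  have hKφ : ContinuousOn (fun z => herglotzRieszKernel c ξ z * φ z) (sphere c |R|) := by fun_prop
  have hsplit : (fun z => herglotzRieszKernel c ξ z * ((φ z).re : ℂ)) = fun z => (2⁻¹ : ℂ) •
      (herglotzRieszKernel c ξ z * φ z + conj (conj (herglotzRieszKernel c ξ z) * φ z)) := by
    funext z
    rw [map_mul, Complex.conj_conj, ← mul_add, Complex.add_conj, smul_eq_mul]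
    push_cast
    ring
  rw [hsplit, Real.circleAverage_fun_smul, Real.circleAverage_fun_add
    hKφ.circleIntegrable' hconj'.circleIntegrable',
    circleAverage_conj hconj.circleIntegrable', circleAverage_herglotzRieszKernel_mul hφ hξ,
    circleAverage_conj_herglotzRieszKernel_mul hφ hξ, smul_eq_mul]
  have := Complex.sub_conj (φ c)
  push_cast at this
  linear_combination (-2⁻¹ : ℂ) * this

end Schwarz

theorem poissonOp_eq_circleAverage (g : ℂ → ℝ) (ξ : ℂ) :
    poissonOp g ξ = Real.circleAverage (fun z => herglotzRieszKernel 0 ξ z * (g z : ℂ)) 0 1 := by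
  rw [Real.circleAverage_eq_circleIntegral one_ne_zero, poissonOp, smul_eq_mul]
  congr 1
  refine circleIntegral.integral_congr zero_le_one fun z _ => ?_
  simp only [herglotzRieszKernel_def, sub_zero, smul_eq_mul]
  ring

theorem poissonOp_congr {g h : ℂ → ℝ} (hgh : EqOn g h (sphere 0 1)) (ξ : ℂ) :
    poissonOp g ξ = poissonOp h ξ := by
  simp only [poissonOp_eq_circleAverage]
  refine Real.circleAverage_congr_sphere fun z hz => ?_
  rw [hgh (by simpa using hz)]

theorem poissonOp_zero (ξ : ℂ) : poissonOp (fun _ => 0) ξ = 0 := by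
  simp [poissonOp, circleIntegral]

theorem poissonOp_re {φ : ℂ → ℂ} (hφ : DiffContOnCl ℂ φ (ball 0 1)) (h0 : (φ 0).im = 0)
    {ξ : ℂ} (hξ : ξ ∈ ball 0 1) : poissonOp (fun z => (φ z).re) ξ = φ ξ := by
  rw [← abs_one] at hφ hξ
  rw [poissonOp_eq_circleAverage, circleAverage_herglotzRieszKernel_mul_re hφ hξ, h0]
  simp

theorem norm_herglotzRieszKernel_le {z ξ : ℂ} (hz : ‖z‖ = 1) (hξ : ‖ξ‖ < 1) :
    ‖herglotzRieszKernel 0 ξ z‖ ≤ (1 + ‖ξ‖) / (1 - ‖ξ‖) := by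
  have hnum : ‖z + ξ‖ ≤ 1 + ‖ξ‖ := hz ▸ norm_add_le z ξ
  have hden : 1 - ‖ξ‖ ≤ ‖z - ξ‖ := hz ▸ norm_sub_norm_le z ξ
  have : 0 < 1 - ‖ξ‖ := by linarith
  rw [herglotzRieszKernel_def, sub_zero, sub_zero, norm_div]
  gcongr

theorem norm_poissonOp_le {g : ℂ → ℝ} {A : ℝ} (hg : ∀ z : ℂ, ‖z‖ = 1 → |g z| ≤ A) {ξ : ℂ}
    (hξ : ‖ξ‖ < 1) : ‖poissonOp g ξ‖ ≤ A * ((1 + ‖ξ‖) / (1 - ‖ξ‖)) := by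
  have h := circleIntegral.norm_two_pi_i_inv_smul_integral_le_of_norm_le_const
    (f := fun z => (g z : ℂ) * ((z + ξ) / (z - ξ)) / z) (c := 0) (R := 1)
    (C := A * ((1 + ‖ξ‖) / (1 - ‖ξ‖))) zero_le_one fun z hz => ?_
  · simpa [poissonOp] using h
  · have hz : ‖z‖ = 1 := by simpa using hz
    have hA : 0 ≤ A := (abs_nonneg _).trans (hg z hz)
    have hK := norm_herglotzRieszKernel_le hz hξ
    rw [herglotzRieszKernel_def, sub_zero, sub_zero] at hK
    rw [norm_div, hz, div_one, norm_mul, Complex.norm_real, Real.norm_eq_abs]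
    exact mul_le_mul (hg z hz) hK (norm_nonneg _) hA

/-! ### The velocity polynomial -/

theorem eq_zero_of_eval_eq_zero_of_norm_eq_one {p : ℂ[X]} (h : ∀ z : ℂ, ‖z‖ = 1 → p.eval z = 0) :
    p = 0 := by
  have hconn : IsPreconnected (sphere (0 : ℂ) 1) :=
    isPreconnected_sphere (by simp [Complex.rank_real_complex]) 0 1
  have hinf : (sphere (0 : ℂ) 1).Infinite :=
    hconn.infinite_of_nontrivial ⟨1, by simp, -1, by simp, by norm_num⟩
  exact p.eq_zero_of_infinite_isRoot (hinf.mono fun z hz => h z (mem_sphere_zero_iff_norm.1 hz))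

theorem two_mul_re_div (a b : ℂ) :
    2 * (a / b).re = (a * conj b + conj a * b).re / ‖b‖ ^ 2 := by
  rw [Complex.div_re, ← Complex.normSq_eq_norm_sq]
  simp only [Complex.add_re, Complex.mul_re, Complex.conj_re, Complex.conj_im]
  ring

theorem diffContOnCl_eval_div {s B : ℂ[X]} {r : ℝ} (hB : ∀ z : ℂ, ‖z‖ ≤ r → B.eval z ≠ 0) :
    DiffContOnCl ℂ (fun z => s.eval z / B.eval z) (ball 0 r) :=
  DifferentiableOn.diffContOnCl_ball (U := closedBall 0 r)
    (DifferentiableOn.div (by fun_prop) (by fun_prop) fun z hz => hB z (by simpa using hz)) le_rfl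

/-- `s` is the velocity polynomial of `B`: the quotient `s / B` has real part `1 / |B| ^ 2` on the
unit circle and is real at the origin. -/
structure IsVelocity (B s : ℂ[X]) : Prop where
  im_eq : (s.eval 0 / B.eval 0).im = 0
  circle : ∀ z : ℂ, ‖z‖ = 1 → s.eval z * conj (B.eval z) + conj (s.eval z) * B.eval z = 2

theorem IsVelocity.eval_div_eq_poissonOp {B s : ℂ[X]} (h : IsVelocity B s)
    (hB : ∀ z : ℂ, ‖z‖ ≤ 1 → B.eval z ≠ 0) {ξ : ℂ} (hξ : ξ ∈ ball 0 1) :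
    s.eval ξ / B.eval ξ = poissonOp (fun z => 1 / ‖B.eval z‖ ^ 2) ξ := by
  rw [← poissonOp_re (diffContOnCl_eval_div hB) h.im_eq hξ]
  refine poissonOp_congr (fun z hz => ?_) ξ
  have hz : ‖z‖ = 1 := by simpa using hz
  have hre := two_mul_re_div (s.eval z) (B.eval z)
  rw [h.circle z hz, Complex.re_ofNat] at hre
  linear_combination hre / 2

theorem eq_zero_of_re_eq_zero {B s : ℂ[X]} (hB : ∀ z : ℂ, ‖z‖ ≤ 1 → B.eval z ≠ 0)
    (h0 : (s.eval 0 / B.eval 0).im = 0)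
    (h : ∀ z : ℂ, ‖z‖ = 1 → s.eval z * conj (B.eval z) + conj (s.eval z) * B.eval z = 0) :
    s = 0 := by
  have hzero : ∀ ξ ∈ ball (0 : ℂ) 1, s.eval ξ = 0 := fun ξ hξ => by
    have hre : EqOn (fun z => (s.eval z / B.eval z).re) (fun _ => 0) (sphere 0 1) := fun z hz => by
      have hz : ‖z‖ = 1 := by simpa using hz
      simpa [h z hz] using two_mul_re_div (s.eval z) (B.eval z)
    have hquot := poissonOp_re (diffContOnCl_eval_div hB) h0 hξ
    rw [poissonOp_congr hre, poissonOp_zero] at hquot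
    exact (div_eq_zero_iff.1 hquot.symm).resolve_right (hB ξ (mem_ball_zero_iff.1 hξ).le)
  exact s.eq_zero_of_infinite_isRoot
    ((infinite_of_mem_nhds (0 : ℂ) (ball_mem_nhds 0 one_pos)).mono hzero)

theorem IsVelocity.reflect_identity {B s : ℂ[X]} (h : IsVelocity B s) {r : ℝ} {z : ℂ}
    (hz0 : z ≠ 0) (hz : ‖z‖ = r) :
    s.eval z * conj (B.eval (z / (r : ℂ) ^ 2)) + conj (s.eval (z / (r : ℂ) ^ 2)) * B.eval z =
      2 := by
  set N := max B.natDegree s.natDegree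
  have hB : B.natDegree ≤ N := le_max_left _ _
  have hs : s.natDegree ≤ N := le_max_right _ _
  have hpoly : symmProd N B s - C 2 * X ^ N = 0 := by
    refine eq_zero_of_eval_eq_zero_of_norm_eq_one fun w hw => ?_
    rw [eval_sub, eval_symmProd_of_norm_eq_one hB hs hw, h.circle w hw, eval_C_mul, eval_pow,
      eval_X]
    ring
  have heval := congrArg (eval z) hpoly
  rw [eval_sub, eval_symmProd hB hs hz0 hz, eval_C_mul, eval_pow, eval_X, eval_zero] at heval
  exact mul_left_cancel₀ (pow_ne_zero N hz0) (by linear_combination heval)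

/-- The real-linear map whose value at the coefficients of `s` records the upper half of the
coefficients of `symmProd N B s`, the (automatically vanishing) imaginary part of the middle one
being replaced by that of `s / B` at the origin. Solving a linear system for this map produces the
velocity polynomial. -/
def velocityMap (N : ℕ) (B : ℂ[X]) : (Fin (N + 1) → ℂ) →ₗ[ℝ] (Fin (N + 1) → ℂ) where
  toFun x i := (symmProd N B (ofFn (N + 1) x)).coeff (N + i) +
    if (i : ℕ) = 0 then (((ofFn (N + 1) x).eval 0 / B.eval 0).im : ℂ) * Complex.I else 0
  map_add' x y := by
    funext i
    simp only [map_add, symmProd_add, coeff_add, eval_add, add_div, Complex.add_im, Pi.add_apply]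
    split_ifs <;> push_cast <;> ring
  map_smul' a x := by
    funext i
    simp only [LinearMap.map_smul_of_tower, symmProd_real_smul, coeff_smul, eval_smul,
      mul_div_assoc, Complex.im_ofReal_mul, RingHom.id_apply, Pi.smul_apply, Complex.real_smul]
    split_ifs <;> push_cast <;> ring

theorem velocityMap_spec {N : ℕ} {B : ℂ[X]} (hB : B.natDegree ≤ N) {x : Fin (N + 1) → ℂ} {a : ℝ}
    (h : velocityMap N B x = Pi.single 0 (a : ℂ)) :
    ((ofFn (N + 1) x).eval 0 / B.eval 0).im = 0 ∧
      ∀ z : ℂ, ‖z‖ = 1 → (ofFn (N + 1) x).eval z * conj (B.eval z) +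
        conj ((ofFn (N + 1) x).eval z) * B.eval z = a := by
  set s := ofFn (N + 1) x with hs_def
  have hs : s.natDegree ≤ N := Nat.lt_succ_iff.1 (ofFn_natDegree_lt N.succ_pos x)
  have h0 : (symmProd N B s).coeff N + ((s.eval 0 / B.eval 0).im : ℂ) * Complex.I = a := by
    simpa [velocityMap, ← hs_def] using congrFun h 0
  have him : (s.eval 0 / B.eval 0).im = 0 := by
    simpa [im_coeff_symmProd hB hs] using congrArg Complex.im h0
  refine ⟨him, fun z hz => ?_⟩
  rw [him, Complex.ofReal_zero, zero_mul, add_zero] at h0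
  have hpos : ∀ n, 0 < n → n ≤ N → (symmProd N B s).coeff (N + n) = 0 := fun n hn hnN => by
    have hne : (⟨n, Nat.lt_succ_iff.2 hnN⟩ : Fin (N + 1)) ≠ 0 := by simpa [Fin.ext_iff] using hn.ne'
    simpa [velocityMap, ← hs_def, hn.ne', hne] using congrFun h ⟨n, Nat.lt_succ_iff.2 hnN⟩
  have heval := congrArg (eval z) (symmProd_eq_C_mul_X_pow hB hs h0 hpos)
  rw [eval_symmProd_of_norm_eq_one hB hs hz, eval_C_mul, eval_pow, eval_X, mul_comm] at heval
  exact mul_right_cancel₀ (pow_ne_zero N (norm_pos_iff.1 (hz ▸ one_pos))) heval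

theorem exists_isVelocity {N : ℕ} {B : ℂ[X]} (hB : B.natDegree ≤ N)
    (hB0 : ∀ z : ℂ, ‖z‖ ≤ 1 → B.eval z ≠ 0) :
    ∃ s : ℂ[X], s.natDegree ≤ N ∧ IsVelocity B s := by
  have hinj : Function.Injective (velocityMap N B) := by
    refine (injective_iff_map_eq_zero _).2 fun x hx => injective_ofFn (N + 1) ?_
    obtain ⟨him, hcircle⟩ := velocityMap_spec (x := x) (a := 0) hB (by simp [hx])
    rw [map_zero]
    exact eq_zero_of_re_eq_zero hB0 him (by simpa using hcircle)
  obtain ⟨x, hx⟩ := LinearMap.surjective_of_injective hinj (Pi.single 0 ((2 : ℝ) : ℂ))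
  obtain ⟨him, hcircle⟩ := velocityMap_spec hB hx
  exact ⟨ofFn (N + 1) x, Nat.lt_succ_iff.1 (ofFn_natDegree_lt N.succ_pos x), him,
    by simpa using hcircle⟩

open Classical in
/-- The velocity polynomial `B * P[1 / |B| ^ 2]` of a polynomial `B` without zeros in the closed
unit disk (and `0` when there is no velocity polynomial). -/
def velocity (B : ℂ[X]) : ℂ[X] :=
  if h : ∃ s, s.natDegree ≤ B.natDegree ∧ IsVelocity B s then h.choose else 0

theorem velocity_spec {B : ℂ[X]} (hB : ∀ z : ℂ, ‖z‖ ≤ 1 → B.eval z ≠ 0) :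
    (velocity B).natDegree ≤ B.natDegree ∧ IsVelocity B (velocity B) := by
  have h := exists_isVelocity le_rfl hB
  rw [velocity, dif_pos h]
  exact h.choose_spec

/-! ### Mean square norms on circles -/

theorem circleAverage_comp_div_sq {E : Type*} [NormedAddCommGroup E] [NormedSpace ℝ E] (f : ℂ → E)
    {r : ℝ} (hr : r ≠ 0) :
    Real.circleAverage (fun z => f (z / (r : ℂ) ^ 2)) 0 r = Real.circleAverage f 0 r⁻¹ := by
  rw [Real.circleAverage_eq_circleAverage_zero_one,
    Real.circleAverage_eq_circleAverage_zero_one (R := r⁻¹)]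
  congr 1 with z
  have : (r : ℂ) ≠ 0 := Complex.ofReal_ne_zero.2 hr
  congr 1
  push_cast
  field_simp
  ring

theorem mapsTo_div_sq_closedBall {r : ℝ} (hr : 1 ≤ r) :
    MapsTo (fun z : ℂ => z / (r : ℂ) ^ 2) (closedBall 0 r) (closedBall 0 r) := fun z hz => by
  rw [mem_closedBall_zero_iff] at hz ⊢
  rw [norm_div, norm_pow, Complex.norm_real, Real.norm_of_nonneg (by linarith)]
  exact (div_le_self (norm_nonneg z) (one_le_pow₀ hr)).trans hz

theorem norm_add_conj_sq (a b : ℂ) :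
    ‖a + conj b‖ ^ 2 = ‖a‖ ^ 2 + 2 * (a * b).re + ‖b‖ ^ 2 := by
  simp only [← Complex.normSq_eq_norm_sq, Complex.normSq_apply, Complex.mul_re, Complex.add_re,
    Complex.add_im, Complex.conj_re, Complex.conj_im]
  ring

theorem circleAverage_norm_sq_le_add_conj {φ : ℂ → ℂ} {r : ℝ} (hr : 1 ≤ r)
    (hφ : DifferentiableOn ℂ φ (closedBall 0 r)) :
    Real.circleAverage (fun z => ‖φ z‖ ^ 2) 0 r ≤
      Real.circleAverage (fun z => ‖φ z + conj (φ (z / (r : ℂ) ^ 2))‖ ^ 2) 0 r +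
        2 * (φ 0).im ^ 2 := by
  have hr0 : 0 ≤ r := by linarith
  have hψ : DifferentiableOn ℂ (fun z => φ (z / (r : ℂ) ^ 2)) (closedBall 0 r) :=
    hφ.comp (by fun_prop) (mapsTo_div_sq_closedBall hr)
  have hmul : DifferentiableOn ℂ (fun z => φ z * φ (z / (r : ℂ) ^ 2)) (closedBall 0 r) :=
    hφ.mul hψ
  have hφc : ContinuousOn φ (sphere 0 r) := hφ.continuousOn.mono sphere_subset_closedBall
  have hψc : ContinuousOn (fun z => φ (z / (r : ℂ) ^ 2)) (sphere 0 r) :=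
    hψ.continuousOn.mono sphere_subset_closedBall
  have hmean : Real.circleAverage (fun z => φ z * φ (z / (r : ℂ) ^ 2)) 0 r = φ 0 * φ 0 := by
    simpa using (hmul.diffContOnCl_ball (c := 0) (R := |r|)
      (by rw [abs_of_nonneg hr0])).circleAverage
  have hint : CircleIntegrable (fun z => φ z * φ (z / (r : ℂ) ^ 2)) 0 r :=
    ContinuousOn.circleIntegrable hr0 (hφc.mul hψc)
  have i₁ : CircleIntegrable (fun z => ‖φ z‖ ^ 2) 0 r :=
    ContinuousOn.circleIntegrable hr0 (by fun_prop)
  have i₂ : CircleIntegrable (fun z => (2 : ℝ) • (φ z * φ (z / (r : ℂ) ^ 2)).re) 0 r :=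
    ContinuousOn.circleIntegrable hr0
      ((Complex.continuous_re.comp_continuousOn (hφc.mul hψc)).const_smul (2 : ℝ))
  have i₃ : CircleIntegrable (fun z => ‖φ z + conj (φ (z / (r : ℂ) ^ 2))‖ ^ 2) 0 r :=
    ContinuousOn.circleIntegrable hr0
      ((hφc.add (Complex.continuous_conj.comp_continuousOn hψc)).norm.pow 2)
  have hle := Real.circleAverage_mono (i₁.add i₂) i₃ fun z _ => by
    simp only [Pi.add_apply, smul_eq_mul, norm_add_conj_sq, le_add_iff_nonneg_right, sq_nonneg]
  rw [Real.circleAverage_add i₁ i₂, Real.circleAverage_fun_smul, circleAverage_re hint, hmean,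
    Complex.mul_re, smul_eq_mul] at hle
  nlinarith only [hle, sq_nonneg (φ 0).re]

theorem circleIntegrable_norm_sq_eval (p : ℂ[X]) (c : ℂ) (R : ℝ) :
    CircleIntegrable (fun z => ‖p.eval z‖ ^ 2) c R :=
  (by fun_prop : Continuous fun z => ‖p.eval z‖ ^ 2).continuousOn.circleIntegrable'

/-- The norm of the Hardy space `H²` of the disk of radius `r`. -/
def hardyNorm (r : ℝ) (p : ℂ[X]) : ℝ := √(Real.circleAverage (fun z => ‖p.eval z‖ ^ 2) 0 r)

theorem hardyNorm_nonneg (r : ℝ) (p : ℂ[X]) : 0 ≤ hardyNorm r p := Real.sqrt_nonneg _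

theorem hardyNorm_sq (r : ℝ) (p : ℂ[X]) :
    hardyNorm r p ^ 2 = Real.circleAverage (fun z => ‖p.eval z‖ ^ 2) 0 r :=
  Real.sq_sqrt (Real.circleAverage_nonneg_of_nonneg fun _ _ => by positivity)

theorem hardyNorm_sq_eq_sum {p : ℂ[X]} {K : ℕ} (hp : p.natDegree < K) (r : ℝ) :
    hardyNorm r p ^ 2 = ∑ n ∈ Finset.range K, (‖p.coeff n‖ * r ^ n) ^ 2 := by
  set q := p.comp (C (r : ℂ) * X)
  have hq : ∀ n, ‖q.coeff n‖ ^ 2 = (‖p.coeff n‖ * r ^ n) ^ 2 := fun n => by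
    rw [comp_C_mul_X_coeff, norm_mul, norm_pow, Complex.norm_real, mul_pow, mul_pow, ← pow_mul,
      mul_comm n, pow_mul, Real.norm_eq_abs, sq_abs, ← pow_mul, ← pow_mul, mul_comm n]
  rw [hardyNorm_sq, Real.circleAverage_eq_circleAverage_zero_one]
  calc Real.circleAverage (fun z => ‖p.eval (r * z + 0)‖ ^ 2) 0 1
      = Real.circleAverage (fun z => ‖q.eval z‖ ^ 2) 0 1 := by simp [q, eval_comp]
    _ = q.sum fun _ a => ‖a‖ ^ 2 := q.sum_sq_norm_coeff_eq_circleAverage.symm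
    _ = ∑ n ∈ Finset.range K, ‖q.coeff n‖ ^ 2 :=
        q.sum_over_range' (by simp) K
          ((natDegree_comp_le.trans (Nat.mul_le_mul_left _
          ((natDegree_C_mul_le _ _).trans natDegree_X_le))).trans_lt (by rwa [mul_one]))
    _ = ∑ n ∈ Finset.range K, (‖p.coeff n‖ * r ^ n) ^ 2 := Finset.sum_congr rfl fun n _ => hq n

theorem norm_coeff_mul_pow_le_hardyNorm {r : ℝ} (p : ℂ[X]) (n : ℕ) :
    ‖p.coeff n‖ * r ^ n ≤ hardyNorm r p := by
  refine le_of_sq_le_sq ?_ (hardyNorm_nonneg r p)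
  have hsum := hardyNorm_sq_eq_sum (p := p) (K := max (p.natDegree + 1) (n + 1)) (by simp) r
  rw [hsum]
  exact Finset.single_le_sum (f := fun n => (‖p.coeff n‖ * r ^ n) ^ 2) (fun _ _ => sq_nonneg _)
    (by simp)

theorem hardyNorm_mono {r R : ℝ} (hr : 0 ≤ r) (hrR : r ≤ R) (p : ℂ[X]) :
    hardyNorm r p ≤ hardyNorm R p := by
  refine le_of_sq_le_sq ?_ (hardyNorm_nonneg R p)
  rw [hardyNorm_sq_eq_sum (Nat.lt_succ_self _), hardyNorm_sq_eq_sum (Nat.lt_succ_self _)]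
  gcongr

theorem hardyNorm_le_of_norm_le {r A : ℝ} {p : ℂ[X]} (hA : 0 ≤ A)
    (h : ∀ z : ℂ, ‖z‖ = |r| → ‖p.eval z‖ ≤ A) : hardyNorm r p ≤ A := by
  refine Real.sqrt_le_iff.2 ⟨hA, Real.circleAverage_mono_on_of_le_circle
    (circleIntegrable_norm_sq_eval p 0 r) fun z hz => ?_⟩
  have hz := h z (by simpa using hz)
  gcongr

theorem hardyNorm_derivative_le {p : ℂ[X]} {K : ℕ} (hp : p.natDegree ≤ K) (r : ℝ) :
    hardyNorm r (derivative p) ≤ K * hardyNorm r p.divX := by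
  refine le_of_sq_le_sq ?_ (mul_nonneg K.cast_nonneg (hardyNorm_nonneg _ _))
  have hp' : (derivative p).natDegree < K + 1 := (natDegree_derivative_le p).trans_lt (by omega)
  have hdivX : p.divX.natDegree < K + 1 := by rw [natDegree_divX_eq_natDegree_tsub_one]; omega
  rw [mul_pow, hardyNorm_sq_eq_sum hp', hardyNorm_sq_eq_sum hdivX, Finset.mul_sum]
  refine Finset.sum_le_sum fun n _ => ?_
  rw [← mul_pow, sq_le_sq, coeff_derivative, coeff_divX]
  rcases le_or_gt (n + 1) K with hn | hn
  · have : ‖(n : ℂ) + 1‖ ≤ K := by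
      rw [← Nat.cast_succ, Complex.norm_natCast]
      exact_mod_cast hn
    rw [norm_mul, mul_comm ‖p.coeff (n + 1)‖, mul_assoc, abs_mul, abs_mul (K : ℝ),
      abs_of_nonneg (norm_nonneg _), Nat.abs_cast]
    gcongr
  · simp [coeff_eq_zero_of_natDegree_lt (hp.trans_lt hn)]

/-! ### The velocity of a polynomial pinched between two constants -/

/-- A bound for `P[1 / |B| ^ 2]` on the disk of radius `r` when `|B| ≥ μ` there. -/
def phiBound (r μ : ℝ) : ℝ := 2 / μ ^ 2 + 1 / μ ^ 2 * ((r + 1) / (r - 1))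

theorem phiBound_pos {r μ : ℝ} (hr : 1 < r) (hμ : 0 < μ) : 0 < phiBound r μ := by
  have : 0 < r - 1 := sub_pos.2 hr
  unfold phiBound
  positivity

theorem ne_zero_of_le_norm_eval {r μ : ℝ} (hμ : 0 < μ) {B : ℂ[X]}
    (hB : ∀ z : ℂ, ‖z‖ ≤ r → μ ≤ ‖B.eval z‖) {z : ℂ} (hz : ‖z‖ ≤ r) : B.eval z ≠ 0 :=
  norm_pos_iff.1 (hμ.trans_le (hB z hz))

theorem norm_div_sq_eq_inv {r : ℝ} (hr : 0 < r) {z : ℂ} (hz : ‖z‖ = r) :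
    ‖z / (r : ℂ) ^ 2‖ = r⁻¹ := by
  rw [norm_div, norm_pow, Complex.norm_real, Real.norm_of_nonneg hr.le, hz]
  field_simp

theorem IsVelocity.norm_eval_div_le_of_le_inv {r μ : ℝ} (hr : 1 < r) (hμ : 0 < μ) {B s : ℂ[X]}
    (hs : IsVelocity B s) (hB : ∀ z : ℂ, ‖z‖ ≤ r → μ ≤ ‖B.eval z‖) {ξ : ℂ} (hξ : ‖ξ‖ ≤ r⁻¹) :
    ‖s.eval ξ / B.eval ξ‖ ≤ 1 / μ ^ 2 * ((r + 1) / (r - 1)) := by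
  have hr1 : r⁻¹ < 1 := inv_lt_one_of_one_lt₀ hr
  have hξ1 : ‖ξ‖ < 1 := hξ.trans_lt hr1
  have hg : ∀ z : ℂ, ‖z‖ = 1 → |1 / ‖B.eval z‖ ^ 2| ≤ 1 / μ ^ 2 := fun z hz => by
    have := hB z (by linarith)
    rw [abs_of_nonneg (by positivity)]
    gcongr
  rw [hs.eval_div_eq_poissonOp (fun z hz => ne_zero_of_le_norm_eval hμ hB (hz.trans hr.le))
    (mem_ball_zero_iff.2 hξ1)]
  calc _ ≤ 1 / μ ^ 2 * ((1 + ‖ξ‖) / (1 - ‖ξ‖)) := norm_poissonOp_le hg hξ1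
    _ ≤ 1 / μ ^ 2 * ((1 + r⁻¹) / (1 - r⁻¹)) := by
        have : 0 < 1 - r⁻¹ := sub_pos.2 hr1
        gcongr
    _ = 1 / μ ^ 2 * ((r + 1) / (r - 1)) := by
        have : r - 1 ≠ 0 := (sub_pos.2 hr).ne'
        field_simp

theorem IsVelocity.norm_eval_div_le_of_norm_eq {r μ : ℝ} (hr : 1 < r) (hμ : 0 < μ) {B s : ℂ[X]}
    (hs : IsVelocity B s) (hB : ∀ z : ℂ, ‖z‖ ≤ r → μ ≤ ‖B.eval z‖) {z : ℂ} (hz : ‖z‖ = r) :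
    ‖s.eval z / B.eval z‖ ≤ phiBound r μ := by
  have hr0 : 0 < r := by linarith
  set y := z / (r : ℂ) ^ 2
  have hy : ‖y‖ = r⁻¹ := norm_div_sq_eq_inv hr0 hz
  have hyr : ‖y‖ ≤ r := hy.le.trans ((inv_le_one_of_one_le₀ hr.le).trans hr.le)
  have hBz := ne_zero_of_le_norm_eval hμ hB hz.le
  have hBy := ne_zero_of_le_norm_eval hμ hB hyr
  have hBy' : conj (B.eval y) ≠ 0 := by simpa using hBy
  have hreflect : s.eval z / B.eval z = 2 / (B.eval z * conj (B.eval y)) -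
      conj (s.eval y / B.eval y) := by
    rw [map_div₀, ← hs.reflect_identity (norm_pos_iff.1 (hz ▸ hr0)) hz]
    field_simp
    ring
  rw [hreflect]
  refine (norm_sub_le _ _).trans (add_le_add ?_ ?_)
  · rw [norm_div, norm_mul, RCLike.norm_conj, Complex.norm_ofNat, sq]
    have := hB z hz.le
    have := hB y hyr
    gcongr
  · rw [RCLike.norm_conj]
    exact hs.norm_eval_div_le_of_le_inv hr hμ hB hy.le

theorem IsVelocity.norm_eval_div_le {r μ : ℝ} (hr : 1 < r) (hμ : 0 < μ) {B s : ℂ[X]}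
    (hs : IsVelocity B s) (hB : ∀ z : ℂ, ‖z‖ ≤ r → μ ≤ ‖B.eval z‖) {z : ℂ} (hz : ‖z‖ ≤ r) :
    ‖s.eval z / B.eval z‖ ≤ phiBound r μ := by
  have hr0 : r ≠ 0 := by positivity
  refine Complex.norm_le_of_forall_mem_frontier_norm_le isBounded_ball
    (diffContOnCl_eval_div fun z hz => ne_zero_of_le_norm_eval hμ hB hz) (fun w hw => ?_)
    (by simpa [closure_ball _ hr0] using hz)
  rw [frontier_ball _ hr0, mem_sphere_zero_iff_norm] at hw
  exact hs.norm_eval_div_le_of_norm_eq hr hμ hB hw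

/-- On the closed disk of radius `r`, `|B|` stays between `μ` and `M`. -/
structure Pinched (r μ M : ℝ) (B : ℂ[X]) : Prop where
  le_norm_eval : ∀ z : ℂ, ‖z‖ ≤ r → μ ≤ ‖B.eval z‖
  norm_eval_le : ∀ z : ℂ, ‖z‖ ≤ r → ‖B.eval z‖ ≤ M

theorem Pinched.ne_zero {r μ M : ℝ} {B : ℂ[X]} (h : Pinched r μ M B) (hμ : 0 < μ) {z : ℂ}
    (hz : ‖z‖ ≤ r) : B.eval z ≠ 0 :=
  ne_zero_of_le_norm_eval hμ h.le_norm_eval hz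

theorem Pinched.velocity_spec {r μ M : ℝ} (hr : 1 < r) (hμ : 0 < μ) {B : ℂ[X]}
    (h : Pinched r μ M B) : (velocity B).natDegree ≤ B.natDegree ∧ IsVelocity B (velocity B) :=
  HeleShaw.velocity_spec fun _ hz => h.ne_zero hμ (hz.trans hr.le)

theorem Pinched.nonneg {r μ M : ℝ} {B : ℂ[X]} (h : Pinched r μ M B) (hr : 0 ≤ r) : 0 ≤ M :=
  (norm_nonneg _).trans (h.norm_eval_le 0 (by simpa using hr))

theorem IsVelocity.norm_eval_le {r μ M : ℝ} (hr : 1 < r) (hμ : 0 < μ) {B s : ℂ[X]}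
    (hs : IsVelocity B s) (hB : Pinched r μ M B) {z : ℂ} (hz : ‖z‖ ≤ r) :
    ‖s.eval z‖ ≤ M * phiBound r μ := by
  have := hB.nonneg (by linarith)
  rw [← mul_div_cancel₀ (s.eval z) (hB.ne_zero hμ hz), norm_mul]
  exact mul_le_mul (hB.norm_eval_le z hz) (hs.norm_eval_div_le hr hμ hB.le_norm_eval hz)
    (norm_nonneg _) this

theorem IsVelocity.norm_coeff_le {r μ M : ℝ} (hr : 1 < r) (hμ : 0 < μ) {B s : ℂ[X]}
    (hs : IsVelocity B s) (hB : Pinched r μ M B) (n : ℕ) : ‖s.coeff n‖ ≤ M * phiBound r μ := by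
  have hr0 : 0 ≤ r := by linarith
  calc ‖s.coeff n‖ ≤ ‖s.coeff n‖ * r ^ n :=
        le_mul_of_one_le_right (norm_nonneg _) (one_le_pow₀ hr.le)
    _ ≤ hardyNorm r s := norm_coeff_mul_pow_le_hardyNorm s n
    _ ≤ M * phiBound r μ :=
        hardyNorm_le_of_norm_le (mul_nonneg (hB.nonneg hr0) (phiBound_pos hr hμ).le) fun z hz =>
          hs.norm_eval_le hr hμ hB (by rw [hz, abs_of_nonneg hr0])

section Lipschitz

variable {r μ M : ℝ} {B₁ B₂ s₁ s₂ : ℂ[X]}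

theorem norm_velocity_sub_div_add_conj_le (hr : 1 < r) (hμ : 0 < μ) (hs₁ : IsVelocity B₁ s₁)
    (hs₂ : IsVelocity B₂ s₂) (hB₁ : ∀ z : ℂ, ‖z‖ ≤ r → μ ≤ ‖B₁.eval z‖) (hB₂ : Pinched r μ M B₂)
    {z : ℂ} (hz : ‖z‖ = r) :
    ‖(s₁ - s₂).eval z / B₁.eval z +
        conj ((s₁ - s₂).eval (z / (r : ℂ) ^ 2) / B₁.eval (z / (r : ℂ) ^ 2))‖ ≤
      M * phiBound r μ / μ ^ 2 *
        (‖(B₁ - B₂).eval (z / (r : ℂ) ^ 2)‖ + ‖(B₁ - B₂).eval z‖) := by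
  have hr0 : 0 < r := by linarith
  have hz0 : z ≠ 0 := norm_pos_iff.1 (hz ▸ hr0)
  have reflect₁ := hs₁.reflect_identity hz0 hz
  have reflect₂ := hs₂.reflect_identity hz0 hz
  have hy : ‖z / (r : ℂ) ^ 2‖ ≤ r :=
    (norm_div_sq_eq_inv hr0 hz).le.trans ((inv_le_one_of_one_le₀ hr.le).trans hr.le)
  set y := z / (r : ℂ) ^ 2
  have hBy : conj (B₁.eval y) ≠ 0 := by simpa using ne_zero_of_le_norm_eval hμ hB₁ hy
  have hsum : (s₁ - s₂).eval z / B₁.eval z + conj ((s₁ - s₂).eval y / B₁.eval y) =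
      -(s₂.eval z * conj ((B₁ - B₂).eval y) + conj (s₂.eval y) * (B₁ - B₂).eval z) /
        (B₁.eval z * conj (B₁.eval y)) := by
    rw [map_div₀, div_add_div _ _ (ne_zero_of_le_norm_eval hμ hB₁ hz.le) hBy]
    simp only [eval_sub, map_sub]
    congr 1
    linear_combination reflect₁ - reflect₂
  rw [hsum, norm_div, norm_neg, norm_mul (B₁.eval z), RCLike.norm_conj]
  have hsz := hs₂.norm_eval_le hr hμ hB₂ hz.le
  have hsy := hs₂.norm_eval_le hr hμ hB₂ hy
  have := hB₁ z hz.le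
  have := hB₁ y hy
  have : 0 ≤ M * phiBound r μ := (norm_nonneg _).trans hsz
  calc _ ≤ (M * phiBound r μ * ‖(B₁ - B₂).eval y‖ + M * phiBound r μ * ‖(B₁ - B₂).eval z‖) /
        (μ * μ) := by
        gcongr
        refine (norm_add_le _ _).trans ?_
        rw [norm_mul, norm_mul, RCLike.norm_conj, RCLike.norm_conj]
        gcongr
    _ = _ := by ring

theorem circleAverage_norm_sq_velocity_sub_le (hr : 1 < r) (hμ : 0 < μ) (hs₁ : IsVelocity B₁ s₁)
    (hs₂ : IsVelocity B₂ s₂) (hB₁ : ∀ z : ℂ, ‖z‖ ≤ r → μ ≤ ‖B₁.eval z‖)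
    (hB₂ : Pinched r μ M B₂) :
    Real.circleAverage (fun z => ‖(s₁ - s₂).eval z / B₁.eval z +
        conj ((s₁ - s₂).eval (z / (r : ℂ) ^ 2) / B₁.eval (z / (r : ℂ) ^ 2))‖ ^ 2) 0 r ≤
      4 * (M * phiBound r μ / μ ^ 2) ^ 2 * hardyNorm r (B₁ - B₂) ^ 2 := by
  have hr0 : 0 < r := by linarith
  set A := M * phiBound r μ / μ ^ 2
  set a := B₁ - B₂
  have hquot : ContinuousOn (fun z => (s₁ - s₂).eval z / B₁.eval z) (closedBall 0 r) :=
    ContinuousOn.div (by fun_prop) (by fun_prop)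
      fun z hz => ne_zero_of_le_norm_eval hμ hB₁ (mem_closedBall_zero_iff.1 hz)
  have hquot' := Complex.continuous_conj.comp_continuousOn
    (hquot.comp (by fun_prop) (mapsTo_div_sq_closedBall hr.le))
  have hsum := (hquot.add hquot').mono (sphere_subset_closedBall (x := 0) (ε := r))
  have hleft := ContinuousOn.circleIntegrable hr0.le (hsum.norm.pow 2)
  have hinner : CircleIntegrable (fun z => ‖a.eval (z / (r : ℂ) ^ 2)‖ ^ 2) 0 r :=
    ContinuousOn.circleIntegrable hr0.le (by fun_prop)
  have houter := circleIntegrable_norm_sq_eval a 0 r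
  calc _ ≤ Real.circleAverage (fun z => (2 * A ^ 2) •
        (‖a.eval (z / (r : ℂ) ^ 2)‖ ^ 2 + ‖a.eval z‖ ^ 2)) 0 r := by
        refine Real.circleAverage_mono hleft (hinner.add houter).const_smul fun z hz => ?_
        rw [abs_of_pos hr0, mem_sphere_zero_iff_norm] at hz
        refine (pow_le_pow_left₀ (norm_nonneg _)
          (norm_velocity_sub_div_add_conj_le hr hμ hs₁ hs₂ hB₁ hB₂ hz) 2).trans ?_
        rw [mul_pow, smul_eq_mul, mul_comm 2, mul_assoc]
        exact mul_le_mul_of_nonneg_left add_sq_le (sq_nonneg A)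
    _ = 2 * A ^ 2 * (hardyNorm r⁻¹ a ^ 2 + hardyNorm r a ^ 2) := by
        rw [Real.circleAverage_fun_smul, Real.circleAverage_fun_add hinner houter,
          circleAverage_comp_div_sq (fun z => ‖a.eval z‖ ^ 2) hr0.ne', hardyNorm_sq, hardyNorm_sq,
          smul_eq_mul]
    _ ≤ 2 * A ^ 2 * (hardyNorm r a ^ 2 + hardyNorm r a ^ 2) := by
        have := hardyNorm_nonneg r⁻¹ a
        gcongr
        exact hardyNorm_mono (by positivity) ((inv_le_one_of_one_le₀ hr.le).trans hr.le) a
    _ = _ := by ring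

theorem abs_im_velocity_sub_div_zero_le (hr : 1 < r) (hμ : 0 < μ) (hs₁ : IsVelocity B₁ s₁)
    (hs₂ : IsVelocity B₂ s₂) (hB₁ : ∀ z : ℂ, ‖z‖ ≤ r → μ ≤ ‖B₁.eval z‖)
    (hB₂ : ∀ z : ℂ, ‖z‖ ≤ r → μ ≤ ‖B₂.eval z‖) :
    |((s₁ - s₂).eval 0 / B₁.eval 0).im| ≤ phiBound r μ / μ * hardyNorm r (B₁ - B₂) := by
  have h0 : ‖(0 : ℂ)‖ ≤ r := by rw [norm_zero]; linarith
  have hB₁0 := ne_zero_of_le_norm_eval hμ hB₁ h0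
  have hB₂0 := ne_zero_of_le_norm_eval hμ hB₂ h0
  have hquot : (s₁ - s₂).eval 0 / B₁.eval 0 =
      s₁.eval 0 / B₁.eval 0 - s₂.eval 0 / B₂.eval 0 +
        s₂.eval 0 / B₂.eval 0 * ((B₁ - B₂).eval 0 / B₁.eval 0) := by
    rw [eval_sub, eval_sub]
    field_simp
    ring
  have hcoeff : ‖(B₁ - B₂).eval 0‖ ≤ hardyNorm r (B₁ - B₂) := by
    simpa [coeff_zero_eq_eval_zero] using norm_coeff_mul_pow_le_hardyNorm (r := r) (B₁ - B₂) 0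
  rw [hquot, Complex.add_im, Complex.sub_im, hs₁.im_eq, hs₂.im_eq, sub_zero, zero_add]
  refine (Complex.abs_im_le_norm _).trans ?_
  rw [norm_mul, norm_div ((B₁ - B₂).eval 0)]
  have hs := hs₂.norm_eval_div_le hr hμ hB₂ h0
  have := hB₁ 0 h0
  have := (phiBound_pos hr hμ).le
  have := hardyNorm_nonneg r (B₁ - B₂)
  calc _ ≤ phiBound r μ * (hardyNorm r (B₁ - B₂) / μ) := by gcongr
    _ = _ := by ring

theorem Pinched.hardyNorm_sq_le {B : ℂ[X]} (hr : 0 ≤ r) (hμ : 0 < μ) (hB : Pinched r μ M B)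
    (p : ℂ[X]) :
    hardyNorm r p ^ 2 ≤
      M ^ 2 * Real.circleAverage (fun z => ‖p.eval z / B.eval z‖ ^ 2) 0 r := by
  have hquot : ContinuousOn (fun z => p.eval z / B.eval z) (sphere 0 r) :=
    ContinuousOn.div (by fun_prop) (by fun_prop)
      fun z hz => hB.ne_zero hμ (mem_sphere_zero_iff_norm.1 hz).le
  have hint : CircleIntegrable (fun z => ‖p.eval z / B.eval z‖ ^ 2) 0 r :=
    ContinuousOn.circleIntegrable hr (by fun_prop)
  rw [hardyNorm_sq, ← smul_eq_mul, ← Real.circleAverage_fun_smul]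
  refine Real.circleAverage_mono (circleIntegrable_norm_sq_eval p 0 r) hint.const_smul
    fun z hz => ?_
  rw [abs_of_nonneg hr, mem_sphere_zero_iff_norm] at hz
  rw [smul_eq_mul, ← mul_pow]
  nth_rw 1 [← mul_div_cancel₀ (p.eval z) (hB.ne_zero hμ hz.le), norm_mul]
  have := hB.norm_eval_le z hz.le
  gcongr

/-- The Lipschitz constant of the velocity with respect to the Hardy norm. -/
def lipConst (r μ M : ℝ) : ℝ := M * phiBound r μ * (2 * M / μ ^ 2 + 2 / μ)

theorem lipConst_nonneg (hr : 1 < r) (hμ : 0 < μ) (hM : 0 ≤ M) : 0 ≤ lipConst r μ M := by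
  have := phiBound_pos hr hμ
  unfold lipConst
  positivity

theorem hardyNorm_velocity_sub_le (hr : 1 < r) (hμ : 0 < μ) (hs₁ : IsVelocity B₁ s₁)
    (hs₂ : IsVelocity B₂ s₂) (hB₁ : Pinched r μ M B₁) (hB₂ : Pinched r μ M B₂) :
    hardyNorm r (s₁ - s₂) ≤ lipConst r μ M * hardyNorm r (B₁ - B₂) := by
  have hM := hB₁.nonneg (by linarith)
  have hH := hardyNorm_nonneg r (B₁ - B₂)
  refine le_of_sq_le_sq ?_ (mul_nonneg (lipConst_nonneg hr hμ hM) hH)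
  have hd : DifferentiableOn ℂ (fun z => (s₁ - s₂).eval z / B₁.eval z) (closedBall 0 r) :=
    DifferentiableOn.div (by fun_prop) (by fun_prop)
      fun z hz => hB₁.ne_zero hμ (mem_closedBall_zero_iff.1 hz)
  have hcentre := (sq_abs _).symm.le.trans (pow_le_pow_left₀ (abs_nonneg _)
    (abs_im_velocity_sub_div_zero_le hr hμ hs₁ hs₂ hB₁.le_norm_eval hB₂.le_norm_eval) 2)
  have hreflect := circleAverage_norm_sq_velocity_sub_le hr hμ hs₁ hs₂ hB₁.le_norm_eval hB₂
  have hquot := circleAverage_norm_sq_le_add_conj hr.le hd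
  have hcross : 0 ≤ M * phiBound r μ / μ ^ 2 * (phiBound r μ / μ) := by
    have := phiBound_pos hr hμ
    positivity
  calc hardyNorm r (s₁ - s₂) ^ 2
      ≤ M ^ 2 * (4 * (M * phiBound r μ / μ ^ 2) ^ 2 * hardyNorm r (B₁ - B₂) ^ 2 +
          2 * (phiBound r μ / μ * hardyNorm r (B₁ - B₂)) ^ 2) := by
        refine (hB₁.hardyNorm_sq_le (by linarith) hμ _).trans ?_
        gcongr
        linarith
    _ ≤ M ^ 2 * (2 * (M * phiBound r μ / μ ^ 2) + 2 * (phiBound r μ / μ)) ^ 2 *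
          hardyNorm r (B₁ - B₂) ^ 2 := by
        rw [mul_pow (phiBound r μ / μ), ← mul_assoc 2, ← add_mul, ← mul_assoc]
        gcongr
        nlinarith only [hcross, sq_nonneg (phiBound r μ / μ)]
    _ = (lipConst r μ M * hardyNorm r (B₁ - B₂)) ^ 2 := by
        rw [lipConst]
        ring

end Lipschitz

/-! ### Ordinary differential equations -/

theorem exists_bounded_lipschitz_extension {α E : Type*} [PseudoMetricSpace α]
    [NormedAddCommGroup E] [NormedSpace ℝ E] [FiniteDimensional ℝ E] {S : Set α} {V : α → E}
    {L : ℝ≥0} {Q : ℝ} (hV : LipschitzOnWith L V S) (hQ : ∀ x ∈ S, ‖V x‖ ≤ Q) :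
    ∃ (W : α → E) (L' Q' : ℝ≥0), LipschitzWith L' W ∧ (∀ x, ‖W x‖ ≤ Q') ∧ EqOn W V S := by
  let e : E ≃L[ℝ] (Fin (Module.finrank ℝ E) → ℝ) :=
    ContinuousLinearEquiv.ofFinrankEq (by simp)
  set A := (e : E →L[ℝ] (Fin (Module.finrank ℝ E) → ℝ))
  set A' := (e.symm : (Fin (Module.finrank ℝ E) → ℝ) →L[ℝ] E)
  obtain ⟨g, hg, hgV⟩ := (A.lipschitz.comp_lipschitzOnWith hV).extend_pi
  set R := ‖A‖₊ * Q.toNNReal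
  have hclamp : LipschitzWith (‖A‖₊ * L) fun x i => max (-(R : ℝ)) (min (R : ℝ) (g x i)) :=
    LipschitzWith.of_dist_le_mul fun x y => (dist_pi_le_iff (by positivity)).2 fun i =>
      ((((LipschitzWith.eval i).comp hg).const_min _).const_max _).dist_le_mul x y |>.trans_eq
        (by rw [one_mul])
  refine ⟨fun x => A' fun i => max (-(R : ℝ)) (min (R : ℝ) (g x i)), _, ‖A'‖₊ * R,
    A'.lipschitz.comp hclamp, fun x => ?_, fun x hx => ?_⟩
  · refine (A'.le_opNorm _).trans ?_
    push_cast
    gcongr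
    refine (pi_norm_le_iff_of_nonneg R.2).2 fun i => abs_le.2 ⟨le_max_left _ _, ?_⟩
    exact max_le ((neg_nonpos.2 R.2).trans R.2) (min_le_left _ _)
  · have hbound : ‖e (V x)‖ ≤ R := by
      refine (A.le_opNorm _).trans ?_
      push_cast [R]
      gcongr
      exact (hQ x hx).trans (Real.le_coe_toNNReal Q)
    have hcoord i := abs_le.1 ((norm_le_pi_norm (e (V x)) i).trans hbound)
    have hfix : (fun i => max (-(R : ℝ)) (min (R : ℝ) (g x i))) = e (V x) := by
      funext i
      rw [← hgV hx]
      exact (congrArg _ (min_eq_right (hcoord i).2)).trans (max_eq_right (hcoord i).1)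
    exact (congrArg A' hfix).trans (e.symm_apply_apply _)

theorem exists_solution_of_lipschitzOnWith {E : Type*} [NormedAddCommGroup E] [NormedSpace ℝ E]
    [FiniteDimensional ℝ E] {S : Set E} {V : E → E} {L : ℝ≥0} {Q T : ℝ}
    (hV : LipschitzOnWith L V S) (hQ : ∀ x ∈ S, ‖V x‖ ≤ Q) (hT : 0 ≤ T) (x₀ : E) :
    ∃ x : ℝ → E, x 0 = x₀ ∧ ContinuousOn x (Icc 0 T) ∧
      ∀ t ∈ Icc 0 T, x t ∈ S → HasDerivWithinAt x (V (x t)) (Icc 0 T) t := by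
  have := FiniteDimensional.complete ℝ E
  obtain ⟨W, L', Q', hWL, hWQ, hWV⟩ := exists_bounded_lipschitz_extension hV hQ
  have hpl : IsPicardLindelof (fun _ => W) (⟨0, left_mem_Icc.2 hT⟩ : Icc 0 T) x₀
      (Q' * T.toNNReal) 0 Q' L' :=
    ⟨fun _ _ => hWL.lipschitzOnWith, fun _ _ => continuousOn_const, fun _ _ x _ => hWQ x,
      by simp [hT]⟩
  obtain ⟨x, hx₀, hx⟩ := hpl.exists_eq_forall_mem_Icc_hasDerivWithinAt₀
  refine ⟨x, hx₀, fun t ht => (hx t ht).continuousWithinAt, fun t ht hS => ?_⟩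
  rw [← hWV hS]
  exact hx t ht

theorem le_of_bootstrap {ψ : ℝ → ℝ} {T A A' : ℝ} (hψ : ContinuousOn ψ (Icc 0 T)) (hA : A < A')
    (h0 : ψ 0 ≤ A) (hstep : ∀ τ ∈ Icc 0 T, (∀ t ∈ Icc 0 τ, ψ t ≤ A') → ψ τ ≤ A) :
    ∀ t ∈ Icc 0 T, ψ t ≤ A := by
  -- Otherwise `ψ` first reaches the level `A'` at some time `τ`, yet `ψ ≤ A` on `[0, τ)`.
  suffices hno : ∀ t ∈ Icc 0 T, ψ t < A' from fun t ht =>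
    hstep t ht fun s hs => (hno s ⟨hs.1, hs.2.trans ht.2⟩).le
  by_contra! hex
  set Z := Icc 0 T ∩ ψ ⁻¹' Ici A'
  have hZ : IsClosed Z := hψ.preimage_isClosed_of_isClosed isClosed_Icc isClosed_Ici
  have hZb : BddBelow Z := ⟨0, fun s hs => hs.1.1⟩
  obtain ⟨⟨hτ, hτT⟩, hψτ⟩ : sInf Z ∈ Z := hZ.csInf_mem hex hZb
  set τ := sInf Z
  have hlt : ∀ s ∈ Ico 0 τ, ψ s ≤ A := by
    intro s hs
    have hsT : s ≤ T := hs.2.le.trans hτT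
    refine hstep s ⟨hs.1, hsT⟩ fun u hu => ?_
    by_contra! hu'
    exact (hu.2.trans_lt hs.2).not_ge (csInf_le hZb ⟨⟨hu.1, hu.2.trans hsT⟩, hu'.le⟩)
  have hτ0 : 0 ≠ τ := fun h => (h0.trans_lt hA).not_ge (h ▸ hψτ)
  have hcl : τ ∈ closure (Ico 0 τ) := by
    rw [closure_Ico hτ0]
    exact right_mem_Icc.2 hτ
  have hτA : ψ τ ≤ A := ContinuousWithinAt.closure_le hcl
    ((hψ τ ⟨hτ, hτT⟩).mono fun s hs => ⟨hs.1, hs.2.le.trans hτT⟩) continuousWithinAt_const hlt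
  exact (hτA.trans_lt hA).not_ge hψτ

/-! ### The norm `M(r)` on polynomials -/

/-- The norm `|p|_{M(r)} = ∑ |aₙ| rⁿ` of a polynomial `p = ∑ aₙ ξⁿ`. -/
def wnorm (r : ℝ) (p : ℂ[X]) : ℝ := p.sum fun n a => ‖a‖ * r ^ n

section WNorm

variable {r : ℝ} {K : ℕ} {p : ℂ[X]}

theorem wnorm_eq_sum (hp : p.natDegree < K) (r : ℝ) :
    wnorm r p = ∑ n ∈ Finset.range K, ‖p.coeff n‖ * r ^ n :=
  p.sum_over_range' (fun n => by simp) K hp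

theorem wnorm_zero (r : ℝ) : wnorm r 0 = 0 := sum_zero_index _

theorem wnorm_nonneg (hr : 0 ≤ r) (p : ℂ[X]) : 0 ≤ wnorm r p :=
  Finset.sum_nonneg fun n _ => by positivity

theorem wnorm_add_le (hr : 0 ≤ r) (p q : ℂ[X]) :
    wnorm r (p + q) ≤ wnorm r p + wnorm r q := by
  have hp : p.natDegree < max p.natDegree q.natDegree + 1 := by omega
  have hq : q.natDegree < max p.natDegree q.natDegree + 1 := by omega
  rw [wnorm_eq_sum (Nat.lt_succ_of_le (natDegree_add_le p q)), wnorm_eq_sum hp, wnorm_eq_sum hq,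
    ← Finset.sum_add_distrib]
  refine Finset.sum_le_sum fun n _ => ?_
  rw [coeff_add, ← add_mul]
  gcongr
  exact norm_add_le _ _

theorem wnorm_sub_le (hr : 0 ≤ r) (p q s : ℂ[X]) :
    wnorm r (p - s) ≤ wnorm r (p - q) + wnorm r (q - s) := by
  rw [← sub_add_sub_cancel p q s]
  exact wnorm_add_le hr _ _

theorem norm_eval_le_wnorm (p : ℂ[X]) {z : ℂ} (hz : ‖z‖ ≤ r) : ‖p.eval z‖ ≤ wnorm r p := by
  rw [wnorm_eq_sum (Nat.lt_succ_self _), eval_eq_sum_range]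
  refine norm_sum_le_of_le _ fun n _ => ?_
  rw [norm_mul, norm_pow]
  gcongr

theorem wnorm_eq_mul_wnorm_divX (h0 : p.coeff 0 = 0) (r : ℝ) :
    wnorm r p = r * wnorm r p.divX := by
  have hdivX : p.divX.natDegree < p.natDegree + 1 := by
    rw [natDegree_divX_eq_natDegree_tsub_one]
    omega
  rw [wnorm_eq_sum (K := p.natDegree + 1 + 1) (by omega), Finset.sum_range_succ', h0,
    norm_zero, zero_mul, add_zero, wnorm_eq_sum hdivX, Finset.mul_sum]
  refine Finset.sum_congr rfl fun n _ => ?_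
  rw [coeff_divX]
  ring

theorem wnorm_derivative_le (hr : 1 ≤ r) (hp : p.natDegree ≤ K) :
    wnorm r (derivative p) ≤ K * wnorm r p := by
  have hp' : (derivative p).natDegree < K + 1 :=
    Nat.lt_succ_of_le ((natDegree_derivative_le p).trans (by omega))
  have : 0 ≤ r := by linarith
  rw [wnorm_eq_sum hp', wnorm_eq_sum (K := K + 1 + 1) (by omega), Finset.sum_range_succ' _ (K + 1),
    mul_add, Finset.mul_sum]
  refine le_add_of_le_of_nonneg (Finset.sum_le_sum fun n _ => ?_) (by positivity)
  rcases lt_or_ge n K with hn | hn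
  · have hnorm : ‖((n : ℂ) + 1)‖ ≤ K := by
      rw [← Nat.cast_succ, Complex.norm_natCast]
      exact_mod_cast hn
    have hpow : r ^ n ≤ r ^ (n + 1) := pow_le_pow_right₀ hr (Nat.le_succ n)
    rw [coeff_derivative, norm_mul, mul_comm ‖p.coeff (n + 1)‖, mul_assoc]
    gcongr
  · rw [coeff_derivative, coeff_eq_zero_of_natDegree_lt (by omega)]
    simp

theorem wnorm_iterate_derivative_le (hr : 1 ≤ r) (hp : p.natDegree ≤ K) (j : ℕ) :
    wnorm r (derivative^[j] p) ≤ (K : ℝ) ^ j * wnorm r p := by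
  induction j with
  | zero => simp
  | succ j ih =>
    have hdeg : (derivative^[j] p).natDegree ≤ K :=
      (natDegree_iterate_derivative p j).trans ((Nat.sub_le _ _).trans hp)
    rw [Function.iterate_succ_apply', pow_succ', mul_assoc]
    exact (wnorm_derivative_le hr hdeg).trans (by gcongr)

theorem hardyNorm_le_wnorm (hr : 0 ≤ r) (p : ℂ[X]) : hardyNorm r p ≤ wnorm r p :=
  hardyNorm_le_of_norm_le (wnorm_nonneg hr p) fun _ hz =>
    norm_eval_le_wnorm p (hz.trans_le (abs_of_nonneg hr).le)

theorem wnorm_le_hardyNorm (hp : p.natDegree < K) (r : ℝ) :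
    wnorm r p ≤ √K * hardyNorm r p := by
  rw [← Real.sqrt_sq (hardyNorm_nonneg r p), hardyNorm_sq_eq_sum hp, wnorm_eq_sum hp,
    ← Real.sqrt_mul (Nat.cast_nonneg K)]
  refine Real.le_sqrt_of_sq_le ?_
  simpa using sq_sum_le_card_mul_sum_sq (s := Finset.range K) (f := fun n => ‖p.coeff n‖ * r ^ n)

theorem wnorm_le_hardyNorm_derivative (hp : p.natDegree ≤ K) (r : ℝ) :
    wnorm r (derivative p) ≤ √K * hardyNorm r (derivative p) := by
  rcases K.eq_zero_or_pos with rfl | hK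
  · rw [derivative_of_natDegree_zero (Nat.le_zero.1 hp), wnorm_zero]
    simp
  · exact wnorm_le_hardyNorm (lt_of_le_of_lt (natDegree_derivative_le p) (by omega)) r

theorem wnorm_le_hardyNorm_divX (hr : 0 ≤ r) (hp : p.natDegree ≤ K) (h0 : p.coeff 0 = 0) :
    wnorm r p ≤ r * (√K * hardyNorm r p.divX) := by
  rw [wnorm_eq_mul_wnorm_divX h0]
  rcases K.eq_zero_or_pos with rfl | hK
  · have hzero : p.divX = 0 := divX_eq_zero_iff.2 (eq_C_of_natDegree_le_zero hp)
    rw [hzero, wnorm_zero]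
    simp
  · gcongr
    refine wnorm_le_hardyNorm ?_ r
    rw [natDegree_divX_eq_natDegree_tsub_one]
    omega

theorem hardyNorm_C_mul_X_pow (hr : 0 ≤ r) (b : ℂ) (k : ℕ) :
    hardyNorm r (C b * X ^ k) = ‖b‖ * r ^ k := by
  have hdeg : (C b * X ^ k).natDegree < k + 1 := Nat.lt_succ_of_le (natDegree_C_mul_X_pow_le b k)
  rw [← abs_of_nonneg (hardyNorm_nonneg _ _), ← abs_of_nonneg (by positivity : 0 ≤ ‖b‖ * r ^ k),
    ← sq_eq_sq_iff_abs_eq_abs, hardyNorm_sq_eq_sum hdeg, Finset.sum_eq_single_of_mem k (by simp)]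
  · simp
  · intro n _ hn
    rw [coeff_C_mul_X_pow, if_neg hn]
    simp

end WNorm

theorem hardyNorm_le_exp_mul {p p' : ℝ → ℂ[X]} {K : ℕ} {r c T : ℝ}
    (hdeg : ∀ t ∈ Icc 0 T, (p t).natDegree < K) (hdeg' : ∀ t ∈ Icc 0 T, (p' t).natDegree < K)
    (hderiv : ∀ t ∈ Icc 0 T, ∀ n,
      HasDerivWithinAt (fun t => (p t).coeff n) ((p' t).coeff n) (Icc 0 T) t)
    (hle : ∀ t ∈ Icc 0 T, hardyNorm r (p' t) ≤ c * hardyNorm r (p t)) :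
    ∀ t ∈ Icc 0 T, hardyNorm r (p t) ≤ Real.exp (c * t) * hardyNorm r (p 0) := by
  set Y : ℂ[X] → EuclideanSpace ℂ (Fin K) :=
    fun q => WithLp.toLp 2 fun i => q.coeff i * (r : ℂ) ^ (i : ℕ)
  have hnorm : ∀ {q : ℂ[X]}, q.natDegree < K → ‖Y q‖ = hardyNorm r q := fun {q} hq => by
    rw [EuclideanSpace.norm_eq, ← Real.sqrt_sq (hardyNorm_nonneg r q), hardyNorm_sq_eq_sum hq,
      Finset.sum_range]
    refine congrArg _ (Finset.sum_congr rfl fun i _ => ?_)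
    rw [norm_mul, norm_pow, Complex.norm_real, Real.norm_eq_abs, ← abs_pow, mul_pow, mul_pow,
      sq_abs]
  have hY : ∀ t ∈ Icc 0 T, HasDerivWithinAt (Y ∘ p) (Y (p' t)) (Icc 0 T) t := fun t ht =>
    ((PiLp.continuousLinearEquiv 2 ℝ (fun _ : Fin K => ℂ)).symm :
      (Fin K → ℂ) →L[ℝ] EuclideanSpace ℂ (Fin K)).hasFDerivAt.comp_hasDerivWithinAt t
      (hasDerivWithinAt_pi.2 fun i => (hderiv t ht i).mul_const _)
  intro t ht
  have hgronwall := norm_le_gronwallBound_of_norm_deriv_right_le (f := Y ∘ p)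
    (f' := Y ∘ p') (K := c) (ε := 0) (fun t ht => (hY t ht).continuousWithinAt)
    (fun t ht => (hY t (Ico_subset_Icc_self ht)).mono_of_mem_nhdsWithin
      (Icc_mem_nhdsGE_of_mem ht)) le_rfl
    (fun t ht => by
      have ht' := Ico_subset_Icc_self ht
      simpa only [Function.comp_apply, hnorm (hdeg t ht'), hnorm (hdeg' t ht'), add_zero]
        using hle t ht') t ht
  rwa [gronwallBound_ε0, sub_zero, Function.comp_apply, Function.comp_apply, hnorm (hdeg t ht),
    hnorm (hdeg 0 ⟨le_rfl, ht.1.trans ht.2⟩), mul_comm] at hgronwall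

/-! ### Polynomial solutions -/

/-- A curve of polynomials of degree at most `K`, vanishing at the origin, that solves
`∂ₜ g = ξ · velocity (g')` on `[0, T]`: on the circle this is the equation
`fₜ = ξ f' P[1 / |f'|²]`, written for the coefficients. -/
structure PolySol (K : ℕ) (T : ℝ) (g : ℝ → ℂ[X]) : Prop where
  natDegree_le : ∀ t ∈ Icc 0 T, (g t).natDegree ≤ K
  coeff_zero : ∀ t ∈ Icc 0 T, (g t).coeff 0 = 0
  hasDeriv : ∀ t ∈ Icc 0 T, ∀ n, HasDerivWithinAt (fun t => (g t).coeff (n + 1))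
    ((velocity (derivative (g t))).coeff n) (Icc 0 T) t

theorem Pinched.natDegree_derivative_lt {r μ M : ℝ} (hr : 0 ≤ r) (hμ : 0 < μ) {p : ℂ[X]}
    (h : Pinched r μ M (derivative p)) {K : ℕ} (hp : p.natDegree ≤ K) :
    (derivative p).natDegree < K := by
  refine (Polynomial.natDegree_derivative_lt fun h0 => ?_).trans_le hp
  refine h.ne_zero hμ (norm_zero.trans_le hr) ?_
  rw [derivative_of_natDegree_zero h0, eval_zero]

namespace PolySol

variable {K : ℕ} {T r μ M : ℝ} {g h : ℝ → ℂ[X]}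

theorem mono {K' : ℕ} {T' : ℝ} (hg : PolySol K T g) (hT : T' ≤ T) (hK : K ≤ K') :
    PolySol K' T' g := by
  have hsub : Icc 0 T' ⊆ Icc 0 T := Icc_subset_Icc_right hT
  exact ⟨fun t ht => (hg.natDegree_le t (hsub ht)).trans hK, fun t ht => hg.coeff_zero t (hsub ht),
    fun t ht n => (hg.hasDeriv t (hsub ht) n).mono hsub⟩

theorem continuousOn_coeff (hg : PolySol K T g) (n : ℕ) :
    ContinuousOn (fun t => (g t).coeff n) (Icc 0 T) := by
  cases n with
  | zero => exact continuousOn_const.congr fun t ht => hg.coeff_zero t ht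
  | succ n => exact fun t ht => (hg.hasDeriv t ht n).continuousWithinAt

theorem natDegree_sub_le (hg : PolySol K T g) (hh : PolySol K T h) {t : ℝ} (ht : t ∈ Icc 0 T) :
    (g t - h t).natDegree ≤ K :=
  (Polynomial.natDegree_sub_le _ _).trans (max_le (hg.natDegree_le t ht) (hh.natDegree_le t ht))

theorem coeff_zero_sub (hg : PolySol K T g) (hh : PolySol K T h) {t : ℝ} (ht : t ∈ Icc 0 T) :
    (g t - h t).coeff 0 = 0 := by
  rw [coeff_sub, hg.coeff_zero t ht, hh.coeff_zero t ht, sub_zero]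

end PolySol

/-- A polynomial solution `g` for which `μ ≤ |g'| ≤ M` on the closed disk of radius `r`. -/
structure PinchedSol (r μ M : ℝ) (K : ℕ) (T : ℝ) (g : ℝ → ℂ[X]) : Prop
    extends PolySol K T g where
  pinched : ∀ t ∈ Icc 0 T, Pinched r μ M (derivative (g t))

section Comparison

variable {K : ℕ} {T r μ M : ℝ} {g h : ℝ → ℂ[X]}

theorem Pinched.hardyNorm_velocity_sub_le {B₁ B₂ : ℂ[X]} (hr : 1 < r) (hμ : 0 < μ)
    (hB₁ : Pinched r μ M B₁) (hB₂ : Pinched r μ M B₂) :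
    hardyNorm r (velocity B₁ - velocity B₂) ≤ lipConst r μ M * hardyNorm r (B₁ - B₂) :=
  HeleShaw.hardyNorm_velocity_sub_le hr hμ (hB₁.velocity_spec hr hμ).2 (hB₂.velocity_spec hr hμ).2
    hB₁ hB₂

theorem natDegree_X_mul_lt {v : ℂ[X]} (hv : v.natDegree < K) : (X * v).natDegree < K + 1 := by
  have := natDegree_mul_le (p := X) (q := v)
  rw [natDegree_X] at this
  omega

theorem divX_X_mul (p : ℂ[X]) : (X * p).divX = p :=
  Polynomial.ext fun n => by rw [coeff_divX, coeff_X_mul]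

theorem hardyNorm_derivative_X_mul_le {v : ℂ[X]} (hv : v.natDegree < K) (r : ℝ) :
    hardyNorm r (derivative (X * v)) ≤ K * hardyNorm r v := by
  have hle := hardyNorm_derivative_le (Nat.le_of_lt_succ (natDegree_X_mul_lt hv)) r
  rwa [divX_X_mul] at hle

namespace PinchedSol

theorem natDegree_velocity_sub_lt (hr : 1 < r) (hμ : 0 < μ) (hg : PinchedSol r μ M K T g)
    (hh : PinchedSol r μ M K T h) {t : ℝ} (ht : t ∈ Icc 0 T) :
    (velocity (derivative (g t)) - velocity (derivative (h t))).natDegree < K := by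
  have hr0 : 0 ≤ r := by linarith
  refine (natDegree_sub_le _ _).trans_lt (max_lt ?_ ?_)
  · exact ((hg.pinched t ht).velocity_spec hr hμ).1.trans_lt
      ((hg.pinched t ht).natDegree_derivative_lt hr0 hμ (hg.natDegree_le t ht))
  · exact ((hh.pinched t ht).velocity_spec hr hμ).1.trans_lt
      ((hh.pinched t ht).natDegree_derivative_lt hr0 hμ (hh.natDegree_le t ht))

theorem hardyNorm_velocity_sub_le (hr : 1 < r) (hμ : 0 < μ) (hg : PinchedSol r μ M K T g)
    (hh : PinchedSol r μ M K T h) {t : ℝ} (ht : t ∈ Icc 0 T) :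
    hardyNorm r (velocity (derivative (g t)) - velocity (derivative (h t))) ≤
      lipConst r μ M * hardyNorm r (derivative (g t - h t)) := by
  rw [derivative_sub]
  exact (hg.pinched t ht).hardyNorm_velocity_sub_le hr hμ (hh.pinched t ht)

theorem hardyNorm_divX_sub_le (hr : 1 < r) (hμ : 0 < μ) (hg : PinchedSol r μ M K T g)
    (hh : PinchedSol r μ M K T h) :
    ∀ t ∈ Icc 0 T, hardyNorm r (g t - h t).divX ≤
      Real.exp (lipConst r μ M * K * t) * hardyNorm r (g 0 - h 0).divX := by
  refine hardyNorm_le_exp_mul (K := K + 1)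
    (p' := fun t => velocity (derivative (g t)) - velocity (derivative (h t)))
    (fun t ht => ?_) (fun t ht => ?_) (fun t ht n => ?_) (fun t ht => ?_)
  · rw [natDegree_divX_eq_natDegree_tsub_one]
    have := hg.natDegree_sub_le hh.toPolySol ht
    omega
  · exact (natDegree_velocity_sub_lt hr hμ hg hh ht).trans K.lt_succ_self
  · simp only [coeff_divX, coeff_sub]
    exact (hg.hasDeriv t ht n).sub (hh.hasDeriv t ht n)
  · have := lipConst_nonneg hr hμ ((hg.pinched t ht).nonneg (by linarith))
    rw [mul_assoc]
    refine (hardyNorm_velocity_sub_le hr hμ hg hh ht).trans ?_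
    gcongr
    exact hardyNorm_derivative_le (hg.natDegree_sub_le hh.toPolySol ht) r

theorem hardyNorm_derivative_sub_le (hr : 1 < r) (hμ : 0 < μ) (hg : PinchedSol r μ M K T g)
    (hh : PinchedSol r μ M K T h) :
    ∀ t ∈ Icc 0 T, hardyNorm r (derivative (g t - h t)) ≤
      Real.exp (lipConst r μ M * K * t) * hardyNorm r (derivative (g 0 - h 0)) := by
  set v := fun t => velocity (derivative (g t)) - velocity (derivative (h t))
  have hv : ∀ t ∈ Icc 0 T, (v t).natDegree < K := fun t ht =>
    natDegree_velocity_sub_lt hr hμ hg hh ht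
  refine hardyNorm_le_exp_mul (K := K + 1) (p' := fun t => derivative (X * v t))
    (fun t ht => ?_) (fun t ht => ?_) (fun t ht n => ?_) (fun t ht => ?_)
  · have := natDegree_derivative_le (g t - h t)
    have := hg.natDegree_sub_le hh.toPolySol ht
    omega
  · have := natDegree_derivative_le (X * v t)
    have := natDegree_X_mul_lt (hv t ht)
    omega
  · simp only [coeff_derivative, coeff_sub, coeff_X_mul, v]
    exact ((hg.hasDeriv t ht n).sub (hh.hasDeriv t ht n)).mul_const _
  · calc hardyNorm r (derivative (X * v t)) ≤ K * hardyNorm r (v t) :=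
          hardyNorm_derivative_X_mul_le (hv t ht) r
      _ ≤ K * (lipConst r μ M * hardyNorm r (derivative (g t - h t))) :=
        mul_le_mul_of_nonneg_left (hardyNorm_velocity_sub_le hr hμ hg hh ht) K.cast_nonneg
      _ = _ := by ring

end PinchedSol

end Comparison

section VelocityField

variable {K : ℕ} {r μ M : ℝ}

/-- The polynomial `x₀ ξ + ⋯ + x_{K-1} ξ^K`. -/
def toPoly (K : ℕ) : (Fin K → ℂ) →ₗ[ℂ] ℂ[X] := LinearMap.mulLeft ℂ X ∘ₗ ofFn K

/-- The vector field on coefficient vectors which is integrated to obtain polynomial solutions. -/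
def velocityField (x : Fin K → ℂ) : Fin K → ℂ :=
  fun i => (velocity (derivative (toPoly K x))).coeff i

theorem coeff_toPoly_zero (x : Fin K → ℂ) : (toPoly K x).coeff 0 = 0 := coeff_X_mul_zero _

theorem coeff_toPoly_succ (x : Fin K → ℂ) (i : Fin K) :
    (toPoly K x).coeff (i + 1) = x i :=
  (coeff_X_mul _ _).trans (ofFn_coeff_eq_val_of_lt x i.2)

theorem natDegree_toPoly_le (x : Fin K → ℂ) : (toPoly K x).natDegree ≤ K := by
  refine natDegree_le_iff_coeff_eq_zero.2 fun n hn => ?_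
  obtain ⟨n, rfl⟩ := Nat.exists_eq_succ_of_ne_zero (Nat.ne_zero_of_lt hn)
  exact (coeff_X_mul _ _).trans (ofFn_coeff_eq_zero_of_ge x (by omega))

theorem toPoly_coeff_succ {p : ℂ[X]} (hp : p.natDegree ≤ K) (h0 : p.coeff 0 = 0) :
    toPoly K (fun i => p.coeff (i + 1)) = p := by
  ext n
  rcases n with _ | n
  · rw [coeff_toPoly_zero, h0]
  · rcases lt_or_ge n K with hn | hn
    · exact coeff_toPoly_succ _ ⟨n, hn⟩
    · rw [coeff_eq_zero_of_natDegree_lt ((natDegree_toPoly_le _).trans_lt (by omega)),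
        coeff_eq_zero_of_natDegree_lt (by omega)]

theorem hardyNorm_divX_toPoly_le (hr : 0 ≤ r) (x : Fin K → ℂ) :
    hardyNorm r (toPoly K x).divX ≤ (∑ n ∈ Finset.range (K + 1), r ^ n) * ‖x‖ := by
  have hdeg : (toPoly K x).divX.natDegree < K + 1 := by
    have := natDegree_toPoly_le x
    rw [natDegree_divX_eq_natDegree_tsub_one]
    omega
  refine (hardyNorm_le_wnorm hr _).trans ?_
  rw [wnorm_eq_sum hdeg, Finset.sum_mul]
  refine Finset.sum_le_sum fun n _ => ?_
  rw [coeff_divX, mul_comm]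
  gcongr
  rcases lt_or_ge n K with hn | hn
  · exact (congrArg _ (coeff_toPoly_succ x ⟨n, hn⟩)).trans_le (norm_le_pi_norm x _)
  · rw [coeff_eq_zero_of_natDegree_lt ((natDegree_toPoly_le x).trans_lt (by omega)), norm_zero]
    exact norm_nonneg x

theorem exists_lipschitzOnWith_velocityField (hr : 1 < r) (hμ : 0 < μ) (hM : 0 ≤ M) :
    ∃ L : ℝ≥0, LipschitzOnWith L (velocityField (K := K))
      {x | Pinched r μ M (derivative (toPoly K x))} := by
  have hr0 : 0 ≤ r := by linarith
  have hL := lipConst_nonneg hr hμ hM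
  set S := ∑ n ∈ Finset.range (K + 1), r ^ n
  have hS : 0 ≤ S := Finset.sum_nonneg fun n _ => by positivity
  refine ⟨(lipConst r μ M * (K * S)).toNNReal, LipschitzOnWith.of_dist_le_mul fun x hx y hy => ?_⟩
  rw [Real.coe_toNNReal _ (by positivity)]
  refine (dist_pi_le_iff (by positivity)).2 fun i => ?_
  set v := velocity (derivative (toPoly K x)) - velocity (derivative (toPoly K y))
  calc dist (velocityField x i) (velocityField y i) = ‖v.coeff i‖ := by
        rw [dist_eq_norm, coeff_sub]; rfl
    _ ≤ ‖v.coeff i‖ * r ^ (i : ℕ) :=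
        le_mul_of_one_le_right (norm_nonneg _) (one_le_pow₀ hr.le)
    _ ≤ hardyNorm r v := norm_coeff_mul_pow_le_hardyNorm v i
    _ ≤ lipConst r μ M * hardyNorm r (derivative (toPoly K (x - y))) := by
        rw [map_sub, derivative_sub]
        exact Pinched.hardyNorm_velocity_sub_le hr hμ hx hy
    _ ≤ lipConst r μ M * (K * (S * ‖x - y‖)) := by
        gcongr
        refine (hardyNorm_derivative_le (natDegree_toPoly_le _) r).trans ?_
        gcongr
        exact hardyNorm_divX_toPoly_le hr0 _
    _ = _ := by rw [dist_eq_norm]; ring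

theorem norm_velocityField_le (hr : 1 < r) (hμ : 0 < μ) (hM : 0 ≤ M) {x : Fin K → ℂ}
    (hx : Pinched r μ M (derivative (toPoly K x))) : ‖velocityField x‖ ≤ M * phiBound r μ :=
  (pi_norm_le_iff_of_nonneg (mul_nonneg hM (phiBound_pos hr hμ).le)).2 fun i =>
    (hx.velocity_spec hr hμ).2.norm_coeff_le hr hμ hx i

theorem exists_curve_pinchedSol_of_pinched (hr : 1 < r) (hμ : 0 < μ) (hM : 0 ≤ M) {T : ℝ}
    (hT : 0 ≤ T) {g₀ : ℂ[X]} (hg₀ : g₀.natDegree ≤ K) (h0 : g₀.coeff 0 = 0) :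
    ∃ g : ℝ → ℂ[X], g 0 = g₀ ∧ (∀ t, (g t).natDegree ≤ K) ∧
      (∀ n, ContinuousOn (fun t => (g t).coeff n) (Icc 0 T)) ∧
      ∀ τ ≤ T, (∀ t ∈ Icc 0 τ, Pinched r μ M (derivative (g t))) → PinchedSol r μ M K τ g := by
  obtain ⟨L, hL⟩ := exists_lipschitzOnWith_velocityField (K := K) hr hμ hM
  obtain ⟨x, hx0, hxc, hx⟩ := exists_solution_of_lipschitzOnWith hL
    (fun x hx => norm_velocityField_le hr hμ hM hx) hT fun i : Fin K => g₀.coeff (i + 1)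
  refine ⟨fun t => toPoly K (x t), ?_, fun t => natDegree_toPoly_le _, fun n => ?_,
    fun τ hτ hp => ⟨⟨fun t _ => natDegree_toPoly_le _, fun t _ => coeff_toPoly_zero _,
      fun t ht n => ?_⟩, hp⟩⟩
  · simp only [hx0, toPoly_coeff_succ hg₀ h0]
  · exact ((lcoeff ℂ n).comp (toPoly K)).continuous_of_finiteDimensional.comp_continuousOn hxc
  · have hd := (hx t ⟨ht.1, ht.2.trans hτ⟩ (hp t ht)).mono (Icc_subset_Icc_right hτ)
    rcases lt_or_ge n K with hn | hn
    · have hcoeff : (fun t => (toPoly K (x t)).coeff (n + 1)) = fun t => x t ⟨n, hn⟩ :=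
        funext fun t => coeff_toPoly_succ _ ⟨n, hn⟩
      rw [hcoeff]
      exact hasDerivWithinAt_pi.1 hd ⟨n, hn⟩
    · have hcoeff : (fun t => (toPoly K (x t)).coeff (n + 1)) = fun _ => 0 := funext fun t =>
        coeff_eq_zero_of_natDegree_lt ((natDegree_toPoly_le (x t)).trans_lt (by omega))
      have hdeg := ((hp t ht).velocity_spec hr hμ).1.trans_lt
        ((hp t ht).natDegree_derivative_lt (by linarith) hμ (natDegree_toPoly_le (x t)))
      rw [hcoeff, coeff_eq_zero_of_natDegree_lt (hdeg.trans_le hn)]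
      exact hasDerivWithinAt_const _ _ _

end VelocityField

/-! ### Perturbing the initial value by one coefficient -/

section Step

variable {K : ℕ} {T r m M A A' : ℝ}

theorem PinchedSol.mono {μ : ℝ} {g : ℝ → ℂ[X]} {K' : ℕ} {T' : ℝ} (hg : PinchedSol r μ M K T g)
    (hT : T' ≤ T) (hK : K ≤ K') : PinchedSol r μ M K' T' g :=
  ⟨hg.toPolySol.mono hT hK, fun t ht => hg.pinched t ⟨ht.1, ht.2.trans hT⟩⟩

theorem PinchedSol.weaken {μ μ' M' : ℝ} {g : ℝ → ℂ[X]} (hg : PinchedSol r μ M K T g) (hμ : μ' ≤ μ)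
    (hM : M ≤ M') : PinchedSol r μ' M' K T g :=
  ⟨hg.toPolySol, fun t ht => ⟨fun z hz => hμ.trans ((hg.pinched t ht).le_norm_eval z hz),
    fun z hz => ((hg.pinched t ht).norm_eval_le z hz).trans hM⟩⟩

theorem PinchedSol.wnorm_derivative_sub_le {μ : ℝ} {g h : ℝ → ℂ[X]} (hr : 1 < r) (hμ : 0 < μ)
    (hg : PinchedSol r μ M K T g) (hh : PinchedSol r μ M K T h) {t : ℝ} (ht : t ∈ Icc 0 T) :
    wnorm r (derivative (g t - h t)) ≤
      √K * (Real.exp (lipConst r μ M * K * t) * hardyNorm r (derivative (g 0 - h 0))) :=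
  (wnorm_le_hardyNorm_derivative (hg.toPolySol.natDegree_sub_le hh.toPolySol ht) r).trans <|
    mul_le_mul_of_nonneg_left (hg.hardyNorm_derivative_sub_le hr hμ hh t ht) (Real.sqrt_nonneg _)

theorem Pinched.of_wnorm_derivative_sub_le {p q : ℂ[X]} (hq : Pinched r m M (derivative q))
    (h : wnorm r (derivative (p - q)) ≤ A) : Pinched r (m - A) (M + A) (derivative p) := by
  have hdist : ∀ z : ℂ, ‖z‖ ≤ r → ‖(derivative p).eval z - (derivative q).eval z‖ ≤ A :=
    fun z hz => by
      rw [← eval_sub, ← derivative_sub]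
      exact (norm_eval_le_wnorm _ hz).trans h
  constructor <;> intro z hz
  · have := norm_sub_norm_le ((derivative q).eval z) ((derivative p).eval z)
    rw [norm_sub_rev] at this
    linarith [hdist z hz, hq.le_norm_eval z hz]
  · linarith [hdist z hz, hq.norm_eval_le z hz,
      norm_sub_norm_le ((derivative p).eval z) ((derivative q).eval z)]

theorem continuousOn_wnorm {p : ℝ → ℂ[X]} {s : Set ℝ} (hp : ∀ t ∈ s, (p t).natDegree ≤ K)
    (hc : ∀ n, ContinuousOn (fun t => (p t).coeff n) s) (r : ℝ) :
    ContinuousOn (fun t => wnorm r (p t)) s :=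
  (continuousOn_finsetSum _ fun n _ => (hc n).norm.mul continuousOn_const).congr fun t ht =>
    wnorm_eq_sum (Nat.lt_succ_of_le (hp t ht)) r

theorem exists_pinchedSol_add (hr : 1 < r) (hA' : A' < m) (hT : 0 ≤ T) {P h : ℝ → ℂ[X]}
    (hPdeg : ∀ t ∈ Icc 0 T, (P t).natDegree ≤ K)
    (hPc : ∀ n, ContinuousOn (fun t => (P t).coeff n) (Icc 0 T))
    (hPp : ∀ t ∈ Icc 0 T, Pinched r m M (derivative (P t)))
    (hh : PinchedSol r (m - A') (M + A') K T h) {q : ℂ[X]} (hq : q.natDegree ≤ K)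
    (hq0 : q.coeff 0 = 0) {ε : ℝ} (hhA : ∀ t ∈ Icc 0 T, wnorm r (derivative (h t - P t)) ≤ A)
    (hAε : A + ε < A') (hε : ∀ t ∈ Icc 0 T, √K *
      (Real.exp (lipConst r (m - A') (M + A') * K * t) * hardyNorm r (derivative q)) ≤ ε) :
    ∃ g : ℝ → ℂ[X], PinchedSol r (m - A') (M + A') K T g ∧ g 0 = h 0 + q ∧
      ∀ t ∈ Icc 0 T, wnorm r (derivative (g t - P t)) ≤ A + ε := by
  have hr0 : 0 ≤ r := by linarith
  have hμ : 0 < m - A' := by linarith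
  have hT0 : (0 : ℝ) ∈ Icc 0 T := left_mem_Icc.2 hT
  have hM : 0 ≤ M + A' := (hh.pinched 0 hT0).nonneg hr0
  obtain ⟨g, hg0, hgdeg, hgc, hgsol⟩ := exists_curve_pinchedSol_of_pinched (g₀ := h 0 + q) hr hμ
    hM hT (natDegree_add_le_of_degree_le (hh.natDegree_le 0 hT0) hq)
    (by rw [coeff_add, hh.coeff_zero 0 hT0, hq0, add_zero])
  have hsol : ∀ τ ∈ Icc 0 T, (∀ t ∈ Icc 0 τ, wnorm r (derivative (g t - P t)) ≤ A') →
      PinchedSol r (m - A') (M + A') K τ g := fun τ hτ hle => hgsol τ hτ.2 fun t ht =>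
    (hPp t ⟨ht.1, ht.2.trans hτ.2⟩).of_wnorm_derivative_sub_le (hle t ht)
  have hnear : ∀ τ ∈ Icc 0 T, wnorm r (derivative (g τ - h τ)) ≤ ε →
      wnorm r (derivative (g τ - P τ)) ≤ A + ε := fun τ hτ hgh => by
    have := wnorm_sub_le hr0 (derivative (g τ)) (derivative (h τ)) (derivative (P τ))
    simp only [← derivative_sub] at this
    linarith [hhA τ hτ]
  have hinit : wnorm r (derivative (g 0 - h 0)) ≤ ε := by
    rw [hg0, add_sub_cancel_left]
    refine (wnorm_le_hardyNorm_derivative hq r).trans ?_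
    simpa only [mul_zero, Real.exp_zero, one_mul] using hε 0 hT0
  have hcont : ContinuousOn (fun t => wnorm r (derivative (g t - P t))) (Icc 0 T) := by
    refine continuousOn_wnorm (K := K) (fun t ht => ?_) (fun n => ?_) r
    · have := natDegree_derivative_le (g t - P t)
      have := natDegree_sub_le_of_le (hgdeg t) (hPdeg t ht)
      omega
    · simp only [coeff_derivative, coeff_sub]
      exact ((hgc _).sub (hPc _)).mul continuousOn_const
  have hbound := le_of_bootstrap hcont hAε (hnear 0 hT0 hinit) fun τ hτ hle => by
    refine hnear τ hτ (le_trans ?_ (hε τ hτ))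
    have := (hsol τ hτ hle).wnorm_derivative_sub_le hr hμ (hh.mono hτ.2 le_rfl)
      (right_mem_Icc.2 hτ.1)
    rwa [hg0, add_sub_cancel_left] at this
  exact ⟨g, hsol T (right_mem_Icc.2 hT) fun t ht => (hbound t ht).trans hAε.le, hg0, hbound⟩

end Step

section StepBound

variable {c r ρ t : ℝ} {k k₀ : ℕ}

theorem max_le_mul_of_pos (hk : 0 < k) (hk₀ : 0 < k₀) : max k k₀ ≤ k₀ * k :=
  max_le (Nat.le_mul_of_pos_left k hk₀) (Nat.le_mul_of_pos_right k₀ hk)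

/-- A bound on `[0, T]` for the effect on a solution of the addition of `b ξ^k` to its initial
value, where `T` and `ρ` are related by `c k₀ T ≤ log (ρ / r)`. The exponent `j` is the order of
differentiation, and `√k k ^ j` is the weight `k ^ (1/2 + j)` of `rhoNorm`. -/
def stepBound (k₀ : ℕ) (ρ : ℝ) (j k : ℕ) (b : ℂ) : ℝ :=
  √k₀ * (‖b‖ * ρ ^ k * (√k * (k : ℝ) ^ j))

theorem stepBound_nonneg (hρ : 0 ≤ ρ) (k₀ j k : ℕ) (b : ℂ) : 0 ≤ stepBound k₀ ρ j k b := by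
  unfold stepBound
  positivity

theorem exp_mul_max_mul_le_pow (hc : 0 ≤ c) (ht : 0 ≤ t) (hr : 0 < r) (hρ : 0 < ρ) (hk : 0 < k)
    (hk₀ : 0 < k₀) (hct : c * k₀ * t ≤ Real.log (ρ / r)) :
    Real.exp (c * (max k k₀ : ℕ) * t) ≤ (ρ / r) ^ k := by
  rw [← Real.exp_log (div_pos hρ hr), ← Real.exp_nat_mul, Real.exp_le_exp]
  calc c * (max k k₀ : ℕ) * t ≤ c * (k₀ * k : ℕ) * t := by
        gcongr
        exact max_le_mul_of_pos hk hk₀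
    _ = k * (c * k₀ * t) := by push_cast; ring
    _ ≤ k * Real.log (ρ / r) := by gcongr

theorem mul_sqrt_mul_exp_mul_le_stepBound (hc : 0 ≤ c) (ht : 0 ≤ t) (hr : 0 < r) (hρ : 0 < ρ)
    (hk : 0 < k) (hk₀ : 0 < k₀) (hct : c * k₀ * t ≤ Real.log (ρ / r)) (b : ℂ) :
    r * (√(max k k₀ : ℕ) * (Real.exp (c * (max k k₀ : ℕ) * t) * (‖b‖ * r ^ (k - 1)))) ≤
      stepBound k₀ ρ 0 k b := by
  have hsqrt : √((max k k₀ : ℕ) : ℝ) ≤ √k₀ * √k := by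
    rw [← Real.sqrt_mul (Nat.cast_nonneg _)]
    exact Real.sqrt_le_sqrt (by exact_mod_cast max_le_mul_of_pos hk hk₀)
  have hpow : (ρ / r) ^ k * (r * r ^ (k - 1)) = ρ ^ k := by
    rw [mul_pow_sub_one hk.ne', ← mul_pow, div_mul_cancel₀ ρ hr.ne']
  calc r * (√(max k k₀ : ℕ) * (Real.exp (c * (max k k₀ : ℕ) * t) * (‖b‖ * r ^ (k - 1))))
      ≤ r * ((√k₀ * √k) * ((ρ / r) ^ k * (‖b‖ * r ^ (k - 1)))) := by
        gcongr
        exact exp_mul_max_mul_le_pow hc ht hr hρ hk hk₀ hct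
    _ = √k₀ * √k * ‖b‖ * ((ρ / r) ^ k * (r * r ^ (k - 1))) := by ring
    _ = stepBound k₀ ρ 0 k b := by rw [hpow, stepBound]; ring

theorem divX_C_mul_X_pow_of_pos (hk : 0 < k) (b : ℂ) :
    (C b * X ^ k).divX = C b * X ^ (k - 1) := by
  rw [divX_C_mul_X_pow, if_neg hk.ne']

theorem sqrt_mul_exp_mul_hardyNorm_derivative_le_stepBound (hc : 0 ≤ c) (ht : 0 ≤ t) (hr : 1 < r)
    (hρ : 0 < ρ) (hk : 0 < k) (hk₀ : 0 < k₀) (hct : c * k₀ * t ≤ Real.log (ρ / r)) (b : ℂ) :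
    √(max k k₀ : ℕ) * (Real.exp (c * (max k k₀ : ℕ) * t) *
      hardyNorm r (derivative (C b * X ^ k))) ≤ stepBound k₀ ρ 1 k b := by
  have hr0 : 0 < r := by linarith
  have hcore := mul_sqrt_mul_exp_mul_le_stepBound hc ht hr0 hρ hk hk₀ hct b
  rw [derivative_C_mul_X_pow, hardyNorm_C_mul_X_pow hr0.le, norm_mul, Complex.norm_natCast]
  set y := √(max k k₀ : ℕ) * (Real.exp (c * (max k k₀ : ℕ) * t) * (‖b‖ * r ^ (k - 1)))
  have hy : 0 ≤ y := by positivity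
  calc √(max k k₀ : ℕ) * (Real.exp (c * (max k k₀ : ℕ) * t) * (‖b‖ * k * r ^ (k - 1)))
      = k * y := by ring
    _ ≤ k * (r * y) := by gcongr; exact le_mul_of_one_le_left hy hr.le
    _ ≤ k * stepBound k₀ ρ 0 k b := by gcongr
    _ = stepBound k₀ ρ 1 k b := by simp only [stepBound]; ring

end StepBound

section Sequence

variable {k₀ k : ℕ} {T r ρ μ m M A A' : ℝ}

theorem exists_pinchedSol_add_sum (hr : 1 < r) (hρ : 0 < ρ) (hA' : A' < m) (hAA' : A < A')
    (hk₀ : 0 < k₀) (hT : 0 ≤ T) (hTle : lipConst r (m - A') (M + A') * k₀ * T ≤ Real.log (ρ / r))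
    {p : ℝ → ℂ[X]} {b : ℕ → ℂ} (hp : PinchedSol r m M k₀ T p)
    (hsum : ∀ k, ∑ i ∈ Finset.range k, stepBound k₀ ρ 1 (i + 1) (b (i + 1)) ≤ A) (k : ℕ) :
    ∃ g : ℝ → ℂ[X], PinchedSol r (m - A') (M + A') (max k k₀) T g ∧
      g 0 = p 0 + ∑ i ∈ Finset.range k, C (b (i + 1)) * X ^ (i + 1) ∧
      ∀ t ∈ Icc 0 T, wnorm r (derivative (g t - p t)) ≤
        ∑ i ∈ Finset.range k, stepBound k₀ ρ 1 (i + 1) (b (i + 1)) := by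
  have hA'0 : 0 ≤ A' := (hsum 0).trans hAA'.le
  induction k with
  | zero =>
    refine ⟨p, (hp.mono le_rfl (le_max_right _ _)).weaken (by linarith) (by linarith), ?_, ?_⟩
    · simp
    · simp [wnorm_zero]
  | succ k ih =>
    obtain ⟨h, hh, hh0, hhp⟩ := ih
    have hc : 0 ≤ lipConst r (m - A') (M + A') := lipConst_nonneg hr (sub_pos.2 hA')
      ((hh.pinched 0 (left_mem_Icc.2 hT)).nonneg (by linarith))
    obtain ⟨g, hg, hg0, hgp⟩ := exists_pinchedSol_add (K := max (k + 1) k₀)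
      (q := C (b (k + 1)) * X ^ (k + 1)) (ε := stepBound k₀ ρ 1 (k + 1) (b (k + 1))) hr hA' hT
      (fun t ht => (hp.natDegree_le t ht).trans (le_max_right _ _)) hp.toPolySol.continuousOn_coeff
      hp.pinched (hh.mono le_rfl (max_le_max_right _ k.le_succ))
      ((natDegree_C_mul_X_pow_le _ _).trans (le_max_left _ _)) (by simp) hhp
      (by rw [← Finset.sum_range_succ]; exact (hsum _).trans_lt hAA')
      (fun t ht => sqrt_mul_exp_mul_hardyNorm_derivative_le_stepBound hc ht.1 hr hρ k.succ_pos hk₀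
        ((mul_le_mul_of_nonneg_left ht.2 (by positivity)).trans hTle) _)
    refine ⟨g, hg, ?_, fun t ht => ?_⟩
    · rw [hg0, hh0, Finset.sum_range_succ, add_assoc]
    · rw [Finset.sum_range_succ]
      exact hgp t ht

theorem exists_pinchedSol_seq (hr : 1 < r) (hρ : 0 < ρ) (hA' : A' < m) (hAA' : A < A')
    (hk₀ : 0 < k₀) (hT : 0 ≤ T) (hTle : lipConst r (m - A') (M + A') * k₀ * T ≤ Real.log (ρ / r))
    {p : ℝ → ℂ[X]} {b : ℕ → ℂ} (hp : PinchedSol r m M k₀ T p)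
    (hsum : ∀ k, ∑ i ∈ Finset.range k, stepBound k₀ ρ 1 (i + 1) (b (i + 1)) ≤ A) :
    ∃ g : ℕ → ℝ → ℂ[X], g 0 = p ∧ ∀ k, PinchedSol r (m - A') (M + A') (max k k₀) T (g k) ∧
      g k 0 = p 0 + ∑ i ∈ Finset.range k, C (b (i + 1)) * X ^ (i + 1) := by
  have hA'0 : 0 ≤ A' := (hsum 0).trans hAA'.le
  choose g hg hg0 _ using exists_pinchedSol_add_sum hr hρ hA' hAA' hk₀ hT hTle hp hsum
  refine ⟨fun | 0 => p | k + 1 => g (k + 1), rfl, ?_⟩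
  rintro (_ | k)
  · refine ⟨(hp.mono le_rfl (le_max_right _ _)).weaken (by linarith) (by linarith), by simp⟩
  · exact ⟨hg _, hg0 _⟩

namespace PinchedSol

variable {g h : ℝ → ℂ[X]} {b : ℂ} {t : ℝ}

theorem wnorm_derivative_sub_le_stepBound (hr : 1 < r) (hρ : 0 < ρ) (hμ : 0 < μ) (hk : 0 < k)
    (hk₀ : 0 < k₀) (hTle : lipConst r μ M * k₀ * T ≤ Real.log (ρ / r))
    (hg : PinchedSol r μ M (max k k₀) T g) (hh : PinchedSol r μ M (max k k₀) T h)
    (h0 : g 0 - h 0 = C b * X ^ k) (ht : t ∈ Icc 0 T) :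
    wnorm r (derivative (g t - h t)) ≤ stepBound k₀ ρ 1 k b := by
  have hc := lipConst_nonneg hr hμ ((hg.pinched t ht).nonneg (by linarith))
  refine (hg.wnorm_derivative_sub_le hr hμ hh ht).trans ?_
  rw [h0]
  exact sqrt_mul_exp_mul_hardyNorm_derivative_le_stepBound hc ht.1 hr hρ hk hk₀
    ((mul_le_mul_of_nonneg_left ht.2 (by positivity)).trans hTle) b

theorem wnorm_velocity_sub_le_stepBound (hr : 1 < r) (hρ : 0 < ρ) (hμ : 0 < μ) (hk : 0 < k)
    (hk₀ : 0 < k₀) (hTle : lipConst r μ M * k₀ * T ≤ Real.log (ρ / r))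
    (hg : PinchedSol r μ M (max k k₀) T g) (hh : PinchedSol r μ M (max k k₀) T h)
    (h0 : g 0 - h 0 = C b * X ^ k) (ht : t ∈ Icc 0 T) :
    wnorm r (velocity (derivative (g t)) - velocity (derivative (h t))) ≤
      lipConst r μ M * stepBound k₀ ρ 1 k b := by
  set K := max k k₀
  have hc := lipConst_nonneg hr hμ ((hg.pinched t ht).nonneg (by linarith))
  have hder := hg.hardyNorm_derivative_sub_le hr hμ hh t ht
  rw [h0] at hder
  calc wnorm r (velocity (derivative (g t)) - velocity (derivative (h t)))
      ≤ √K * hardyNorm r (velocity (derivative (g t)) - velocity (derivative (h t))) :=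
        wnorm_le_hardyNorm (hg.natDegree_velocity_sub_lt hr hμ hh ht) r
    _ ≤ √K * (lipConst r μ M * (Real.exp (lipConst r μ M * K * t) *
          hardyNorm r (derivative (C b * X ^ k)))) := by
        gcongr
        exact (hg.hardyNorm_velocity_sub_le hr hμ hh ht).trans
          (mul_le_mul_of_nonneg_left hder hc)
    _ = lipConst r μ M * (√K * (Real.exp (lipConst r μ M * K * t) *
          hardyNorm r (derivative (C b * X ^ k)))) := by ring
    _ ≤ lipConst r μ M * stepBound k₀ ρ 1 k b := by
        gcongr
        exact sqrt_mul_exp_mul_hardyNorm_derivative_le_stepBound hc ht.1 hr hρ hk hk₀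
          ((mul_le_mul_of_nonneg_left ht.2 (by positivity)).trans hTle) b

theorem wnorm_iterate_derivative_sub_le_stepBound (hr : 1 < r) (hρ : 0 < ρ) (hμ : 0 < μ)
    (hk : 0 < k) (hk₀ : 0 < k₀) (hTle : lipConst r μ M * k₀ * T ≤ Real.log (ρ / r))
    (hg : PinchedSol r μ M (max k k₀) T g) (hh : PinchedSol r μ M (max k k₀) T h)
    (h0 : g 0 - h 0 = C b * X ^ k) (ht : t ∈ Icc 0 T) (j : ℕ) :
    wnorm r (derivative^[j] (g t - h t)) ≤ (k₀ : ℝ) ^ j * stepBound k₀ ρ j k b := by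
  set K := max k k₀
  have hr0 : 0 < r := by linarith
  have hc := lipConst_nonneg hr hμ ((hg.pinched t ht).nonneg hr0.le)
  have hdeg := hg.toPolySol.natDegree_sub_le hh.toPolySol ht
  have hdivX := hg.hardyNorm_divX_sub_le hr hμ hh t ht
  rw [h0, divX_C_mul_X_pow_of_pos hk, hardyNorm_C_mul_X_pow hr0.le] at hdivX
  have hKk : (K : ℝ) ≤ k₀ * k := by exact_mod_cast max_le_mul_of_pos hk hk₀
  have hwnorm : wnorm r (g t - h t) ≤ stepBound k₀ ρ 0 k b :=
    calc wnorm r (g t - h t)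
        ≤ r * (√K * hardyNorm r (g t - h t).divX) :=
          wnorm_le_hardyNorm_divX hr0.le hdeg (hg.toPolySol.coeff_zero_sub hh.toPolySol ht)
      _ ≤ r * (√K * (Real.exp (lipConst r μ M * K * t) * (‖b‖ * r ^ (k - 1)))) := by gcongr
      _ ≤ stepBound k₀ ρ 0 k b := mul_sqrt_mul_exp_mul_le_stepBound hc ht.1 hr0 hρ hk hk₀
          ((mul_le_mul_of_nonneg_left ht.2 (by positivity)).trans hTle) b
  calc wnorm r (derivative^[j] (g t - h t)) ≤ (K : ℝ) ^ j * wnorm r (g t - h t) :=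
        wnorm_iterate_derivative_le hr.le hdeg j
    _ ≤ (k₀ * k : ℝ) ^ j * stepBound k₀ ρ 0 k b := by
        have := wnorm_nonneg hr0.le (g t - h t)
        gcongr
    _ = (k₀ : ℝ) ^ j * stepBound k₀ ρ j k b := by simp only [stepBound]; ring

end PinchedSol

end Sequence

/-! ### Locally univalent functions -/

section LocallyUnivalent

/-- Taking an `n`-th root of the unit `h` in `f = (z - z₀)ⁿ h` shows that `f` is locally the
composition of `w ↦ a wⁿ` and a local biholomorphism. -/
theorem exists_eventuallyEq_mul_pow {f : ℂ → ℂ} {z₀ : ℂ} {n : ℕ} (hf : AnalyticAt ℂ f z₀)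
    (hn0 : n ≠ 0) (hn : analyticOrderAt f z₀ = n) :
    ∃ (a : ℂ) (ψ : ℂ → ℂ), HasStrictDerivAt ψ 1 z₀ ∧ ψ z₀ = 0 ∧
      ∀ᶠ z in 𝓝 z₀, f z = a * ψ z ^ n := by
  obtain ⟨h, hh, hh0, hfh⟩ := hf.analyticOrderAt_eq_natCast.1 hn
  set u : ℂ → ℂ := fun z => (h z / h z₀) ^ ((n : ℂ)⁻¹)
  have hslit : h z₀ / h z₀ ∈ Complex.slitPlane := by
    rw [div_self hh0]
    exact Complex.one_mem_slitPlane
  have hu : AnalyticAt ℂ u z₀ :=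
    (hh.div analyticAt_const hh0).cpow analyticAt_const hslit
  have hu0 : u z₀ = 1 := by simp [u, div_self hh0]
  refine ⟨h z₀, fun z => (z - z₀) * u z, ?_, by simp, ?_⟩
  · have hid : HasStrictDerivAt (fun z => z - z₀) 1 z₀ := (hasStrictDerivAt_id z₀).sub_const z₀
    simpa [hu0] using hid.fun_mul hu.hasStrictDerivAt
  · filter_upwards [hfh] with z hz
    rw [hz, smul_eq_mul, mul_pow, Complex.cpow_nat_inv_pow _ hn0]
    field_simp

theorem deriv_ne_zero_of_injOn {f : ℂ → ℂ} {z₀ : ℂ} {U : Set ℂ} (hf : AnalyticAt ℂ f z₀)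
    (hU : U ∈ 𝓝 z₀) (hinj : InjOn f U) : deriv f z₀ ≠ 0 := by
  intro hderiv
  have hsub : AnalyticAt ℂ (fun z => f z - f z₀) z₀ := hf.sub analyticAt_const
  have htop : analyticOrderAt (fun z => f z - f z₀) z₀ ≠ ⊤ := fun h => by
    obtain ⟨z, ⟨hzf, hzU⟩, hz⟩ := ((((analyticOrderAt_eq_top.1 h).and hU).filter_mono
      nhdsWithin_le_nhds).and (self_mem_nhdsWithin (a := z₀) (s := {z₀}ᶜ))).exists
    exact hz (hinj hzU (mem_of_mem_nhds hU) (sub_eq_zero.1 hzf))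
  obtain ⟨n, hn⟩ := ENat.ne_top_iff_exists.1 htop
  have hn2 : 1 < n := by
    have hpos : analyticOrderAt (deriv f) z₀ ≠ 0 :=
      analyticOrderAt_ne_zero.2 ⟨hf.deriv, hderiv⟩
    have hadd := hf.analyticOrderAt_deriv_add_one
    rw [← hn] at hadd
    have : (1 : ℕ∞) < n := by
      rw [← hadd]
      exact ENat.lt_add_left (by simp) (pos_iff_ne_zero.2 hpos)
    exact_mod_cast this
  obtain ⟨a, ψ, hψ, hψ0, hfψ⟩ := exists_eventuallyEq_mul_pow hsub (by omega) hn.symm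
  set V := {z | f z - f z₀ = a * ψ z ^ n} ∩ U
  have himage : ψ '' V ∈ 𝓝 (0 : ℂ) := by
    rw [← hψ0, ← hψ.map_nhds_eq one_ne_zero]
    exact image_mem_map (inter_mem hfψ hU)
  -- Both `w` and `ζ w` are values of `ψ`, and they have the same `n`-th power.
  have hζ := Complex.isPrimitiveRoot_exp n (by omega)
  set ζ := Complex.exp (2 * Real.pi * Complex.I / n)
  have hrotate : (fun w => ζ * w) ⁻¹' (ψ '' V) ∈ 𝓝 (0 : ℂ) :=
    (continuous_const_mul ζ).continuousAt (by simpa using himage)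
  obtain ⟨w, ⟨⟨z₁, hz₁, hw₁⟩, z₂, hz₂, hw₂⟩, hw⟩ := ((((eventually_mem_set.2 himage).and
    (eventually_mem_set.2 hrotate)).filter_mono nhdsWithin_le_nhds).and
      (self_mem_nhdsWithin (a := (0 : ℂ)) (s := {0}ᶜ))).exists
  have hz : z₁ = z₂ := hinj hz₁.2 hz₂.2 <| sub_left_injective <|
    show f z₁ - f z₀ = f z₂ - f z₀ by
      rw [hz₁.1, hz₂.1, hw₁, hw₂, mul_pow, hζ.pow_eq_one, one_mul]
  rw [hz, hw₂] at hw₁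
  exact hζ.ne_one hn2 ((mul_eq_right₀ hw).1 hw₁)

variable {E : Set ℂ} {f : ℂ → ℂ}

theorem IsOmega.deriv_ne_zero (h : IsOmega E f) {z : ℂ} (hz : z ∈ E) : deriv f z ≠ 0 := by
  obtain ⟨U, hU, hinj⟩ := h.locallyUnivalent z hz
  exact deriv_ne_zero_of_injOn (h.analytic z hz) hU hinj

theorem isOmega_of_deriv_ne_zero (hf : AnalyticOnNhd ℂ f E) (hd : ∀ z ∈ E, deriv f z ≠ 0)
    (h0 : f 0 = 0) (him : (deriv f 0).im = 0) (hre : 0 < (deriv f 0).re) : IsOmega E f where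
  analytic := hf
  locallyUnivalent z hz :=
    have hs := (hf z hz).hasStrictDerivAt.hasStrictFDerivAt_equiv (hd z hz)
    ⟨_, (hs.toOpenPartialHomeomorph f).open_source.mem_nhds
      hs.mem_toOpenPartialHomeomorph_source, (hs.toOpenPartialHomeomorph f).injOn⟩
  map_zero := h0
  deriv_im := him
  deriv_re := hre

end LocallyUnivalent

section PolySolOfIsStrongStar

theorem deriv_polyFun (g : ℝ → ℂ[X]) (t : ℝ) (z : ℂ) :
    deriv (polyFun g t) z = (derivative (g t)).eval z :=
  Polynomial.deriv _

theorem analyticOnNhd_polyFun (g : ℝ → ℂ[X]) (t : ℝ) (E : Set ℂ) :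
    AnalyticOnNhd ℂ (polyFun g t) E := fun z _ => (g t).differentiable.analyticAt z

theorem coeff_eq_sum_eval {s : Finset ℂ} {p : ℂ[X]} (hp : p.natDegree < s.card) (n : ℕ) :
    p.coeff n = ∑ x ∈ s, p.eval x * (Lagrange.basis s id x).coeff n := by
  conv_lhs => rw [Lagrange.eq_interpolate (f := p) (injOn_id _)
    (degree_le_natDegree.trans_lt (Nat.cast_lt.2 hp)), Lagrange.interpolate_apply, finsetSum_coeff]
  simp only [coeff_C_mul, id_eq]

theorem polySol_of_isStrongStar {k₀ : ℕ} {T : ℝ} {p : ℝ → ℂ[X]}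
    (hdeg : ∀ t ∈ Icc 0 T, (p t).natDegree ≤ k₀) (hp : IsStrongStar T (polyFun p)) :
    PolySol k₀ T p := by
  have hne : ∀ t ∈ Icc 0 T, ∀ z : ℂ, ‖z‖ ≤ 1 → (derivative (p t)).eval z ≠ 0 := fun t ht z hz => by
    rw [← deriv_polyFun]
    exact (hp.mem_omega t ht).deriv_ne_zero (mem_closedBall_zero_iff.2 hz)
  refine ⟨hdeg, fun t ht => ?_, fun t ht n => ?_⟩
  · rw [coeff_zero_eq_eval_zero]
    exact (hp.mem_omega t ht).map_zero
  obtain ⟨hvdeg, hv⟩ := velocity_spec (hne t ht)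
  obtain ⟨s, hsball, hscard⟩ := (infinite_of_mem_nhds (0 : ℂ)
    (ball_mem_nhds 0 one_pos)).exists_subset_card_eq (k₀ + 2)
  have hinterp : HasDerivWithinAt
      (fun t => ∑ x ∈ s, (p t).eval x * (Lagrange.basis s id x).coeff (n + 1))
      (∑ x ∈ s, (X * velocity (derivative (p t))).eval x *
        (Lagrange.basis s id x).coeff (n + 1)) (Icc 0 T) t := by
    refine HasDerivWithinAt.fun_sum fun x hx => ?_
    have heq := hp.equation t ht x (hsball hx)
    simp only [deriv_polyFun] at heq
    rw [← hv.eval_div_eq_poissonOp (hne t ht) (hsball hx), mul_assoc,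
      mul_div_cancel₀ _ (hne t ht x (mem_ball_zero_iff.1 (hsball hx)).le)] at heq
    rw [eval_mul, eval_X]
    exact heq.mul_const _
  have hvdeg' : (X * velocity (derivative (p t))).natDegree < s.card := by
    have := natDegree_X_mul_lt (v := velocity (derivative (p t))) (K := k₀ + 1) (by
      have := natDegree_derivative_le (p t)
      have := hdeg t ht
      omega)
    omega
  rw [← coeff_eq_sum_eval hvdeg', coeff_X_mul] at hinterp
  refine hinterp.congr_of_mem (fun t ht => coeff_eq_sum_eval ?_ _) ht
  have := hdeg t ht
  omega

end PolySolOfIsStrongStar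

/-! ### Regularity of polynomial solutions -/

section Regularity

theorem contDiffOn_one_of_hasDerivWithinAt {E : Type*} [NormedAddCommGroup E] [NormedSpace ℝ E]
    {F F' : ℝ → E} {s : Set ℝ} (hs : UniqueDiffOn ℝ s)
    (hF : ∀ t ∈ s, HasDerivWithinAt F (F' t) s t) (hF' : ContinuousOn F' s) :
    ContDiffOn ℝ 1 F s :=
  (contDiffOn_one_iff_derivWithin hs).2 ⟨fun t ht => (hF t ht).differentiableWithinAt,
    hF'.congr fun t ht => (hF t ht).derivWithin (hs t ht)⟩

theorem IsOmega.mono {E E' : Set ℂ} {f : ℂ → ℂ} (h : IsOmega E f) (hE : E' ⊆ E) : IsOmega E' f :=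
  ⟨fun z hz => h.analytic z (hE hz), fun z hz => h.locallyUnivalent z (hE hz), h.map_zero,
    h.deriv_im, h.deriv_re⟩

theorem isStrongStar_of_hasDerivWithinAt {r T : ℝ} {F F' : ℝ → C(closedBall (0 : ℂ) r, ℂ)}
    {f : ℝ → ℂ → ℂ} (hT : 0 < T) (hr : 1 ≤ r)
    (hF : ∀ t ∈ Icc 0 T, HasDerivWithinAt F (F' t) (Icc 0 T) t) (hF' : ContinuousOn F' (Icc 0 T))
    (hfF : ∀ t ∈ Icc 0 T, ∀ z, F t z = f t z)
    (hω : ∀ t ∈ Icc 0 T, IsOmega (closedBall 0 1) (f t))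
    (heq : ∀ t ∈ Icc 0 T, ∀ ξ : closedBall (0 : ℂ) r, (ξ : ℂ) ∈ ball 0 1 →
      F' t ξ = ξ * deriv (f t) ξ * poissonOp (fun z => 1 / ‖deriv (f t) z‖ ^ 2) ξ) :
    IsStrongStar T f := by
  have heval : ∀ t ∈ Icc 0 T, ∀ ξ : closedBall (0 : ℂ) r,
      HasDerivWithinAt (fun t => f t ξ) (F' t ξ) (Icc 0 T) t := fun t ht ξ =>
    ((((ContinuousMap.evalCLM ℂ ξ).restrictScalars ℝ).hasFDerivAt.comp_hasDerivWithinAt t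
      (hF t ht))).congr_of_mem (fun s hs => (hfF s hs ξ).symm) ht
  refine ⟨hω, fun ξ hξ => ?_, fun t ht ξ hξ => ?_⟩
  · lift ξ to closedBall (0 : ℂ) r using closedBall_subset_closedBall hr hξ
    exact contDiffOn_one_of_hasDerivWithinAt (uniqueDiffOn_Icc hT)
      (fun t ht => heval t ht ξ) ((continuous_eval_const ξ).comp_continuousOn hF')
  · lift ξ to closedBall (0 : ℂ) r using
      closedBall_subset_closedBall hr (ball_subset_closedBall hξ)
    rw [← heq t ht ξ hξ]
    exact heval t ht ξ

/-- A polynomial as a continuous function on a closed disk. -/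
def polyCM (R : ℝ) (q : ℂ[X]) : C(closedBall (0 : ℂ) R, ℂ) := q.toContinuousMapOn _

theorem polyCM_apply (R : ℝ) (q : ℂ[X]) (z : closedBall (0 : ℂ) R) :
    polyCM R q z = q.eval (z : ℂ) := rfl

theorem polyCM_sub (R : ℝ) (p q : ℂ[X]) : polyCM R (p - q) = polyCM R p - polyCM R q := by
  ext z
  exact Polynomial.eval_sub ..

theorem norm_polyCM_le {R : ℝ} (hR : 0 ≤ R) (q : ℂ[X]) : ‖polyCM R q‖ ≤ wnorm R q :=
  (ContinuousMap.norm_le _ (wnorm_nonneg hR q)).2 fun z =>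
    norm_eval_le_wnorm q (mem_closedBall_zero_iff.1 z.2)

variable {K : ℕ} {T r μ M : ℝ} {g : ℝ → ℂ[X]} {t : ℝ}

theorem polyCM_eq_sum {q : ℂ[X]} (hq : q.natDegree < K) (R : ℝ) :
    polyCM R q = ∑ n ∈ Finset.range K, q.coeff n • polyCM R (X ^ n) := by
  ext z
  simp [polyCM_apply, eval_eq_sum_range' hq]

theorem continuousOn_polyCM {q : ℝ → ℂ[X]} {s : Set ℝ} (hq : ∀ t ∈ s, (q t).natDegree < K)
    (hc : ∀ n, ContinuousOn (fun t => (q t).coeff n) s) (R : ℝ) :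
    ContinuousOn (fun t => polyCM R (q t)) s :=
  (continuousOn_finsetSum _ fun n _ => (hc n).smul continuousOn_const).congr
    fun t ht => polyCM_eq_sum (hq t ht) R

theorem hasDerivWithinAt_polyCM {q : ℝ → ℂ[X]} {q' : ℂ[X]} {s : Set ℝ}
    (hq : ∀ t ∈ s, (q t).natDegree < K) (hq' : q'.natDegree < K) (ht : t ∈ s)
    (hd : ∀ n, HasDerivWithinAt (fun t => (q t).coeff n) (q'.coeff n) s t) (R : ℝ) :
    HasDerivWithinAt (fun t => polyCM R (q t)) (polyCM R q') s t := by
  rw [polyCM_eq_sum hq']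
  exact (HasDerivWithinAt.fun_sum fun n _ => (hd n).smul_const _).congr_of_mem
    (fun t ht => polyCM_eq_sum (hq t ht) R) ht

/-- The time derivative of a polynomial solution `g`. -/
def rate (g : ℝ → ℂ[X]) (t : ℝ) : ℂ[X] := X * velocity (derivative (g t))

theorem deriv_polyFun_zero (g : ℝ → ℂ[X]) (t : ℝ) : deriv (polyFun g t) 0 = (g t).coeff 1 := by
  rw [deriv_polyFun, ← coeff_zero_eq_eval_zero, coeff_derivative]
  simp

theorem Pinched.rate_eval (hr : 1 < r) (hμ : 0 < μ) (hp : Pinched r μ M (derivative (g t)))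
    {ξ : ℂ} (hξ : ξ ∈ ball 0 1) :
    (rate g t).eval ξ = ξ * deriv (polyFun g t) ξ *
      poissonOp (fun z => 1 / ‖deriv (polyFun g t) z‖ ^ 2) ξ := by
  simp only [deriv_polyFun]
  have hne : ∀ z : ℂ, ‖z‖ ≤ 1 → (derivative (g t)).eval z ≠ 0 :=
    fun z hz => hp.ne_zero hμ (hz.trans hr.le)
  rw [← (hp.velocity_spec hr hμ).2.eval_div_eq_poissonOp hne hξ, mul_assoc,
    mul_div_cancel₀ _ (hne ξ (mem_ball_zero_iff.1 hξ).le), rate, eval_mul, eval_X]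

namespace PinchedSol

theorem natDegree_velocity_lt (hr : 1 < r) (hμ : 0 < μ) (hg : PinchedSol r μ M K T g)
    (ht : t ∈ Icc 0 T) : (velocity (derivative (g t))).natDegree < K :=
  ((hg.pinched t ht).velocity_spec hr hμ).1.trans_lt
    ((hg.pinched t ht).natDegree_derivative_lt (by linarith) hμ (hg.natDegree_le t ht))

theorem hasDerivWithinAt_polyCM (hr : 1 < r) (hμ : 0 < μ) (hg : PinchedSol r μ M K T g) (R : ℝ)
    (ht : t ∈ Icc 0 T) :
    HasDerivWithinAt (fun t => polyCM R (g t)) (polyCM R (rate g t)) (Icc 0 T) t := by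
  refine HeleShaw.hasDerivWithinAt_polyCM (fun s hs => Nat.lt_succ_of_le (hg.natDegree_le s hs))
    (natDegree_X_mul_lt (hg.natDegree_velocity_lt hr hμ ht)) ht (fun n => ?_) R
  cases n with
  | zero =>
    simp only [coeff_X_mul_zero]
    exact (hasDerivWithinAt_const t _ 0).congr_of_mem (fun s hs => hg.coeff_zero s hs) ht
  | succ n =>
    simp only [coeff_X_mul]
    exact hg.hasDeriv t ht n

theorem continuousOn_coeff_velocity (hr : 1 < r) (hμ : 0 < μ) (hg : PinchedSol r μ M K T g)
    (n : ℕ) : ContinuousOn (fun t => (velocity (derivative (g t))).coeff n) (Icc 0 T) := by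
  rcases (Icc (0 : ℝ) T).eq_empty_or_nonempty with hT | ⟨t₀, ht₀⟩
  · simp only [hT, continuousOn_empty]
  have hM : 0 ≤ M := (hg.pinched t₀ ht₀).nonneg (by linarith)
  rcases lt_or_ge n K with hn | hn
  · obtain ⟨L, hL⟩ := exists_lipschitzOnWith_velocityField (K := K) hr hμ hM
    have hpoly : ∀ t ∈ Icc 0 T, toPoly K (fun i => (g t).coeff (i + 1)) = g t := fun t ht =>
      toPoly_coeff_succ (hg.natDegree_le t ht) (hg.coeff_zero t ht)
    have hcoeff : ContinuousOn (fun t => fun i : Fin K => (g t).coeff (i + 1)) (Icc 0 T) :=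
      continuousOn_pi.2 fun i => hg.toPolySol.continuousOn_coeff _
    have hfield := hL.continuousOn.comp hcoeff fun t ht => by
      rw [mem_ofPred_eq, hpoly t ht]
      exact hg.pinched t ht
    refine ((continuous_apply (⟨n, hn⟩ : Fin K)).comp_continuousOn hfield).congr fun t ht => ?_
    simp only [Function.comp_apply, velocityField, hpoly t ht]
  · exact (continuousOn_const (c := (0 : ℂ))).congr fun t ht =>
      coeff_eq_zero_of_natDegree_lt ((hg.natDegree_velocity_lt hr hμ ht).trans_le hn)

theorem continuousOn_polyCM_rate (hr : 1 < r) (hμ : 0 < μ) (hg : PinchedSol r μ M K T g) (R : ℝ) :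
    ContinuousOn (fun t => polyCM R (rate g t)) (Icc 0 T) := by
  refine continuousOn_polyCM
    (fun t ht => natDegree_X_mul_lt (hg.natDegree_velocity_lt hr hμ ht)) (fun n => ?_) R
  cases n with
  | zero => simp only [coeff_X_mul_zero, continuousOn_const]
  | succ n => simpa only [coeff_X_mul] using hg.continuousOn_coeff_velocity hr hμ n

theorem isC1Curve (hT : 0 < T) (hr : 1 < r) (hμ : 0 < μ) (hg : PinchedSol r μ M K T g) (R : ℝ) :
    IsC1Curve R T (polyFun g) :=
  ⟨fun t => polyCM R (g t), fun _ _ _ => rfl, contDiffOn_one_of_hasDerivWithinAt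
    (uniqueDiffOn_Icc hT) (fun _ ht => hg.hasDerivWithinAt_polyCM hr hμ R ht)
    (hg.continuousOn_polyCM_rate hr hμ R)⟩

theorem isC1Closed (hT : 0 < T) (hr : 1 < r) (hμ : 0 < μ) (hg : PinchedSol r μ M K T g) :
    IsC1Closed r T (polyFun g) :=
  ⟨r + 1, lt_add_one r, fun t _ => analyticOnNhd_polyFun g t _, hg.isC1Curve hT hr hμ (r + 1)⟩

theorem isOmega (hμ : 0 < μ) (hg : PinchedSol r μ M K T g) (ht : t ∈ Icc 0 T)
    (him : ((g t).coeff 1).im = 0) (hre : 0 < ((g t).coeff 1).re) :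
    IsOmega (closedBall 0 r) (polyFun g t) := by
  refine isOmega_of_deriv_ne_zero (analyticOnNhd_polyFun g t _) (fun z hz => ?_) ?_ ?_ ?_
  · rw [deriv_polyFun]
    exact (hg.pinched t ht).ne_zero hμ (mem_closedBall_zero_iff.1 hz)
  · rw [polyFun, ← coeff_zero_eq_eval_zero]
    exact hg.coeff_zero t ht
  · rwa [deriv_polyFun_zero]
  · rwa [deriv_polyFun_zero]

theorem isStrongStar (hT : 0 < T) (hr : 1 < r) (hμ : 0 < μ) (hg : PinchedSol r μ M K T g)
    (hω : ∀ t ∈ Icc 0 T, IsOmega (closedBall 0 r) (polyFun g t)) :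
    IsStrongStar T (polyFun g) :=
  isStrongStar_of_hasDerivWithinAt hT hr.le (fun _ ht => hg.hasDerivWithinAt_polyCM hr hμ r ht)
    (hg.continuousOn_polyCM_rate hr hμ r) (fun _ _ _ => rfl)
    (fun t ht => (hω t ht).mono (closedBall_subset_closedBall hr.le))
    fun t ht _ hξ => (hg.pinched t ht).rate_eval hr hμ hξ

theorem im_coeff_one (hr : 1 < r) (hμ : 0 < μ) (hg : PinchedSol r μ M K T g)
    (h0 : ((g 0).coeff 1).im = 0) : ∀ t ∈ Icc 0 T, ((g t).coeff 1).im = 0 := by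
  -- The first coefficient `a` satisfies `a' = φ(0) a` with `φ(0)` real.
  have hderiv : ∀ t ∈ Icc 0 T, HasDerivWithinAt (fun t => ((g t).coeff 1).im)
      ((velocity (derivative (g t))).coeff 0).im (Icc 0 T) t := fun t ht =>
    Complex.imCLM.hasFDerivAt.comp_hasDerivWithinAt t (hg.hasDeriv t ht 0)
  refine eq_zero_of_abs_deriv_le_mul_abs_self_of_eq_zero_right (K := phiBound r μ)
    (fun t ht => (hderiv t ht).continuousWithinAt)
    (fun t ht => (hderiv t (Ico_subset_Icc_self ht)).mono_of_mem_nhdsWithin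
      (Icc_mem_nhdsGE_of_mem ht)) h0 fun t ht => ?_
  have hpin := hg.pinched t (Ico_subset_Icc_self ht)
  have hv := (hpin.velocity_spec hr hμ).2
  have hr0 : ‖(0 : ℂ)‖ ≤ r := by
    rw [norm_zero]
    linarith
  set φ := (velocity (derivative (g t))).eval 0 / (derivative (g t)).eval 0
  have hφ : (velocity (derivative (g t))).coeff 0 = φ * (g t).coeff 1 := by
    rw [← deriv_polyFun_zero, deriv_polyFun, coeff_zero_eq_eval_zero,
      div_mul_cancel₀ _ (hpin.ne_zero hμ hr0)]
  have him : φ.im = 0 := hv.im_eq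
  rw [hφ, Complex.mul_im, him, zero_mul, add_zero, norm_mul]
  gcongr
  exact (Complex.abs_re_le_norm φ).trans (hv.norm_eval_div_le hr hμ hpin.le_norm_eval hr0)

end PinchedSol

namespace PolySol

theorem continuousOn_norm_deriv (hg : PolySol K T g) (S : Set ℂ) :
    ContinuousOn (fun q : ℂ × ℝ => ‖deriv (polyFun g q.2) q.1‖) (S ×ˢ Icc 0 T) := by
  have hsum : ContinuousOn (fun q : ℂ × ℝ => ∑ n ∈ Finset.range (K + 1),
      (derivative (g q.2)).coeff n * q.1 ^ n) (S ×ˢ Icc 0 T) := by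
    refine continuousOn_finsetSum _ fun n _ => ContinuousOn.mul ?_ (by fun_prop)
    simp only [coeff_derivative]
    exact ((hg.continuousOn_coeff (n + 1)).comp continuousOn_snd fun q hq => hq.2).mul
      continuousOn_const
  refine (hsum.congr fun q hq => ?_).norm
  rw [deriv_polyFun, eval_eq_sum_range']
  have := natDegree_derivative_le (g q.2)
  have := hg.natDegree_le _ hq.2
  omega

theorem exists_pinchedSol_minDeriv (hT : 0 ≤ T) (hr : 0 ≤ r) (hg : PolySol K T g)
    (hω : ∀ t ∈ Icc 0 T, IsOmega (closedBall 0 r) (polyFun g t)) :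
    0 < minDeriv r T (polyFun g) ∧ ∃ M, PinchedSol r (minDeriv r T (polyFun g)) M K T g := by
  have hcompact : IsCompact (closedBall (0 : ℂ) r ×ˢ Icc 0 T) :=
    (isCompact_closedBall 0 r).prod isCompact_Icc
  have hne : (closedBall (0 : ℂ) r ×ˢ Icc 0 T).Nonempty :=
    ⟨(0, 0), mem_closedBall_self hr, left_mem_Icc.2 hT⟩
  have hcont := hg.continuousOn_norm_deriv (closedBall 0 r)
  obtain ⟨q, hq, hmin⟩ := hcompact.exists_sInf_image_eq hne hcont
  obtain ⟨M, hM⟩ := hcompact.bddAbove_image hcont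
  have hbelow := hcompact.bddBelow_image hcont
  refine ⟨?_, M, hg, fun t ht => ⟨fun z hz => ?_, fun z hz => ?_⟩⟩
  · rw [minDeriv, hmin]
    exact norm_pos_iff.2 ((hω _ hq.2).deriv_ne_zero hq.1)
  · rw [← deriv_polyFun]
    exact csInf_le hbelow ⟨(z, t), ⟨mem_closedBall_zero_iff.2 hz, ht⟩, rfl⟩
  · rw [← deriv_polyFun]
    exact hM ⟨(z, t), ⟨mem_closedBall_zero_iff.2 hz, ht⟩, rfl⟩

end PolySol

end Regularity

/-! ### Limits of polynomial solutions -/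

section Limits

theorem tendsto_tsum_tail (u : ℕ → ℝ) : Tendsto (fun k => ∑' i, u (k + i)) atTop (𝓝 0) := by
  simpa only [add_comm] using tendsto_sum_nat_add u

theorem exists_tendstoUniformlyOn_of_norm_sub_le {α E : Type*} [NormedAddCommGroup E]
    [CompleteSpace E] {H : ℕ → α → E} {s : Set α} {u : ℕ → ℝ} (hu : Summable u)
    (hHu : ∀ k, ∀ x ∈ s, ‖H (k + 1) x - H k x‖ ≤ u k) :
    ∃ H' : α → E, TendstoUniformlyOn H H' atTop s := by
  have hdist : ∀ x ∈ s, ∀ k, dist (H k x) (H (k + 1) x) ≤ u k := fun x hx k => by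
    rw [dist_comm, dist_eq_norm]
    exact hHu k x hx
  have hlim : ∀ x, ∃ y, x ∈ s → Tendsto (fun k => H k x) atTop (𝓝 y) := fun x => by
    by_cases hx : x ∈ s
    · obtain ⟨y, hy⟩ := cauchySeq_tendsto_of_complete
        (cauchySeq_of_dist_le_of_summable u (hdist x hx) hu)
      exact ⟨y, fun _ => hy⟩
    · exact ⟨0, fun h => absurd h hx⟩
  choose H' hH' using hlim
  refine ⟨H', Metric.tendstoUniformlyOn_iff.2 fun ε hε => ?_⟩
  filter_upwards [(tendsto_tsum_tail u).eventually (gt_mem_nhds hε)] with k hk x hx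
  rw [dist_comm]
  exact (dist_le_tsum_of_dist_le_of_tendsto u (hdist x hx) hu (hH' x hx) k).trans_lt hk

theorem exists_hasDerivWithinAt_of_tendstoUniformlyOn {E : Type*} [NormedAddCommGroup E]
    [NormedSpace ℝ E] [CompleteSpace E] {G H : ℕ → ℝ → E} {F' : ℝ → E} {T : ℝ} (hT : 0 ≤ T) {a : E}
    (hG : ∀ k, ∀ t ∈ Icc 0 T, HasDerivWithinAt (G k) (H k t) (Icc 0 T) t)
    (hF' : ContinuousOn F' (Icc 0 T)) (hH : TendstoUniformlyOn H F' atTop (Icc 0 T))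
    (h0 : Tendsto (fun k => G k 0) atTop (𝓝 a)) :
    ∃ F : ℝ → E, (∀ t ∈ Icc 0 T, HasDerivWithinAt F (F' t) (Icc 0 T) t) ∧
      ∀ t ∈ Icc 0 T, Tendsto (fun k => G k t) atTop (𝓝 (F t)) := by
  set F : ℝ → E := fun t => a + ∫ τ in (0 : ℝ)..t, F' τ with hF
  have hFd : ∀ t ∈ Icc 0 T, HasDerivWithinAt F (F' t) (Icc 0 T) t := fun t ht =>
    ODE.hasDerivWithinAt_picard_Icc (f := fun τ (_ : E) => F' τ) (α := fun _ => (0 : E))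
      (u := univ) (left_mem_Icc.2 hT) (hF'.comp continuousOn_fst fun q hq => hq.1)
      continuousOn_const (fun _ _ => mem_univ _) a ht
  refine ⟨F, hFd, fun t ht => ?_⟩
  have hincr : Tendsto (fun k => (G k t - F t) - (G k 0 - F 0)) atTop (𝓝 0) := by
    refine Metric.tendsto_nhds.2 fun ε hε => ?_
    filter_upwards [Metric.tendstoUniformlyOn_iff.1 hH (ε / (T + 1)) (by positivity)] with k hk
    have hmv := Convex.norm_image_sub_le_of_norm_hasDerivWithin_le (f := fun t => G k t - F t)
      (fun s hs => (hG k s hs).fun_sub (hFd s hs))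
      (fun s hs => by rw [← dist_eq_norm, dist_comm]; exact (hk s hs).le)
      (convex_Icc 0 T) (left_mem_Icc.2 hT) ht
    rw [dist_zero_right]
    calc _ ≤ ε / (T + 1) * ‖t - 0‖ := hmv
      _ < ε / (T + 1) * (T + 1) := by
        gcongr
        rw [sub_zero, Real.norm_of_nonneg ht.1]
        linarith [ht.2]
      _ = ε := by field_simp
  simpa [hF] using (hincr.add (h0.sub_const (F 0))).add_const (F t)

theorem tendsto_poissonOp {h : ℕ → ℂ → ℝ} {h' : ℂ → ℝ} {B : ℝ} {ξ : ℂ}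
    (hc : ∀ k, ContinuousOn (h k) (sphere 0 1)) (hB : ∀ k, ∀ z ∈ sphere 0 1, |h k z| ≤ B)
    (hlim : ∀ z ∈ sphere 0 1, Tendsto (fun k => h k z) atTop (𝓝 (h' z))) (hξ : ξ ∈ ball 0 1) :
    Tendsto (fun k => poissonOp (h k) ξ) atTop (𝓝 (poissonOp h' ξ)) := by
  have hcirc : ∀ θ, circleMap (0 : ℂ) 1 θ ∈ sphere (0 : ℂ) 1 := circleMap_mem_sphere 0 zero_le_one
  have hK : Continuous fun θ => herglotzRieszKernel 0 ξ (circleMap 0 1 θ) := by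
    have hKs : ContinuousOn (herglotzRieszKernel 0 ξ) (sphere 0 1) := by
      simpa only [abs_one] using continuousOn_herglotzRieszKernel_sphere hξ
    exact hKs.comp_continuous (continuous_circleMap 0 1) hcirc
  simp only [poissonOp_eq_circleAverage, Real.circleAverage_def]
  refine (intervalIntegral.tendsto_integral_filter_of_dominated_convergence
    (fun θ => ‖herglotzRieszKernel 0 ξ (circleMap 0 1 θ)‖ * B) (.of_forall fun k => ?_)
    (.of_forall fun k => .of_forall fun θ _ => ?_) ((hK.norm.mul_const B).intervalIntegrable _ _)
    (.of_forall fun θ _ => ?_)).const_smul _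
  · have := (hc k).comp_continuous (continuous_circleMap 0 1) hcirc
    exact (hK.mul (Complex.continuous_ofReal.comp this)).aestronglyMeasurable
  · rw [norm_mul, Complex.norm_real]
    exact mul_le_mul_of_nonneg_left (hB k _ (hcirc θ)) (norm_nonneg _)
  · exact ((Complex.continuous_ofReal.tendsto _).comp (hlim _ (hcirc θ))).const_mul _

end Limits

section Coefficients

theorem iteratedDeriv_eval (p : ℂ[X]) (j : ℕ) :
    iteratedDeriv j (fun z => p.eval z) = fun z => (derivative^[j] p).eval z := by
  induction j with
  | zero => rfl
  | succ j ih =>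
    rw [iteratedDeriv_succ, ih, Function.iterate_succ_apply']
    exact funext fun z => Polynomial.deriv _

theorem coeffAt_eval (p : ℂ[X]) (i : ℕ) : coeffAt (fun z => p.eval z) i = p.coeff i := by
  simp only [coeffAt, iteratedDeriv_eval]
  rw [div_eq_iff (Nat.cast_ne_zero.2 i.factorial_ne_zero), ← coeff_zero_eq_eval_zero,
    coeff_iterate_derivative, zero_add, Nat.descFactorial_self, nsmul_eq_mul, mul_comm]

theorem coeffAt_neg (φ : ℂ → ℂ) (i : ℕ) : coeffAt (fun z => -φ z) i = -coeffAt φ i := by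
  rw [coeffAt, coeffAt, iteratedDeriv_fun_neg, neg_div]

theorem mNorm_neg (r : ℝ) (φ : ℂ → ℂ) : mNorm r (fun z => -φ z) = mNorm r φ := by
  simp only [mNorm, coeffAt_neg, norm_neg]

theorem mNorm_sub_comm (r : ℝ) (φ ψ : ℂ → ℂ) :
    mNorm r (fun z => φ z - ψ z) = mNorm r (fun z => ψ z - φ z) := by
  rw [← mNorm_neg]
  simp only [neg_sub]

theorem mNorm_eval {r : ℝ} (hr : 0 ≤ r) (p : ℂ[X]) :
    mNorm r (fun z => p.eval z) = ENNReal.ofReal (wnorm r p) := by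
  rw [mNorm, wnorm_eq_sum (Nat.lt_succ_self _),
    ENNReal.ofReal_sum_of_nonneg fun n _ => by positivity]
  simp only [coeffAt_eval]
  refine tsum_eq_sum fun n hn => ?_
  rw [coeff_eq_zero_of_natDegree_lt (by simpa using hn), norm_zero, zero_mul, ENNReal.ofReal_zero]

theorem mNorm_le_of_tendsto {r : ℝ} {φ : ℕ → ℂ → ℂ} {ψ : ℂ → ℂ} {B : ENNReal}
    (h : ∀ i, Tendsto (fun k => coeffAt (φ k) i) atTop (𝓝 (coeffAt ψ i)))
    (hB : ∀ᶠ k in atTop, mNorm r (φ k) ≤ B) : mNorm r ψ ≤ B := by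
  rw [mNorm, ENNReal.tsum_eq_iSup_sum]
  refine iSup_le fun s => ?_
  have hsum : Tendsto (fun k => ∑ i ∈ s, ENNReal.ofReal (‖coeffAt (φ k) i‖ * r ^ i)) atTop
      (𝓝 (∑ i ∈ s, ENNReal.ofReal (‖coeffAt ψ i‖ * r ^ i))) :=
    tendsto_finsetSum _ fun i _ => ENNReal.tendsto_ofReal ((h i).norm.mul_const _)
  exact le_of_tendsto hsum (hB.mono fun k hk => (ENNReal.sum_le_tsum s).trans hk)

theorem tendstoLocallyUniformlyOn_iteratedDeriv {φ : ℕ → ℂ → ℂ} {ψ : ℂ → ℂ} {U : Set ℂ}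
    (hU : IsOpen U) (h : TendstoLocallyUniformlyOn φ ψ atTop U)
    (hφ : ∀ k, DifferentiableOn ℂ (φ k) U) (j : ℕ) :
    TendstoLocallyUniformlyOn (fun k => iteratedDeriv j (φ k)) (iteratedDeriv j ψ) atTop U := by
  induction j with
  | zero => simpa only [iteratedDeriv_zero] using h
  | succ j ih =>
    simp only [iteratedDeriv_succ]
    refine ih.deriv (.of_forall fun k => ?_) hU
    simp only [iteratedDeriv_eq_iterate]
    exact (((hφ k).analyticOnNhd hU).iterated_deriv j).differentiableOn

theorem tendsto_coeffAt {φ : ℕ → ℂ → ℂ} {ψ : ℂ → ℂ} {U : Set ℂ} (hU : IsOpen U) (h0 : 0 ∈ U)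
    (h : TendstoLocallyUniformlyOn φ ψ atTop U) (hφ : ∀ k, DifferentiableOn ℂ (φ k) U) (i : ℕ) :
    Tendsto (fun k => coeffAt (φ k) i) atTop (𝓝 (coeffAt ψ i)) :=
  ((tendstoLocallyUniformlyOn_iteratedDeriv hU h hφ i).tendsto_at h0).div_const _

theorem hasSum_coeffAt {v : ℂ → ℂ} {ρ : ℝ} (hv : DifferentiableOn ℂ v (ball 0 ρ)) {z : ℂ}
    (hz : z ∈ ball 0 ρ) : HasSum (fun i => coeffAt v i * z ^ i) (v z) := by
  refine (Complex.hasSum_taylorSeries_on_ball hv hz).congr_fun fun i => ?_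
  simp only [coeffAt, smul_eq_mul, sub_zero]
  ring

theorem wnorm_sub_le_sum_Ico {r : ℝ} (hr : 0 ≤ r) {q : ℕ → ℂ[X]} {e : ℕ → ℝ}
    (h : ∀ k, wnorm r (q (k + 1) - q k) ≤ e k) {k n : ℕ} (hkn : k ≤ n) :
    wnorm r (q n - q k) ≤ ∑ i ∈ Finset.Ico k n, e i := by
  induction n, hkn using Nat.le_induction with
  | base => simp [wnorm_zero]
  | succ n hn ih =>
    rw [Finset.sum_Ico_succ_top hn]
    linarith [wnorm_sub_le hr (q (n + 1)) (q n) (q k), h n]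

theorem wnorm_sub_le_tsum {r : ℝ} (hr : 0 ≤ r) {q : ℕ → ℂ[X]} {e : ℕ → ℝ} (he : Summable e)
    (h : ∀ k, wnorm r (q (k + 1) - q k) ≤ e k) {k n : ℕ} (hkn : k ≤ n) :
    wnorm r (q n - q k) ≤ ∑' i, e (k + i) := by
  refine (wnorm_sub_le_sum_Ico hr h hkn).trans ?_
  rw [Finset.sum_Ico_eq_sum_range]
  exact (he.comp_injective (add_right_injective k)).sum_le_tsum _
    fun i _ => (wnorm_nonneg hr _).trans (h _)

end Coefficients

section PolynomialLimits

variable {r μ M : ℝ} {q : ℕ → ℂ[X]} {f : ℂ → ℂ} {z : ℂ}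

theorem tendstoLocallyUniformlyOn_iteratedDeriv_eval
    (hq : TendstoLocallyUniformlyOn (fun k z => (q k).eval z) f atTop (ball 0 r)) (j : ℕ) :
    TendstoLocallyUniformlyOn (fun k z => (derivative^[j] (q k)).eval z) (iteratedDeriv j f) atTop
      (ball 0 r) := by
  simpa only [iteratedDeriv_eval] using
    tendstoLocallyUniformlyOn_iteratedDeriv isOpen_ball hq (fun k => (q k).differentiableOn) j

theorem tendsto_eval_derivative
    (hq : TendstoLocallyUniformlyOn (fun k z => (q k).eval z) f atTop (ball 0 r))
    (hz : z ∈ ball 0 r) :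
    Tendsto (fun k => (derivative (q k)).eval z) atTop (𝓝 (deriv f z)) := by
  simpa only [iteratedDeriv_one, Function.iterate_one] using
    (tendstoLocallyUniformlyOn_iteratedDeriv_eval hq 1).tendsto_at hz

theorem mNorm_iteratedDeriv_sub_le {e : ℕ → ℝ} (hr : 0 < r)
    (hq : TendstoLocallyUniformlyOn (fun k z => (q k).eval z) f atTop (ball 0 r)) (j : ℕ)
    (he : Summable e) (h : ∀ k, wnorm r (derivative^[j] (q (k + 1) - q k)) ≤ e k) (k : ℕ) :
    mNorm r (fun z => iteratedDeriv j f z - (derivative^[j] (q k)).eval z) ≤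
      ENNReal.ofReal (∑' i, e (k + i)) := by
  set d : ℕ → ℂ[X] := fun n => derivative^[j] (q n)
  have hlim : TendstoLocallyUniformlyOn (fun n z => (d n - d k).eval z)
      (fun z => iteratedDeriv j f z - (d k).eval z) atTop (ball 0 r) := by
    have := tendstoLocallyUniformlyOn_iteratedDeriv_eval hq j
    rw [Metric.tendstoLocallyUniformlyOn_iff] at this ⊢
    simpa only [eval_sub, dist_sub_right] using this
  refine mNorm_le_of_tendsto (tendsto_coeffAt isOpen_ball (mem_ball_self hr) hlim
    fun n => (d n - d k).differentiableOn) ?_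
  filter_upwards [eventually_ge_atTop k] with n hn
  rw [mNorm_eval hr.le]
  refine ENNReal.ofReal_le_ofReal (wnorm_sub_le_tsum hr.le he (fun i => ?_) hn)
  rw [← iterate_derivative_sub]
  exact h i

theorem norm_deriv_mem_Icc_of_tendsto (hpin : ∀ k, Pinched r μ M (derivative (q k)))
    (hq : TendstoLocallyUniformlyOn (fun k z => (q k).eval z) f atTop (ball 0 r))
    (hz : z ∈ ball 0 r) : ‖deriv f z‖ ∈ Icc μ M :=
  have hz' : ‖z‖ ≤ r := (mem_ball_zero_iff.1 hz).le
  isClosed_Icc.mem_of_tendsto (tendsto_eval_derivative hq hz).norm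
    (.of_forall fun k => ⟨(hpin k).le_norm_eval z hz', (hpin k).norm_eval_le z hz'⟩)

theorem isOmega_ball_of_tendsto (hr : 0 < r) (hμ : 0 < μ)
    (hpin : ∀ k, Pinched r μ M (derivative (q k)))
    (hq : TendstoLocallyUniformlyOn (fun k z => (q k).eval z) f atTop (ball 0 r))
    (hω : ∀ k, IsOmega (closedBall 0 r) fun z => (q k).eval z) : IsOmega (ball 0 r) f := by
  have h0 : (0 : ℂ) ∈ ball 0 r := mem_ball_self hr
  have hd0 : ∀ z ∈ ball 0 r, deriv f z ≠ 0 := fun z hz =>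
    norm_pos_iff.1 (hμ.trans_le (norm_deriv_mem_Icc_of_tendsto hpin hq hz).1)
  have hderiv := tendsto_eval_derivative hq h0
  simp only [← Polynomial.deriv] at hderiv
  have him : (deriv f 0).im = 0 :=
    tendsto_nhds_unique ((Complex.continuous_im.tendsto _).comp hderiv)
      (tendsto_const_nhds.congr fun k => (hω k).deriv_im.symm)
  have hre : 0 ≤ (deriv f 0).re :=
    ge_of_tendsto' ((Complex.continuous_re.tendsto _).comp hderiv) fun k => (hω k).deriv_re.le
  refine isOmega_of_deriv_ne_zero ?_ hd0 ?_ him (hre.lt_of_ne' fun h => hd0 0 h0 ?_)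
  · exact (hq.differentiableOn (.of_forall fun k => (q k).differentiableOn)
      isOpen_ball).analyticOnNhd isOpen_ball
  · exact tendsto_nhds_unique (hq.tendsto_at h0)
      (tendsto_const_nhds.congr fun k => (hω k).map_zero.symm)
  · exact Complex.ext h him

theorem tendsto_poissonOp_of_pinched (hr : 1 < r) (hμ : 0 < μ)
    (hpin : ∀ k, Pinched r μ M (derivative (q k)))
    (hq : TendstoLocallyUniformlyOn (fun k z => (q k).eval z) f atTop (ball 0 r))
    (hz : z ∈ ball 0 1) :
    Tendsto (fun k => poissonOp (fun z => 1 / ‖(derivative (q k)).eval z‖ ^ 2) z) atTop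
      (𝓝 (poissonOp (fun z => 1 / ‖deriv f z‖ ^ 2) z)) := by
  have hnorm : ∀ w ∈ sphere (0 : ℂ) 1, ‖w‖ ≤ r := fun w hw =>
    (mem_sphere_zero_iff_norm.1 hw).trans_le hr.le
  refine tendsto_poissonOp (B := 1 / μ ^ 2) (fun k => ?_) (fun k w hw => ?_) (fun w hw => ?_) hz
  · refine continuousOn_const.div (by fun_prop) fun w hw => ?_
    exact pow_ne_zero 2 (norm_ne_zero_iff.2 ((hpin k).ne_zero hμ (hnorm w hw)))
  · rw [abs_of_nonneg (by positivity)]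
    have := (hpin k).le_norm_eval w (hnorm w hw)
    gcongr
  · have hw' : w ∈ ball 0 r :=
      mem_ball_zero_iff.2 ((mem_sphere_zero_iff_norm.1 hw).trans_lt hr)
    have hpos := hμ.trans_le (norm_deriv_mem_Icc_of_tendsto hpin hq hw').1
    exact tendsto_const_nhds.div ((tendsto_eval_derivative hq hw').norm.pow 2) (by positivity)

end PolynomialLimits

section LimitSolution

/-- The extension by zero of a function on a closed disk, as `IsStrongStar` and `IsC1Open` are
about functions on `ℂ`. -/
def extendZero (r : ℝ) (F : C(closedBall (0 : ℂ) r, ℂ)) (z : ℂ) : ℂ :=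
  open Classical in if h : z ∈ closedBall (0 : ℂ) r then F ⟨z, h⟩ else 0

theorem extendZero_coe {r : ℝ} (F : C(closedBall (0 : ℂ) r, ℂ)) (z : closedBall (0 : ℂ) r) :
    extendZero r F z = F z := dif_pos z.2

theorem tendstoUniformlyOn_extendZero {r : ℝ} {q : ℕ → ℂ[X]} {F : C(closedBall (0 : ℂ) r, ℂ)}
    (h : Tendsto (fun k => polyCM r (q k)) atTop (𝓝 F)) :
    TendstoUniformlyOn (fun k z => (q k).eval z) (extendZero r F) atTop (closedBall 0 r) := by
  rw [Metric.tendstoUniformlyOn_iff]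
  intro ε hε
  filter_upwards [Metric.tendsto_nhds.1 h ε hε] with k hk z hz
  rw [extendZero_coe F ⟨z, hz⟩, dist_comm]
  exact (ContinuousMap.dist_apply_le_dist (f := polyCM r (q k)) (g := F) ⟨z, hz⟩).trans_lt hk

variable {K : ℕ → ℕ} {T r μ M : ℝ} {g : ℕ → ℝ → ℂ[X]} {u v : ℕ → ℝ}

theorem exists_hasDerivWithinAt_tendsto_polyCM (hT : 0 ≤ T) (hr : 1 < r) (hμ : 0 < μ)
    (hg : ∀ k, PinchedSol r μ M (K k) T (g k)) (hu : Summable u)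
    (hgu : ∀ k, wnorm r (g (k + 1) 0 - g k 0) ≤ u k) (hv : Summable v)
    (hgv : ∀ k, ∀ t ∈ Icc 0 T, wnorm r (rate (g (k + 1)) t - rate (g k) t) ≤ v k) :
    ∃ F F' : ℝ → C(closedBall (0 : ℂ) r, ℂ), ContinuousOn F' (Icc 0 T) ∧
      ∀ t ∈ Icc 0 T, HasDerivWithinAt F (F' t) (Icc 0 T) t ∧
        Tendsto (fun k => polyCM r (g k t)) atTop (𝓝 (F t)) ∧
        Tendsto (fun k => polyCM r (rate (g k) t)) atTop (𝓝 (F' t)) := by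
  have hr0 : 0 ≤ r := by linarith
  obtain ⟨F', hF'⟩ := exists_tendstoUniformlyOn_of_norm_sub_le
    (H := fun k t => polyCM r (rate (g k) t)) hv fun k t ht => by
      rw [← polyCM_sub]
      exact (norm_polyCM_le hr0 _).trans (hgv k t ht)
  have hF'c : ContinuousOn F' (Icc 0 T) :=
    hF'.continuousOn (.of_forall fun k => (hg k).continuousOn_polyCM_rate hr hμ r)
  obtain ⟨a, ha⟩ : ∃ a, Tendsto (fun k => polyCM r (g k 0)) atTop (𝓝 a) :=
    cauchySeq_tendsto_of_complete <| cauchySeq_of_dist_le_of_summable u (fun k => by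
      rw [dist_comm, dist_eq_norm, ← polyCM_sub]
      exact (norm_polyCM_le hr0 _).trans (hgu k)) hu
  obtain ⟨F, hF, hlim⟩ := exists_hasDerivWithinAt_of_tendstoUniformlyOn
    (G := fun k t => polyCM r (g k t)) hT
    (fun k t ht => (hg k).hasDerivWithinAt_polyCM hr hμ r ht) hF'c hF' ha
  exact ⟨F, F', hF'c, fun t ht => ⟨hF t ht, hlim t ht, hF'.tendsto_at ht⟩⟩

theorem exists_isStrongStar_limit (hT : 0 < T) (hr : 1 < r) (hμ : 0 < μ)
    (hg : ∀ k, PinchedSol r μ M (K k) T (g k))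
    (hω : ∀ k, ∀ t ∈ Icc 0 T, IsOmega (closedBall 0 r) (polyFun (g k) t)) (hu : Summable u)
    (hgu : ∀ k, wnorm r (g (k + 1) 0 - g k 0) ≤ u k) (hv : Summable v)
    (hgv : ∀ k, ∀ t ∈ Icc 0 T, wnorm r (rate (g (k + 1)) t - rate (g k) t) ≤ v k) :
    ∃ f : ℝ → ℂ → ℂ, IsStrongStar T f ∧ IsC1Open r T f ∧
      (∀ t ∈ Icc 0 T, IsOmega (ball 0 r) (f t)) ∧
      ∀ t ∈ Icc 0 T,
        TendstoUniformlyOn (fun k => polyFun (g k) t) (f t) atTop (closedBall 0 r) := by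
  obtain ⟨F, F', hF'c, hF⟩ :=
    exists_hasDerivWithinAt_tendsto_polyCM hT.le hr hμ hg hu hgu hv hgv
  set f : ℝ → ℂ → ℂ := fun t => extendZero r (F t)
  have hunif : ∀ t ∈ Icc 0 T,
      TendstoUniformlyOn (fun k => polyFun (g k) t) (f t) atTop (closedBall 0 r) :=
    fun t ht => tendstoUniformlyOn_extendZero (hF t ht).2.1
  have hloc : ∀ t ∈ Icc 0 T,
      TendstoLocallyUniformlyOn (fun k z => (g k t).eval z) (f t) atTop (ball 0 r) :=
    fun t ht => ((hunif t ht).mono ball_subset_closedBall).tendstoLocallyUniformlyOn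
  have hpin : ∀ t ∈ Icc 0 T, ∀ k, Pinched r μ M (derivative (g k t)) :=
    fun t ht k => (hg k).pinched t ht
  have hfω : ∀ t ∈ Icc 0 T, IsOmega (ball 0 r) (f t) := fun t ht =>
    isOmega_ball_of_tendsto (by linarith) hμ (hpin t ht) (hloc t ht) fun k => hω k t ht
  have hfF : ∀ t ∈ Icc 0 T, ∀ z : closedBall (0 : ℂ) r, F t z = f t z :=
    fun t _ z => (extendZero_coe (F t) z).symm
  have hequation : ∀ t ∈ Icc 0 T, ∀ ξ : closedBall (0 : ℂ) r, (ξ : ℂ) ∈ ball 0 1 →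
      F' t ξ = ξ * deriv (f t) ξ * poissonOp (fun z => 1 / ‖deriv (f t) z‖ ^ 2) ξ := by
    intro t ht ξ hξ
    refine tendsto_nhds_unique
      (((continuous_eval_const ξ).tendsto _).comp (hF t ht).2.2) ?_
    simp only [Function.comp_def, polyCM_apply, (hpin t ht _).rate_eval hr hμ hξ, deriv_polyFun]
    exact ((tendsto_eval_derivative (hloc t ht) (ball_subset_ball hr.le hξ)).const_mul _).mul
      (tendsto_poissonOp_of_pinched hr hμ (hpin t ht) (hloc t ht) hξ)
  refine ⟨f, ?_, ⟨fun t ht => (hfω t ht).analytic, F, hfF, ?_⟩, hfω, hunif⟩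
  · exact isStrongStar_of_hasDerivWithinAt hT hr.le (fun t ht => (hF t ht).1) hF'c hfF
      (fun t ht => (hfω t ht).mono (closedBall_subset_ball hr)) hequation
  · exact contDiffOn_one_of_hasDerivWithinAt (uniqueDiffOn_Icc hT) (fun t ht => (hF t ht).1) hF'c

end LimitSolution

section Truncations

theorem stepBound_le_stepBound_succ {ρ : ℝ} {k : ℕ} (hρ : 0 ≤ ρ) (hk : 0 < k) (k₀ j : ℕ) (b : ℂ) :
    stepBound k₀ ρ j k b ≤ stepBound k₀ ρ (j + 1) k b := by
  have : (1 : ℝ) ≤ k := by exact_mod_cast hk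
  unfold stepBound
  gcongr
  exact j.le_succ

theorem wnorm_X_mul (r : ℝ) (p : ℂ[X]) : wnorm r (X * p) = r * wnorm r p := by
  rw [wnorm_eq_mul_wnorm_divX (coeff_X_mul_zero p), divX_X_mul]

theorem iteratedDeriv_polyFun (g : ℝ → ℂ[X]) (t : ℝ) (j : ℕ) :
    iteratedDeriv j (polyFun g t) = fun z => (derivative^[j] (g t)).eval z :=
  iteratedDeriv_eval (g t) j

/-- Solutions `g k` for the truncations of the perturbation `∑ i, b i ξ^i` of an initial value:
`g (k + 1)` and `g k` differ by `b (k + 1) ξ^(k + 1)` at time `0`. -/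
structure TruncatedSol (r μ M : ℝ) (k₀ : ℕ) (T : ℝ) (b : ℕ → ℂ) (g : ℕ → ℝ → ℂ[X]) : Prop where
  pinchedSol : ∀ k, PinchedSol r μ M (max k k₀) T (g k)
  sub_at_zero : ∀ k, g (k + 1) 0 - g k 0 = C (b (k + 1)) * X ^ (k + 1)

namespace TruncatedSol

variable {r ρ μ M T t : ℝ} {k₀ : ℕ} {b : ℕ → ℂ} {g : ℕ → ℝ → ℂ[X]}

theorem pinchedSol_succ (h : TruncatedSol r μ M k₀ T b g) (k : ℕ) :
    PinchedSol r μ M (max (k + 1) k₀) T (g k) :=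
  (h.pinchedSol k).mono le_rfl (max_le_max_right _ k.le_succ)

theorem wnorm_derivative_sub_le (hr : 1 < r) (hρ : 0 < ρ) (hμ : 0 < μ) (hk₀ : 0 < k₀)
    (hTle : lipConst r μ M * k₀ * T ≤ Real.log (ρ / r)) (h : TruncatedSol r μ M k₀ T b g)
    (ht : t ∈ Icc 0 T) (k : ℕ) :
    wnorm r (derivative (g (k + 1) t - g k t)) ≤ stepBound k₀ ρ 1 (k + 1) (b (k + 1)) :=
  (h.pinchedSol (k + 1)).wnorm_derivative_sub_le_stepBound hr hρ hμ k.succ_pos hk₀ hTle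
    (h.pinchedSol_succ k) (h.sub_at_zero k) ht

theorem wnorm_iterate_derivative_sub_le (hr : 1 < r) (hρ : 0 < ρ) (hμ : 0 < μ) (hk₀ : 0 < k₀)
    (hTle : lipConst r μ M * k₀ * T ≤ Real.log (ρ / r)) (h : TruncatedSol r μ M k₀ T b g)
    (ht : t ∈ Icc 0 T) (j k : ℕ) :
    wnorm r (derivative^[j] (g (k + 1) t - g k t)) ≤
      (k₀ : ℝ) ^ j * stepBound k₀ ρ j (k + 1) (b (k + 1)) :=
  (h.pinchedSol (k + 1)).wnorm_iterate_derivative_sub_le_stepBound hr hρ hμ k.succ_pos hk₀ hTle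
    (h.pinchedSol_succ k) (h.sub_at_zero k) ht j

theorem wnorm_rate_sub_le (hr : 1 < r) (hρ : 0 < ρ) (hμ : 0 < μ) (hk₀ : 0 < k₀)
    (hTle : lipConst r μ M * k₀ * T ≤ Real.log (ρ / r)) (h : TruncatedSol r μ M k₀ T b g)
    (ht : t ∈ Icc 0 T) (k : ℕ) :
    wnorm r (rate (g (k + 1)) t - rate (g k) t) ≤
      r * (lipConst r μ M * stepBound k₀ ρ 1 (k + 1) (b (k + 1))) := by
  rw [rate, rate, ← mul_sub, wnorm_X_mul]
  gcongr
  exact (h.pinchedSol (k + 1)).wnorm_velocity_sub_le_stepBound hr hρ hμ k.succ_pos hk₀ hTle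
    (h.pinchedSol_succ k) (h.sub_at_zero k) ht

theorem exists_isStrongStar_limit (hT : 0 < T) (hr : 1 < r) (hρ : 0 < ρ) (hμ : 0 < μ)
    (hk₀ : 0 < k₀) (hTle : lipConst r μ M * k₀ * T ≤ Real.log (ρ / r))
    (h : TruncatedSol r μ M k₀ T b g)
    (hω : ∀ k, ∀ t ∈ Icc 0 T, IsOmega (closedBall 0 r) (polyFun (g k) t))
    (hb : Summable fun i => stepBound k₀ ρ 1 (i + 1) (b (i + 1))) :
    ∃ f : ℝ → ℂ → ℂ, IsStrongStar T f ∧ IsC1Open r T f ∧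
      (∀ t ∈ Icc 0 T, IsOmega (ball 0 r) (f t)) ∧
      ∀ t ∈ Icc 0 T,
        TendstoUniformlyOn (fun k => polyFun (g k) t) (f t) atTop (closedBall 0 r) := by
  refine HeleShaw.exists_isStrongStar_limit hT hr hμ h.pinchedSol hω hb (fun k => ?_)
    ((hb.mul_left _).mul_left _) fun k t ht => h.wnorm_rate_sub_le hr hρ hμ hk₀ hTle ht k
  have hstep := h.wnorm_iterate_derivative_sub_le hr hρ hμ hk₀ hTle (left_mem_Icc.2 hT.le) 0 k
  rw [pow_zero, one_mul] at hstep
  exact hstep.trans (stepBound_le_stepBound_succ hρ.le k.succ_pos k₀ 0 _)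

theorem mNorm_iteratedDeriv_sub_le (hr : 1 < r) (hρ : 0 < ρ) (hμ : 0 < μ) (hk₀ : 0 < k₀)
    (hTle : lipConst r μ M * k₀ * T ≤ Real.log (ρ / r)) (h : TruncatedSol r μ M k₀ T b g)
    {φ : ℂ → ℂ} (ht : t ∈ Icc 0 T)
    (hφ : TendstoLocallyUniformlyOn (fun k => polyFun (g k) t) φ atTop (ball 0 r)) (j : ℕ)
    (hb : Summable fun i => stepBound k₀ ρ j (i + 1) (b (i + 1))) :
    mNorm r (fun z => iteratedDeriv j φ z - iteratedDeriv j (polyFun (g 0) t) z) ≤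
      ENNReal.ofReal ((k₀ : ℝ) ^ j * ∑' i, stepBound k₀ ρ j (i + 1) (b (i + 1))) := by
  have hlim := HeleShaw.mNorm_iteratedDeriv_sub_le (by linarith) hφ j (hb.mul_left _)
    (fun k => h.wnorm_iterate_derivative_sub_le hr hρ hμ hk₀ hTle ht j k) 0
  simpa only [iteratedDeriv_polyFun, zero_add, tsum_mul_left] using hlim

theorem mNorm_deriv_sub_le (hr : 1 < r) (hρ : 0 < ρ) (hμ : 0 < μ) (hk₀ : 0 < k₀)
    (hTle : lipConst r μ M * k₀ * T ≤ Real.log (ρ / r)) (h : TruncatedSol r μ M k₀ T b g)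
    {φ : ℂ → ℂ} (ht : t ∈ Icc 0 T)
    (hφ : TendstoLocallyUniformlyOn (fun k => polyFun (g k) t) φ atTop (ball 0 r))
    (hb : Summable fun i => stepBound k₀ ρ 1 (i + 1) (b (i + 1))) (k : ℕ) :
    mNorm r (fun z => deriv φ z - deriv (polyFun (g k) t) z) ≤
      ENNReal.ofReal (∑' i, stepBound k₀ ρ 1 (k + i + 1) (b (k + i + 1))) := by
  have hlim := HeleShaw.mNorm_iteratedDeriv_sub_le (by linarith) hφ 1 hb
    (fun k => h.wnorm_derivative_sub_le hr hρ hμ hk₀ hTle ht k) k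
  simpa only [iteratedDeriv_one, Function.iterate_one, deriv_polyFun] using hlim

theorem tendsto_iSup_mNorm_deriv_sub (hr : 1 < r) (hρ : 0 < ρ) (hμ : 0 < μ) (hk₀ : 0 < k₀)
    (hTle : lipConst r μ M * k₀ * T ≤ Real.log (ρ / r)) (h : TruncatedSol r μ M k₀ T b g)
    {f : ℝ → ℂ → ℂ} (hf : ∀ t ∈ Icc 0 T,
      TendstoLocallyUniformlyOn (fun k => polyFun (g k) t) (f t) atTop (ball 0 r))
    (hb : Summable fun i => stepBound k₀ ρ 1 (i + 1) (b (i + 1))) :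
    Tendsto (fun k => ⨆ t ∈ Icc 0 T,
      mNorm r (fun z => deriv (polyFun (g k) t) z - deriv (f t) z)) atTop (𝓝 0) := by
  have htail := ENNReal.tendsto_ofReal
    (tendsto_tsum_tail fun i => stepBound k₀ ρ 1 (i + 1) (b (i + 1)))
  rw [ENNReal.ofReal_zero] at htail
  refine tendsto_of_tendsto_of_tendsto_of_le_of_le tendsto_const_nhds htail
    (fun _ => zero_le) fun k => iSup₂_le fun t ht => ?_
  rw [mNorm_sub_comm]
  exact h.mNorm_deriv_sub_le hr hρ hμ hk₀ hTle ht (hf t ht) hb k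

end TruncatedSol

end Truncations

/-! ### The perturbed solution -/

section Perturbation

variable {r ρ m M A' T : ℝ} {k₀ : ℕ}

theorem natDegree_pos_of_isOmega {E : Set ℂ} {p : ℝ → ℂ[X]} {t : ℝ}
    (h : IsOmega E (polyFun p t)) : 0 < (p t).natDegree := by
  by_contra! hdeg
  have hre := h.deriv_re
  rw [deriv_polyFun_zero, coeff_eq_zero_of_natDegree_lt (by omega)] at hre
  exact lt_irrefl _ hre

theorem ofReal_stepBound (k₀ j i : ℕ) (b : ℂ) :
    ENNReal.ofReal (stepBound k₀ ρ j (i + 1) b) = ENNReal.ofReal √k₀ *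
      ENNReal.ofReal (‖b‖ * ρ ^ (i + 1) * ((i : ℝ) + 1) ^ ((1 : ℝ) / 2 + (j : ℝ))) := by
  rw [← ENNReal.ofReal_mul (Real.sqrt_nonneg _), stepBound,
    Real.rpow_add (by positivity), Real.rpow_natCast, ← Real.sqrt_eq_rpow, Nat.cast_succ]

theorem tsum_ofReal_stepBound (k₀ j : ℕ) (v : ℂ → ℂ) :
    ∑' i, ENNReal.ofReal (stepBound k₀ ρ j (i + 1) (coeffAt v (i + 1))) =
      ENNReal.ofReal √k₀ * rhoNorm ρ j v := by
  simp only [ofReal_stepBound, ENNReal.tsum_mul_left, rhoNorm]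

theorem summable_stepBound (hρ : 0 ≤ ρ) {j : ℕ} {v : ℂ → ℂ} (hv : rhoNorm ρ j v ≠ ⊤) :
    Summable fun i => stepBound k₀ ρ j (i + 1) (coeffAt v (i + 1)) := by
  have htop := (tsum_ofReal_stepBound k₀ j v).trans_ne
    (ENNReal.mul_ne_top ENNReal.ofReal_ne_top hv)
  simpa only [ENNReal.toReal_ofReal (stepBound_nonneg hρ _ _ _ _)] using
    ENNReal.summable_toReal htop

theorem ofReal_tsum_stepBound (hρ : 0 ≤ ρ) {j : ℕ} {v : ℂ → ℂ} (hv : rhoNorm ρ j v ≠ ⊤) :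
    ENNReal.ofReal (∑' i, stepBound k₀ ρ j (i + 1) (coeffAt v (i + 1))) =
      ENNReal.ofReal √k₀ * rhoNorm ρ j v := by
  rw [← tsum_ofReal_stepBound, ENNReal.ofReal_tsum_of_nonneg
    (fun i => stepBound_nonneg hρ _ _ _ _) (summable_stepBound hρ hv)]

theorem tendsto_sum_coeffAt {v : ℂ → ℂ} (hv : DifferentiableOn ℂ v (ball 0 ρ)) (h0 : v 0 = 0)
    {z : ℂ} (hz : z ∈ ball 0 ρ) :
    Tendsto (fun k => (∑ i ∈ Finset.Icc 1 k, C (coeffAt v i) * X ^ i).eval z) atTop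
      (𝓝 (v z)) := by
  have hc0 : coeffAt v 0 = 0 := by simp [coeffAt, h0]
  refine ((tendsto_add_atTop_iff_nat 1).2 (hasSum_coeffAt hv hz).tendsto_sum_nat).congr fun k => ?_
  rw [Finset.sum_range_eq_add_Ico _ k.succ_pos, hc0, zero_mul, zero_add, eval_finsetSum]
  exact Finset.sum_congr rfl fun i _ => by simp

theorem im_coeff_one_sum {b : ℕ → ℂ} (hb : (b 1).im = 0) (k : ℕ) :
    ((∑ i ∈ Finset.Icc 1 k, C (b i) * X ^ i).coeff 1).im = 0 := by
  rw [finsetSum_coeff, Complex.im_sum]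
  refine Finset.sum_eq_zero fun i _ => ?_
  rw [coeff_C_mul_X_pow]
  split_ifs with h
  · rw [← h, hb]
  · rfl

theorem tendsto_eval_add_sum_coeffAt {f₀ : ℂ → ℂ} {q : ℂ[X]}
    (hf₀ : DifferentiableOn ℂ f₀ (ball 0 ρ)) (h0 : f₀ 0 = q.eval 0) {z : ℂ} (hz : z ∈ ball 0 ρ) :
    Tendsto (fun k => (q + ∑ i ∈ Finset.Icc 1 k,
      C (coeffAt (fun z => f₀ z - q.eval z) i) * X ^ i).eval z) atTop (𝓝 (f₀ z)) := by
  have hv : DifferentiableOn ℂ (fun z => f₀ z - q.eval z) (ball 0 ρ) :=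
    hf₀.sub q.differentiable.differentiableOn
  have hlim := (tendsto_sum_coeffAt hv (sub_eq_zero.2 h0) hz).const_add (q.eval z)
  rw [add_sub_cancel] at hlim
  simpa only [eval_add] using hlim

theorem im_coeff_one_add_sum_coeffAt {f₀ : ℂ → ℂ} {q : ℂ[X]} (hf₀ : DifferentiableAt ℂ f₀ 0)
    (him : (deriv f₀ 0).im = 0) (hq : (q.coeff 1).im = 0) (k : ℕ) :
    ((q + ∑ i ∈ Finset.Icc 1 k,
      C (coeffAt (fun z => f₀ z - q.eval z) i) * X ^ i).coeff 1).im = 0 := by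
  have hq' : deriv (fun z => q.eval z) 0 = q.coeff 1 := by
    rw [Polynomial.deriv, ← coeff_zero_eq_eval_zero, coeff_derivative]
    simp
  have hv : (coeffAt (fun z => f₀ z - q.eval z) 1).im = 0 := by
    rw [coeffAt, iteratedDeriv_one, deriv_fun_sub hf₀ q.differentiableAt, hq']
    simp [him, hq]
  rw [coeff_add, Complex.add_im, im_coeff_one_sum hv, hq, add_zero]

theorem re_coeff_one_pos_of_wnorm_derivative_sub_lt {p q : ℂ[X]} (hr : 0 ≤ r)
    (hp : Pinched r m M (derivative p)) (him : (p.coeff 1).im = 0) (hre : 0 < (p.coeff 1).re)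
    (hpq : wnorm r (derivative (q - p)) < m) : 0 < (q.coeff 1).re := by
  have h0 : ‖(0 : ℂ)‖ ≤ r := norm_zero.trans_le hr
  have hcoeff : ∀ s : ℂ[X], (derivative s).eval 0 = s.coeff 1 := fun s => by
    rw [← coeff_zero_eq_eval_zero, coeff_derivative]
    simp
  have hlow : m ≤ (p.coeff 1).re := by
    have hp1 : p.coeff 1 = ((p.coeff 1).re : ℂ) := Complex.ext rfl him
    have := hp.le_norm_eval 0 h0
    rwa [hcoeff, hp1, Complex.norm_real, Real.norm_of_nonneg hre.le] at this
  have hdiff := (norm_eval_le_wnorm _ h0).trans_lt hpq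
  rw [hcoeff, coeff_sub] at hdiff
  have := (abs_lt.1 ((Complex.abs_re_le_norm _).trans_lt hdiff)).1
  rw [Complex.sub_re] at this
  linarith

theorem TruncatedSol.isOmega {μ M' t : ℝ} {b : ℕ → ℂ} {g : ℕ → ℝ → ℂ[X]} (hr : 1 < r)
    (hρ : 0 < ρ) (hμ : 0 < μ) (hk₀ : 0 < k₀) (hTle : lipConst r μ M' * k₀ * T ≤ Real.log (ρ / r))
    (h : TruncatedSol r μ M' k₀ T b g) (ht : t ∈ Icc 0 T)
    (hb : Summable fun i => stepBound k₀ ρ 1 (i + 1) (b (i + 1)))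
    (hbm : ∑' i, stepBound k₀ ρ 1 (i + 1) (b (i + 1)) < m)
    (hpin : Pinched r m M (derivative (g 0 t))) (hω : IsOmega (closedBall 0 r) (polyFun (g 0) t))
    {k : ℕ} (him : ((g k 0).coeff 1).im = 0) : IsOmega (closedBall 0 r) (polyFun (g k) t) := by
  have hr0 : 0 ≤ r := by linarith
  have hclose : wnorm r (derivative (g k t - g 0 t)) < m := by
    have hsum := wnorm_sub_le_tsum (q := fun k => derivative (g k t)) hr0 hb (fun k => by
      rw [← Polynomial.derivative_sub]
      exact h.wnorm_derivative_sub_le hr hρ hμ hk₀ hTle ht k) k.zero_le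
    rw [← Polynomial.derivative_sub] at hsum
    simp only [zero_add] at hsum
    exact hsum.trans_lt hbm
  have hre := hω.deriv_re
  have him' := hω.deriv_im
  rw [deriv_polyFun_zero] at hre him'
  exact (h.pinchedSol k).isOmega hμ ht ((h.pinchedSol k).im_coeff_one hr hμ him t ht)
    (re_coeff_one_pos_of_wnorm_derivative_sub_lt hr0 hpin him' hre hclose)

theorem exists_truncatedSol {p : ℝ → ℂ[X]} {b : ℕ → ℂ} (hr : 1 < r) (hρ : 0 < ρ) (hA' : A' < m)
    (hk₀ : 0 < k₀) (hT : 0 ≤ T) (hTle : lipConst r (m - A') (M + A') * k₀ * T ≤ Real.log (ρ / r))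
    (hp : PinchedSol r m M k₀ T p)
    (hb : Summable fun i => stepBound k₀ ρ 1 (i + 1) (b (i + 1)))
    (hbA' : ∑' i, stepBound k₀ ρ 1 (i + 1) (b (i + 1)) < A') :
    ∃ g : ℕ → ℝ → ℂ[X], g 0 = p ∧ TruncatedSol r (m - A') (M + A') k₀ T b g ∧
      ∀ k, g k 0 = p 0 + ∑ i ∈ Finset.Icc 1 k, C (b i) * X ^ i := by
  obtain ⟨g, hg0, hg⟩ := exists_pinchedSol_seq hr hρ hA' hbA' hk₀ hT hTle hp fun k =>
    hb.sum_le_tsum _ fun i _ => stepBound_nonneg hρ.le _ _ _ _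
  refine ⟨g, hg0, ⟨fun k => (hg k).1, fun k => ?_⟩, fun k => ?_⟩
  · rw [(hg (k + 1)).2, (hg k).2, Finset.sum_range_succ, add_sub_add_left_eq_sub,
      add_sub_cancel_left]
  · rw [(hg k).2, Finset.range_eq_Ico, Finset.sum_Ico_add' (fun i => C (b i) * X ^ i) 0 k 1]
    rfl

theorem exists_perturbed_solution {p : ℝ → ℂ[X]} {f₀ : ℂ → ℂ} (hr : 1 < r) (hρ : r < ρ)
    (hA' : A' < m) (hk₀ : 0 < k₀) (hT : 0 < T)
    (hTle : lipConst r (m - A') (M + A') * k₀ * T ≤ Real.log (ρ / r))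
    (hp : PinchedSol r m M k₀ T p)
    (hω : ∀ t ∈ Icc 0 T, IsOmega (closedBall 0 r) (polyFun p t))
    (hf₀ : AnalyticOnNhd ℂ f₀ (ball 0 ρ)) (h0 : f₀ 0 = 0) (him : (deriv f₀ 0).im = 0)
    (hvA' : ENNReal.ofReal √k₀ * rhoNorm ρ 1 (fun z => f₀ z - polyFun p 0 z) < ENNReal.ofReal A') :
    ∃ f : ℝ → ℂ → ℂ, (∀ z ∈ closedBall (0 : ℂ) r, f 0 z = f₀ z) ∧
      IsStrongStar T f ∧ IsC1Open r T f ∧ (∀ t ∈ Icc 0 T, IsOmega (ball 0 r) (f t)) ∧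
      (∀ t ∈ Icc 0 T, mNorm r (fun z => deriv (f t) z - deriv (polyFun p t) z) ≤
        ENNReal.ofReal √k₀ * rhoNorm ρ 1 (fun z => f₀ z - polyFun p 0 z)) ∧
      (∃ g : ℕ → ℝ → ℂ[X],
        (∀ k, g k 0 = p 0 + ∑ i ∈ Finset.Icc 1 k,
          C (coeffAt (fun z => f₀ z - polyFun p 0 z) i) * X ^ i) ∧
        (∀ k, IsStrongStar T (polyFun (g k))) ∧ (∀ k, IsC1Closed r T (polyFun (g k))) ∧
        (∀ k, ∀ t ∈ Icc 0 T, IsOmega (closedBall 0 r) (polyFun (g k) t)) ∧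
        Tendsto (fun k => ⨆ t ∈ Icc 0 T,
          mNorm r (fun z => deriv (polyFun (g k) t) z - deriv (f t) z)) atTop (𝓝 0)) ∧
      ∀ j, rhoNorm ρ j (fun z => f₀ z - polyFun p 0 z) ≠ ⊤ → ∀ t ∈ Icc 0 T,
        mNorm r (fun z => iteratedDeriv j (f t) z - iteratedDeriv j (polyFun p t) z) ≤
          ENNReal.ofReal ((k₀ : ℝ) ^ j) *
            (ENNReal.ofReal √k₀ * rhoNorm ρ j (fun z => f₀ z - polyFun p 0 z)) := by
  have hρ0 : 0 < ρ := by linarith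
  have hμ : 0 < m - A' := sub_pos.2 hA'
  have h0T : (0 : ℝ) ∈ Icc 0 T := left_mem_Icc.2 hT.le
  have htop : rhoNorm ρ 1 (fun z => f₀ z - polyFun p 0 z) ≠ ⊤ := fun h => by
    rw [h, ENNReal.mul_top (by simpa using hk₀)] at hvA'
    exact not_top_lt hvA'
  have hb := summable_stepBound (k₀ := k₀) hρ0.le htop
  rw [← ofReal_tsum_stepBound hρ0.le htop] at hvA'
  have hbA' := (ENNReal.ofReal_lt_ofReal_iff_of_nonneg
    (tsum_nonneg fun i => stepBound_nonneg hρ0.le _ _ _ _)).1 hvA'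
  obtain ⟨g, rfl, htr, hg⟩ := exists_truncatedSol hr hρ0 hA' hk₀ hT.le hTle hp hb hbA'
  have him₀ := (hω 0 h0T).deriv_im
  rw [deriv_polyFun_zero] at him₀
  have hgω : ∀ k, ∀ t ∈ Icc 0 T, IsOmega (closedBall 0 r) (polyFun (g k) t) := fun k t ht =>
    htr.isOmega hr hρ0 hμ hk₀ hTle ht hb (hbA'.trans hA') (hp.pinched t ht) (hω t ht)
      (hg k ▸ im_coeff_one_add_sum_coeffAt (hf₀ 0 (mem_ball_self hρ0)).differentiableAt him him₀ k)
  obtain ⟨f, hfs, hfc, hfω, hunif⟩ := htr.exists_isStrongStar_limit hT hr hρ0 hμ hk₀ hTle hgω hb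
  have hloc := fun t ht => ((hunif t ht).mono ball_subset_closedBall).tendstoLocallyUniformlyOn
  refine ⟨f, fun z hz => ?_, hfs, hfc, hfω, fun t ht => ?_, ⟨g, hg,
    fun k => (htr.pinchedSol k).isStrongStar hT hr hμ (hgω k),
    fun k => (htr.pinchedSol k).isC1Closed hT hr hμ, hgω,
    htr.tendsto_iSup_mNorm_deriv_sub hr hρ0 hμ hk₀ hTle hloc hb⟩, fun j hj t ht => ?_⟩
  · refine tendsto_nhds_unique ((hunif 0 h0T).tendsto_at hz)
      ((tendsto_eval_add_sum_coeffAt hf₀.differentiableOn (h0.trans (hω 0 h0T).map_zero.symm)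
        (closedBall_subset_ball hρ hz)).congr fun k => ?_)
    exact congrArg (eval z) (hg k).symm
  · rw [← ofReal_tsum_stepBound hρ0.le htop]
    refine (htr.mNorm_deriv_sub_le hr hρ0 hμ hk₀ hTle ht (hloc t ht) hb 0).trans_eq ?_
    exact congrArg _ (tsum_congr fun i => by rw [zero_add])
  · rw [← ofReal_tsum_stepBound hρ0.le hj, ← ENNReal.ofReal_mul (by positivity)]
    exact htr.mNorm_iteratedDeriv_sub_le hr hρ0 hμ hk₀ hTle ht (hloc t ht) j
      (summable_stepBound hρ0.le hj)

end Perturbation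

section Constants

variable {ρ l m C L t₀ δ : ℝ} {k₀ : ℕ}

theorem sqrt_mul_rhoNorm_le (hk₀ : 0 < k₀) {n : ℕ} {v : ℂ → ℂ}
    (h : rhoNorm ρ n v ≤ ENNReal.ofReal (l / √k₀ * m)) :
    ENNReal.ofReal √k₀ * rhoNorm ρ n v ≤ ENNReal.ofReal (l * m) := by
  have hsqrt : 0 < √(k₀ : ℝ) := by positivity
  calc ENNReal.ofReal √k₀ * rhoNorm ρ n v
      ≤ ENNReal.ofReal √k₀ * ENNReal.ofReal (l / √k₀ * m) := by gcongr
    _ = ENNReal.ofReal (l * m) := by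
        rw [← ENNReal.ofReal_mul hsqrt.le]
        congr 1
        field_simp

theorem pow_mul_sqrt_mul_rhoNorm_le (hδ : 0 ≤ δ) {n : ℕ} {v : ℂ → ℂ}
    (h : rhoNorm ρ n v ≤ ENNReal.ofReal δ) :
    ENNReal.ofReal ((k₀ : ℝ) ^ n) * (ENNReal.ofReal √k₀ * rhoNorm ρ n v) ≤
      ENNReal.ofReal (((k₀ : ℝ) + 1) ^ (n + 1) * δ) := by
  have hsqrt : √(k₀ : ℝ) ≤ k₀ + 1 :=
    (Real.sqrt_le_left (by positivity)).2 (by nlinarith [k₀.cast_nonneg (α := ℝ)])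
  calc ENNReal.ofReal ((k₀ : ℝ) ^ n) * (ENNReal.ofReal √k₀ * rhoNorm ρ n v)
      ≤ ENNReal.ofReal ((k₀ : ℝ) ^ n) * (ENNReal.ofReal √k₀ * ENNReal.ofReal δ) := by gcongr
    _ = ENNReal.ofReal ((k₀ : ℝ) ^ n * √k₀ * δ) := by
        rw [ENNReal.ofReal_mul (by positivity), ENNReal.ofReal_mul (by positivity), mul_assoc]
    _ ≤ ENNReal.ofReal (((k₀ : ℝ) + 1) ^ (n + 1) * δ) := by
        rw [pow_succ]
        gcongr
        exact le_add_of_nonneg_right zero_le_one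

theorem lifespan_spec {r t₁ : ℝ} (hr : 0 < r) (hρ : r < ρ) (ht₁ : 0 < t₁) (hL : L ≤ C)
    (hC : 0 < C) (hk₀ : 0 < k₀) (ht₀ : t₀ = min (1 / (C * k₀) * Real.log (ρ / r)) t₁) :
    0 < t₀ ∧ t₀ ≤ t₁ ∧ L * k₀ * t₀ ≤ Real.log (ρ / r) := by
  have hlog : 0 < Real.log (ρ / r) := Real.log_pos ((one_lt_div hr).2 hρ)
  have : 0 < C * k₀ := by positivity
  have hpos : 0 < t₀ := by
    rw [ht₀]
    positivity
  refine ⟨hpos, ht₀.trans_le (min_le_right _ _), ?_⟩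
  calc L * k₀ * t₀ ≤ C * k₀ * t₀ := by gcongr
    _ ≤ C * k₀ * (1 / (C * k₀) * Real.log (ρ / r)) := by
        gcongr
        exact ht₀.trans_le (min_le_left _ _)
    _ = Real.log (ρ / r) := by field_simp

theorem exists_pinchedSol_of_isStrongStar {r T : ℝ} {p : ℝ → ℂ[X]} (hr : 0 ≤ r) (hT : 0 ≤ T)
    (hdeg : ∀ t ∈ Icc 0 T, (p t).natDegree = k₀)
    (hω : ∀ t ∈ Icc 0 T, IsOmega (closedBall 0 r) (polyFun p t))
    (hp : IsStrongStar T (polyFun p)) :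
    0 < k₀ ∧ 0 < minDeriv r T (polyFun p) ∧
      ∃ M, PinchedSol r (minDeriv r T (polyFun p)) M k₀ T p := by
  have h0 := left_mem_Icc.2 hT
  exact ⟨hdeg 0 h0 ▸ natDegree_pos_of_isOmega (hω 0 h0),
    (polySol_of_isStrongStar (fun t ht => (hdeg t ht).le) hp).exists_pinchedSol_minDeriv hT hr hω⟩

end Constants

end HeleShaw

end

theorem mainTheorem2 :
    ∃ c : ℕ → ℕ → ℝ, (∀ j k, 0 < c j k) ∧
    ∀ (k₀ : ℕ) (r t₁ l : ℝ) (p : ℝ → ℂ[X]),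
      1 < r → 0 < t₁ → l < 1 →
      (∀ t ∈ Icc 0 t₁, (p t).natDegree = k₀) →
      HeleShaw.IsC1Closed r t₁ (HeleShaw.polyFun p) →
      (∀ t ∈ Icc 0 t₁, HeleShaw.IsOmega (closedBall 0 r) (HeleShaw.polyFun p t)) →
      HeleShaw.IsStrongStar t₁ (HeleShaw.polyFun p) →
    ∃ C : ℝ, 0 < C ∧
    ∀ (ρ : ℝ) (f₀ : ℂ → ℂ),
      r < ρ →
      AnalyticOnNhd ℂ f₀ (ball 0 ρ) →
      f₀ 0 = 0 →
      (deriv f₀ 0).im = 0 →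
      HeleShaw.rhoNorm ρ 1 (fun z => f₀ z - HeleShaw.polyFun p 0 z) ≤
        ENNReal.ofReal (l / √(k₀ : ℝ) * HeleShaw.minDeriv r t₁ (HeleShaw.polyFun p)) →
    ∀ t₀ : ℝ, t₀ = min (1 / (C * k₀) * Real.log (ρ / r)) t₁ →
    ∃ f : ℝ → ℂ → ℂ,
      -- the perturbed solution
      (∀ z ∈ closedBall (0 : ℂ) r, f 0 z = f₀ z) ∧
      HeleShaw.IsStrongStar t₀ f ∧
      HeleShaw.IsC1Open r t₀ f ∧
      (∀ t ∈ Icc 0 t₀, HeleShaw.IsOmega (ball 0 r) (f t)) ∧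
      (∀ t ∈ Icc 0 t₀,
        HeleShaw.mNorm r (fun z => deriv (f t) z - deriv (HeleShaw.polyFun p t) z) ≤
          ENNReal.ofReal (l * HeleShaw.minDeriv r t₁ (HeleShaw.polyFun p))) ∧
      -- it is the limit of the polynomial solutions that start from the truncated data
      (∃ g : ℕ → ℝ → ℂ[X],
        (∀ k, g k 0 = p 0 + ∑ i ∈ Finset.Icc 1 k,
            Polynomial.C (HeleShaw.coeffAt (fun z => f₀ z - HeleShaw.polyFun p 0 z) i) * X ^ i) ∧
        (∀ k, HeleShaw.IsStrongStar t₀ (HeleShaw.polyFun (g k))) ∧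
        (∀ k, HeleShaw.IsC1Closed r t₀ (HeleShaw.polyFun (g k))) ∧
        (∀ k, ∀ t ∈ Icc 0 t₀, HeleShaw.IsOmega (closedBall 0 r) (HeleShaw.polyFun (g k) t)) ∧
        Tendsto (fun k => ⨆ t ∈ Icc 0 t₀,
            HeleShaw.mNorm r (fun z => deriv (HeleShaw.polyFun (g k) t) z - deriv (f t) z))
          atTop (𝓝 0)) ∧
      -- the estimates of the derivatives of order `j`
      (∀ (j : ℕ) (δ : ℝ), 0 < δ →
        HeleShaw.rhoNorm ρ j (fun z => f₀ z - HeleShaw.polyFun p 0 z) ≤ ENNReal.ofReal δ →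
        ∀ t ∈ Icc 0 t₀,
          HeleShaw.mNorm r (fun z => iteratedDeriv j (f t) z -
              iteratedDeriv j (HeleShaw.polyFun p t) z) ≤
            ENNReal.ofReal (c j k₀ * δ)) := by
  refine ⟨fun j k => ((k : ℝ) + 1) ^ (j + 1), fun j k => by positivity, ?_⟩
  intro k₀ r t₁ l p hr ht₁ hl hdeg _ hω hp
  have hr0 : 0 < r := one_pos.trans hr
  obtain ⟨hk₀, hm, M, hpin⟩ :=
    HeleShaw.exists_pinchedSol_of_isStrongStar hr0.le ht₁.le hdeg hω hp
  set m := HeleShaw.minDeriv r t₁ (HeleShaw.polyFun p)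
  obtain ⟨A', hA', hA'm⟩ := exists_between (max_lt hm (mul_lt_of_lt_one_left hm hl))
  obtain ⟨hA'0, hlA'⟩ := max_lt_iff.1 hA'
  obtain ⟨C, hC⟩ := exists_gt (max 0 (HeleShaw.lipConst r (m - A') (M + A')))
  obtain ⟨hC0, hLC⟩ := max_lt_iff.1 hC
  refine ⟨C, hC0, fun ρ f₀ hρ hf₀ h0 him hsmall t₀ ht₀ => ?_⟩
  obtain ⟨ht₀pos, ht₀t₁, hLt₀⟩ := HeleShaw.lifespan_spec hr0 hρ ht₁ hLC.le hC0 hk₀ ht₀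
  have hclose := HeleShaw.sqrt_mul_rhoNorm_le hk₀ hsmall
  obtain ⟨f, hinit, hsol, hC1, hωf, hderiv, htrunc, hiter⟩ :=
    HeleShaw.exists_perturbed_solution hr hρ hA'm hk₀ ht₀pos hLt₀ (hpin.mono ht₀t₁ le_rfl)
      (fun t ht => hω t ⟨ht.1, ht.2.trans ht₀t₁⟩) hf₀ h0 him
      (hclose.trans_lt ((ENNReal.ofReal_lt_ofReal_iff hA'0).2 hlA'))
  exact ⟨f, hinit, hsol, hC1, hωf, fun t ht => (hderiv t ht).trans hclose, htrunc,
    fun j δ hδ hj t ht => (hiter j (ne_top_of_le_ne_top ENNReal.ofReal_ne_top hj) t ht).trans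
      (HeleShaw.pow_mul_sqrt_mul_rhoNorm_le hδ.le hj)⟩
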